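/- **Setting.** A concurrent program consists of finitely many threads, each with finitely many registers, an initial label and a finite set of labelled instructions "$l$: instr; goto $l'$", over a domain $\mathrm{DOM}\ni 0$ of values and addresses. Instructions are loads $r\leftarrow \mathrm{mem}[e]$, stores $\mathrm{mem}[e]\leftarrow e'$, assignments $r\leftarrow e$, assertions $\texttt{assert}\ e$ (executable if $e\neq 0$), $\texttt{scfence}$, and the lightweight $\texttt{fence}\ e_1\dots e_n$; an expression is a function $\mathrm{DOM}^*\to\mathrm{DOM}$ applied to registers of the thread. Registers and memory are initially $0$. Each thread has one FIFO buffer per address and one further FIFO buffer for all addresses. Executing a store (an *issue* action) appends it to the buffer of its address; at any time the oldest store of a per-address buffer may silently move to the end of the thread's all-addresses buffer, and the oldest store of the all-addresses buffer may be written to memory (a *store* action). A load reads the most recent store to its address buffered by its own thread (per-address buffer first, then all-addresses buffer), or memory if there is none. An $\texttt{scfence}$ is executable only if all buffers of its thread are empty. A $\texttt{fence}\ a_1\dots a_n$ can be issued only if the thread's buffers for $a_1,\dots,a_n$ are empty; it is then appended to the all-addresses buffer and later leaves it by a *fence* action. A *computation* is a sequence of actions leading from the initial state to a state in which all buffers are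 empty; each store or fence action is matched with the issue it stems from. A computation is *SC* if every issue is immediately followed by its store or fence action. The *trace* of a computation is the labelled directed graph whose nodes are its actions, an issue and its store or fence being one node labelled by the latter, with four kinds of edges: program order (the order of actions of one thread, stores and fences being placed at their issue), store order (the order in which stores to the same address reach memory), source (from the store whose value a load reads to that load), and conflict (from a load to each store that is later in store order than its source; and, if a load reads the initial value, to the first store to its address). A program is *robust* if every trace of a computation is the trace of an SC computation. A *violation* is a computation whose trace is not the trace of any SC computation. A store of a computation is *delayed* if some action of the same thread lies between its issue and the store action. **Theorem (Singularity).** Consider a program that does not contain the lightweight $\texttt{fence}$ instruction ($\texttt{scfence}$ is allowed). The program is not robust if and only if it has a violation with exactly one delayed store. -/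

import Mathlib

/-! Concurrent programs over a store-atomic relaxed memory architecture with per-thread,
per-address FIFO buffers feeding per-thread all-addresses FIFO buffers; computations,
happens-before traces, robustness, violations and delayed stores. -/

namespace StoreAtomic

universe u v w x

/-! ### Syntax -/

/-- An expression `f(r₁, …, rₖ)`: a function on words over the domain, applied to registers. -/
structure Expr (Dom : Type u) (Reg : Type v) where
  func : List Dom → Dom
  args : List Reg

/-- The value of an expression under a register valuation. -/
def Expr.eval {Dom : Type u} {Reg : Type v} (e : Expr Dom Reg) (ρ : Reg → Dom) : Dom :=
  e.func (e.args.map ρ)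

/-- Instructions of a thread with registers `Reg`. -/
inductive Instr (Dom : Type u) (Reg : Type v) where
  /-- `r ← mem[e]` -/
  | load (r : Reg) (addr : Expr Dom Reg)
  /-- `mem[e] ← e'` -/
  | store (addr val : Expr Dom Reg)
  /-- `r ← e` -/
  | assign (r : Reg) (e : Expr Dom Reg)
  /-- `assert e` -/
  | assert (e : Expr Dom Reg)
  /-- `scfence` -/
  | scfence
  /-- the lightweight `fence e₁ … eₙ` -/
  | fence (addrs : List (Expr Dom Reg))

/-- A concurrent program with data and address domain `Dom`, threads `T`, registers `R t` of
thread `t`, and labels `L`. A triple `(l, i, l')` in `code t` is the labelled instruction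
`l: i; goto l'`; several instructions may carry the same label. -/
structure Program (Dom : Type u) (T : Type v) (R : T → Type w) (L : Type x) where
  /-- initial label of each thread -/
  init : T → L
  /-- labelled instructions of each thread -/
  code : (t : T) → Set (L × Instr Dom (R t) × L)
  finite_code : ∀ t, (code t).Finite

/-- The program does not use the lightweight `fence` instruction (`scfence` is allowed). -/
def Program.NoFence {Dom : Type u} {T : Type v} {R : T → Type w} {L : Type x}
    (P : Program Dom T R L) : Prop :=
  ∀ t l es l', (l, Instr.fence es, l') ∉ P.code t

/-! ### Actions and events -/

/-- The operation performed by an action. -/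
inductive Op (Dom : Type u) where
  /-- a store of value `v` to address `a` reaches the memory -/
  | st (a v : Dom)
  /-- a load from address `a` returns value `v` -/
  | ld (a v : Dom)
  /-- issue of a store or fence -/
  | isu
  /-- local assignment or assertion -/
  | loc
  | scfence
  /-- a lightweight fence leaves the buffers -/
  | fence (as : List Dom)

/-- An occurrence of an action `(thread, op)` in a computation. The number `idx` tells which
instruction instance of the thread the action belongs to (instances are numbered in the order
in which the thread executes them), so that the issue `isu_x` and the store or fence `x` that it
corresponds to have the same `thread` and `idx`. -/
structure Event (Dom : Type u) (T : Type v) where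
  thread : T
  idx : ℕ
  op : Op Dom

section Events

variable {Dom : Type u} {T : Type v}

/-- The instruction instance an event belongs to; this is its node in the trace. -/
def Event.node (e : Event Dom T) : T × ℕ := (e.thread, e.idx)

def Event.IsIssue (e : Event Dom T) : Prop := e.op = Op.isu

def Event.LoadsFrom (e : Event Dom T) (a : Dom) : Prop := ∃ v, e.op = Op.ld a v

def Event.StoresTo (e : Event Dom T) (a : Dom) : Prop := ∃ v, e.op = Op.st a v

def Event.IsStore (e : Event Dom T) : Prop := ∃ a, e.StoresTo a

def Event.IsFence (e : Event Dom T) : Prop := ∃ as, e.op = Op.fence as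

end Events

/-! ### States and transitions -/

/-- Content of an all-addresses buffer cell: a store `a ← v` or a fence. -/
inductive Entry (Dom : Type u) where
  | store (a v : Dom)
  | fence (as : List Dom)

open Classical in
/-- The value of a buffered store if it goes to address `a`. -/
noncomputable def Entry.valueAt {Dom : Type u} (a : Dom) : Entry Dom → Option Dom
  | .store b v => if b = a then some v else none
  | .fence _ => none

/-- A state of the architecture. Buffers list the oldest element first. Buffered elements carry
the number of the instruction instance that issued them. -/
structure State (Dom : Type u) (T : Type v) (R : T → Type w) (L : Type x) where
  pc : T → L
  reg : (t : T) → R t → Dom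
  mem : Dom → Dom
  /-- per-thread and per-address buffers -/
  buf₁ : T → Dom → List (Dom × ℕ)
  /-- per-thread all-addresses buffers -/
  buf₂ : T → List (Entry Dom × ℕ)
  /-- number of instruction instances executed so far by each thread -/
  count : T → ℕ

section Semantics

variable {Dom : Type u} {T : Type v} {R : T → Type w} {L : Type x}

/-- All registers and addresses hold `0`, all buffers are empty. -/
def Program.initState [Zero Dom] (P : Program Dom T R L) : State Dom T R L where
  pc := P.init
  reg := fun _ _ => 0
  mem := fun _ => 0
  buf₁ := fun _ _ => []
  buf₂ := fun _ => []
  count := fun _ => 0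

/-- The buffers of thread `t` are empty. -/
def State.BuffersEmpty (s : State Dom T R L) (t : T) : Prop :=
  s.buf₂ t = [] ∧ ∀ a, s.buf₁ t a = []

/-- Values of the stores to address `a` in the all-addresses buffer of thread `t`. -/
noncomputable def State.stores₂ (s : State Dom T R L) (t : T) (a : Dom) : List Dom :=
  (s.buf₂ t).filterMap fun c => c.1.valueAt a

/-- A load of thread `t` from address `a` returns `v` in state `s`. -/
inductive State.Reads (s : State Dom T R L) (t : T) (a : Dom) : Dom → Prop where
  | early₁ (β : List (Dom × ℕ)) (v : Dom) (i : ℕ) (h₁ : s.buf₁ t a = β ++ [(v, i)]) :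
      State.Reads s t a v
  | early₂ (β : List Dom) (v : Dom) (h₁ : s.buf₁ t a = []) (h₂ : s.stores₂ t a = β ++ [v]) :
      State.Reads s t a v
  | memory (h₁ : s.buf₁ t a = []) (h₂ : s.stores₂ t a = []) :
      State.Reads s t a (s.mem a)

open Classical in
/-- Thread `t` executes an instruction and moves on to label `l'`. -/
noncomputable def State.goto (s : State Dom T R L) (t : T) (l' : L) : State Dom T R L :=
  { s with
    pc := Function.update s.pc t l'
    count := Function.update s.count t (s.count t + 1) }

open Classical in
noncomputable def State.setReg (s : State Dom T R L) (t : T) (r : R t) (v : Dom) :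
    State Dom T R L :=
  { s with reg := Function.update s.reg t (Function.update (s.reg t) r v) }

open Classical in
noncomputable def State.setMem (s : State Dom T R L) (a v : Dom) : State Dom T R L :=
  { s with mem := Function.update s.mem a v }

open Classical in
noncomputable def State.setBuf₁ (s : State Dom T R L) (t : T) (a : Dom) (β : List (Dom × ℕ)) :
    State Dom T R L :=
  { s with buf₁ := Function.update s.buf₁ t (Function.update (s.buf₁ t) a β) }

open Classical in
noncomputable def State.setBuf₂ (s : State Dom T R L) (t : T) (γ : List (Entry Dom × ℕ)) :
    State Dom T R L :=
  { s with buf₂ := Function.update s.buf₂ t γ }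

/-- The transition relation; the label `none` is the empty word. -/
inductive Program.Step [Zero Dom] (P : Program Dom T R L) :
    State Dom T R L → Option (Event Dom T) → State Dom T R L → Prop where
  | load (s : State Dom T R L) (t : T) (l' : L) (r : R t) (e : Expr Dom (R t)) (v : Dom)
      (hi : (s.pc t, Instr.load r e, l') ∈ P.code t)
      (hv : s.Reads t (e.eval (s.reg t)) v) :
      Program.Step P s (some ⟨t, s.count t, Op.ld (e.eval (s.reg t)) v⟩)
        ((s.goto t l').setReg t r v)
  | issueStore (s : State Dom T R L) (t : T) (l' : L) (ea ev : Expr Dom (R t)) (a v : Dom)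
      (hi : (s.pc t, Instr.store ea ev, l') ∈ P.code t)
      (ha : a = ea.eval (s.reg t)) (hv : v = ev.eval (s.reg t)) :
      Program.Step P s (some ⟨t, s.count t, Op.isu⟩)
        ((s.goto t l').setBuf₁ t a (s.buf₁ t a ++ [(v, s.count t)]))
  | advance (s : State Dom T R L) (t : T) (a v : Dom) (i : ℕ) (β : List (Dom × ℕ))
      (hb : s.buf₁ t a = (v, i) :: β) :
      Program.Step P s none
        ((s.setBuf₁ t a β).setBuf₂ t (s.buf₂ t ++ [(Entry.store a v, i)]))
  | storeToMemory (s : State Dom T R L) (t : T) (a v : Dom) (i : ℕ) (β : List (Entry Dom × ℕ))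
      (hb : s.buf₂ t = (Entry.store a v, i) :: β) :
      Program.Step P s (some ⟨t, i, Op.st a v⟩) ((s.setMem a v).setBuf₂ t β)
  | scfence (s : State Dom T R L) (t : T) (l' : L)
      (hi : (s.pc t, Instr.scfence, l') ∈ P.code t)
      (hb : s.BuffersEmpty t) :
      Program.Step P s (some ⟨t, s.count t, Op.scfence⟩) (s.goto t l')
  | issueFence (s : State Dom T R L) (t : T) (l' : L) (es : List (Expr Dom (R t)))
      (as : List Dom)
      (hi : (s.pc t, Instr.fence es, l') ∈ P.code t)
      (ha : as = es.map fun e => e.eval (s.reg t))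
      (hb : ∀ a ∈ as, s.buf₁ t a = []) :
      Program.Step P s (some ⟨t, s.count t, Op.isu⟩)
        ((s.goto t l').setBuf₂ t (s.buf₂ t ++ [(Entry.fence as, s.count t)]))
  | fence (s : State Dom T R L) (t : T) (as : List Dom) (i : ℕ) (β : List (Entry Dom × ℕ))
      (hb : s.buf₂ t = (Entry.fence as, i) :: β) :
      Program.Step P s (some ⟨t, i, Op.fence as⟩) (s.setBuf₂ t β)
  | assign (s : State Dom T R L) (t : T) (l' : L) (r : R t) (e : Expr Dom (R t))
      (hi : (s.pc t, Instr.assign r e, l') ∈ P.code t) :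
      Program.Step P s (some ⟨t, s.count t, Op.loc⟩)
        ((s.goto t l').setReg t r (e.eval (s.reg t)))
  | assert (s : State Dom T R L) (t : T) (l' : L) (e : Expr Dom (R t))
      (hi : (s.pc t, Instr.assert e, l') ∈ P.code t)
      (he : e.eval (s.reg t) ≠ 0) :
      Program.Step P s (some ⟨t, s.count t, Op.loc⟩) (s.goto t l')

/-- `P.Reaches τ s`: the sequence `τ` leads from the initial state to `s`. -/
inductive Program.Reaches [Zero Dom] (P : Program Dom T R L) :
    List (Event Dom T) → State Dom T R L → Prop where
  | init : Program.Reaches P [] P.initState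
  | silent {τ : List (Event Dom T)} {s s' : State Dom T R L}
      (h : Program.Reaches P τ s) (hs : P.Step s none s') : Program.Reaches P τ s'
  | act {τ : List (Event Dom T)} {s s' : State Dom T R L} {e : Event Dom T}
      (h : Program.Reaches P τ s) (hs : P.Step s (some e) s') :
      Program.Reaches P (τ ++ [e]) s'

/-- The relaxed computations: sequences that lead from the initial state to a state with
empty buffers. -/
def Program.Comp [Zero Dom] (P : Program Dom T R L) : Set (List (Event Dom T)) :=
  {τ | ∃ s, P.Reaches τ s ∧ ∀ t, s.BuffersEmpty t}

/-- The sequentially consistent computations: stores (and fences) take immediate effect, that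
is, each issue is directly followed by the store or fence that it issues. -/
def Program.SCComp [Zero Dom] (P : Program Dom T R L) : Set (List (Event Dom T)) :=
  {τ | τ ∈ P.Comp ∧ ∀ p i, τ[p]? = some i → i.IsIssue →
    ∃ e, τ[p + 1]? = some e ∧ (e.IsStore ∨ e.IsFence) ∧ e.node = i.node}

end Semantics

/-! ### Happens-before traces -/

section Traces

variable {Dom : Type u} {T : Type v}

/-- `e` occurs before `f` in `τ`. (The events of a computation are pairwise distinct.) -/
def Before (τ : List (Event Dom T)) (e f : Event Dom T) : Prop := [e, f].Sublist τ

/-- Program order: the order of the actions of one thread, where stores and fences are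
represented by their issue. -/
def PO (τ : List (Event Dom T)) (n m : T × ℕ) : Prop :=
  ∃ e f, Before τ e f ∧ e.thread = f.thread ∧
    ¬ (e.IsStore ∨ e.IsFence) ∧ ¬ (f.IsStore ∨ f.IsFence) ∧ e.node = n ∧ f.node = m

/-- Store order: the order in which stores to the same address reach the memory. -/
def ST (τ : List (Event Dom T)) (n m : T × ℕ) : Prop :=
  ∃ a e f, Before τ e f ∧ e.StoresTo a ∧ f.StoresTo a ∧ e.node = n ∧ f.node = m

/-- `y` is a store to `a` of the thread of `l` that is issued before `l` and reaches the memory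
after `l`. -/
def PendingAt (τ : List (Event Dom T)) (a : Dom) (l y : Event Dom T) : Prop :=
  y.StoresTo a ∧ y.thread = l.thread ∧ Before τ l y ∧
    ∃ i : Event Dom T, i.IsIssue ∧ i.node = y.node ∧ Before τ i l

/-- `y` is the store from which the load `l` of address `a` takes its value: the most recently
issued pending store of the own thread, and if there is none, the last store to `a` that has
reached the memory. -/
def IsSource (τ : List (Event Dom T)) (a : Dom) (y l : Event Dom T) : Prop :=
  (PendingAt τ a l y ∧ ∀ z, PendingAt τ a l z → z = y ∨ PO τ z.node y.node) ∨
  ((∀ z, ¬ PendingAt τ a l z) ∧ y.StoresTo a ∧ Before τ y l ∧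
    ∀ z, z.StoresTo a → Before τ z l → z = y ∨ Before τ z y)

/-- Source relation, from a store to the loads that read its value. -/
def SRC (τ : List (Event Dom T)) (n m : T × ℕ) : Prop :=
  ∃ a y l, l ∈ τ ∧ l.LoadsFrom a ∧ IsSource τ a y l ∧ y.node = n ∧ l.node = m

/-- Conflict relation, from a load to the stores that overwrite the value it reads. -/
def CF (τ : List (Event Dom T)) (n m : T × ℕ) : Prop :=
  (∃ k, SRC τ k n ∧ ST τ k m) ∨
  (∃ a l y, l ∈ τ ∧ l.LoadsFrom a ∧ l.node = n ∧ y ∈ τ ∧ y.StoresTo a ∧ y.node = m ∧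
    (∀ k, ¬ SRC τ k n) ∧ ∀ k, ¬ ST τ k m)

/-- Happens-before traces: directed graphs whose nodes are labelled by the operations and which
have four kinds of edges. A node is a pair of a thread and a position in its program order, so
that equality of traces is label-preserving isomorphism of graphs. -/
@[ext]
structure Trace (Dom : Type u) (T : Type v) where
  /-- the nodes with their labels -/
  nodes : Set ((T × ℕ) × Op Dom)
  po : T × ℕ → T × ℕ → Prop
  st : T × ℕ → T × ℕ → Prop
  src : T × ℕ → T × ℕ → Prop
  cf : T × ℕ → T × ℕ → Prop

/-- The happens-before trace of a computation. The issue of a store or fence is represented by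
the node of that store or fence. -/
def traceOf (τ : List (Event Dom T)) : Trace Dom T where
  nodes := {p | ∃ e ∈ τ, ¬ e.IsIssue ∧ p = (e.node, e.op)}
  po := PO τ
  st := ST τ
  src := SRC τ
  cf := CF τ

/-- The store or fence `y` overtakes `c`: the action `c` stems from the same thread and lies
between the issue of `y` and `y`. -/
def Overtakes (τ : List (Event Dom T)) (y c : Event Dom T) : Prop :=
  (y.IsStore ∨ y.IsFence) ∧ c.thread = y.thread ∧
    ∃ i : Event Dom T, i.IsIssue ∧ i.node = y.node ∧ [i, c, y].Sublist τ

/-- `y` is a delayed store of `τ`: a store whose number of delays is not zero. -/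
def IsDelayedStore (τ : List (Event Dom T)) (y : Event Dom T) : Prop :=
  y.IsStore ∧ ∃ c, Overtakes τ y c

end Traces

section Robustness

variable {Dom : Type u} {T : Type v} {R : T → Type w} {L : Type x}

/-- Every trace of a relaxed computation is a trace of a sequentially consistent one. -/
def Program.Robust [Zero Dom] (P : Program Dom T R L) : Prop :=
  traceOf '' P.Comp ⊆ traceOf '' P.SCComp

/-- A violation of robustness: a relaxed computation whose trace is not the trace of any
sequentially consistent computation. -/
def Program.IsViolation [Zero Dom] (P : Program Dom T R L) (τ : List (Event Dom T)) : Prop :=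
  τ ∈ P.Comp ∧ traceOf τ ∉ traceOf '' P.SCComp

end Robustness

end StoreAtomic

/-! A computation is abstracted to an execution graph: every instruction instance gets its
operation, the time `iss` at which it is executed and the time `com` at which it takes effect.
Without the lightweight fence, the two kinds of buffers of a thread act, for each address, as a
single FIFO queue. The graph therefore obeys a few laws (`Graph.Consistent`): execution follows
program order, stores of one thread to one address commit in order, an `scfence` waits for all
earlier stores of its thread, and a load reads the newest pending store of its own thread or else
the last committed one. `Program.exists_realizes` provides the graph, and the relations of the trace
are read off from it.

Violations are the computations with cyclic happens-before. In an SC computation every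
happens-before edge increases the issue time (`Realizes.acyclic_of_mem_SCComp`). Conversely, if
happens-before is acyclic, executing the instances along a linear extension, with immediate stores,
is an SC computation with the same trace (`Realizes.exists_mem_SCComp`).

Given a cycle, let `v` be the first instance whose execution closes one
(`Realizes.exists_critical`). The cycle leaves `v` towards an instance `u` executed earlier; by the
laws, `u` is a store of another thread to some address `a`, still buffered when `v` is executed, and
`v` loads from or stores to `a` (`Realizes.pending_of_hb`). The cycle returns to `v` by a program
order or conflict edge: a store order or source edge would start at a store to `a` that commits
before `u`, which closes a cycle without `v`. Let `D` be the set of instances executed before `v`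
that lead to such a returning edge, and let `w` be the last store to `a` in `D` to reach memory.
Execute `D` along a linear extension of happens-before with immediate stores, except that `w` stays
buffered; then execute `v`; then write `w` (`Realizes.exists_delayedSeq`). The threads of `D` do not
notice the delay. After `w`, no store to `a` occurs, every load from `a` belongs to the thread of
`w` and reads `w`, and that thread executes no `scfence`, because `w` was still pending at `v` in
the original computation. The value loaded by `v` may change, but not its address. The edges inside
`D`, an edge from `v` to `w` and the returning edges all survive (`Graph.Performs.hb`), so the new
trace is cyclic too. Finally, `w` is really delayed: the first edge of its path towards `v` leads to
an instance of its own thread. -/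

namespace StoreAtomic

universe u v w x

/-! ### Positions of events -/

section Positions

variable {α : Type u}

open Classical in
/-- The position of the first occurrence of `e` in `τ`; the length of `τ` if there is none. -/
noncomputable def pos (τ : List α) (e : α) : ℕ := τ.idxOf e

theorem pos_lt_length {τ : List α} {e : α} : pos τ e < τ.length ↔ e ∈ τ := by
  classical exact List.idxOf_lt_length_iff

theorem pos_le_length {τ : List α} {e : α} : pos τ e ≤ τ.length := by
  classical exact List.idxOf_le_length

theorem pos_append_of_mem {τ σ : List α} {e : α} (h : e ∈ τ) : pos (τ ++ σ) e = pos τ e := by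
  classical exact List.idxOf_append_of_mem h

theorem pos_append_of_notMem {τ σ : List α} {e : α} (h : e ∉ τ) :
    pos (τ ++ σ) e = τ.length + pos σ e := by
  classical exact List.idxOf_append_of_notMem h

theorem pos_append_self {τ : List α} {e : α} (h : e ∉ τ) : pos (τ ++ [e]) e = τ.length := by
  rw [pos_append_of_notMem h]; simp [pos]

theorem getElem?_pos {τ : List α} {e : α} (h : e ∈ τ) : τ[pos τ e]? = some e := by
  classical
  rw [List.getElem?_eq_getElem (pos_lt_length.2 h)]
  exact congrArg some (List.getElem_idxOf _)

theorem pos_inj {τ : List α} {e f : α} (he : e ∈ τ) (hf : f ∈ τ) (h : pos τ e = pos τ f) :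
    e = f := by
  have h1 := getElem?_pos he
  rw [h, getElem?_pos hf] at h1
  exact (Option.some_inj.1 h1).symm

theorem pos_lt_pos_of_append {τ σ : List α} {e f : α} (he : e ∈ τ) (hf : f ∉ τ) :
    pos (τ ++ σ) e < pos (τ ++ σ) f := by
  rw [pos_append_of_mem he, pos_append_of_notMem hf]
  have := pos_lt_length.2 he
  omega

theorem pair_sublist_iff {τ : List α} (hn : τ.Nodup) {e f : α} :
    [e, f].Sublist τ ↔ f ∈ τ ∧ pos τ e < pos τ f := by
  constructor
  · intro h
    have hf : f ∈ τ := h.subset (by simp)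
    refine ⟨hf, ?_⟩
    have h' := h
    rw [show [e, f] = [e] ++ [f] from rfl, List.append_sublist_iff] at h'
    obtain ⟨r₁, r₂, rfl, h1, h2⟩ := h'
    have he1 : e ∈ r₁ := h1.subset (by simp)
    have hf2 : f ∈ r₂ := h2.subset (by simp)
    exact pos_lt_pos_of_append he1 fun hf1 => (List.nodup_append.1 hn).2.2 f hf1 f hf2 rfl
  · rintro ⟨hf, h⟩
    obtain ⟨r₁, r₂, rfl⟩ := List.append_of_mem hf
    have hf1 : f ∉ r₁ := fun hf1 => (List.nodup_append.1 hn).2.2 f hf1 f (by simp) rfl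
    have he : e ∈ r₁ := by
      by_contra he
      rw [pos_append_of_notMem he, pos_append_of_notMem hf1] at h
      simp [pos] at h
    rw [show [e, f] = [e] ++ [f] from rfl]
    exact (List.singleton_sublist.2 he).append (by simp)

end Positions

/-! ### Execution graphs -/

section Graphs

variable {Dom : Type u} {T : Type v}

/-- The operation of the event by which a thread executes an instruction: stores and fences are
issued. -/
def Op.exec : Op Dom → Op Dom
  | .st _ _ => .isu
  | .fence _ => .isu
  | o => o

theorem Op.exec_ne_st (o : Op Dom) (a v : Dom) : o.exec ≠ .st a v := by
  cases o <;> simp [Op.exec]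

/-- Instruction instances with their operations, the time at which they are executed, and the
time at which they take effect on the memory. -/
structure Graph (Dom : Type u) (T : Type v) where
  cnt : T → ℕ
  op : T × ℕ → Op Dom
  iss : T × ℕ → ℕ
  com : T × ℕ → ℕ

namespace Graph

def Valid (g : Graph Dom T) (n : T × ℕ) : Prop := n.2 < g.cnt n.1

def Stores (g : Graph Dom T) (n : T × ℕ) (a : Dom) : Prop := g.Valid n ∧ ∃ v, g.op n = .st a v

def Loads (g : Graph Dom T) (n : T × ℕ) (a : Dom) : Prop := g.Valid n ∧ ∃ v, g.op n = .ld a v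

/-- The store `m` to `a` is buffered by its thread when this thread executes `n`. -/
def Pending (g : Graph Dom T) (a : Dom) (m n : T × ℕ) : Prop :=
  g.Stores m a ∧ m.1 = n.1 ∧ m.2 < n.2 ∧ ¬ g.com m < g.iss n

/-- The load `n` from `a` reads from the store `m`. -/
def Source (g : Graph Dom T) (a : Dom) (m n : T × ℕ) : Prop :=
  (g.Pending a m n ∧ ∀ k, g.Pending a k n → k.2 ≤ m.2) ∨
  ((∀ k, ¬ g.Pending a k n) ∧ g.Stores m a ∧ g.com m < g.iss n ∧
    ∀ k, g.Stores k a → g.com k < g.iss n → g.com k ≤ g.com m)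

/-- The laws of the memory model, where `N` is the current time. -/
structure Consistent [Zero Dom] (g : Graph Dom T) (N : ℕ) : Prop where
  iss_lt : ∀ n, g.Valid n → g.iss n < N
  po : ∀ t i j, i < j → j < g.cnt t → g.iss (t, i) < g.iss (t, j)
  iss_lt_com : ∀ n a, g.Stores n a → g.iss n < g.com n
  -- An event that has not occurred is given the length of the sequence as its position, so all
  -- uncommitted stores share the commit time `N`; only committed ones can be compared.
  fifo : ∀ t i j a, i < j → g.Stores (t, i) a → g.Stores (t, j) a → g.com (t, j) < N →
    g.com (t, i) < g.com (t, j)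
  scfence : ∀ t i j a, i < j → g.Stores (t, i) a → g.Valid (t, j) → g.op (t, j) = .scfence →
    g.com (t, i) < g.iss (t, j)
  read : ∀ n a v, g.Valid n → g.op n = .ld a v →
    (∃ m, g.op m = .st a v ∧ g.Source a m n) ∨
    (v = 0 ∧ (∀ k, ¬ g.Pending a k n) ∧ ∀ k, g.Stores k a → ¬ g.com k < g.iss n)

/-- `g'` describes a continuation after time `N` of the execution described by `g`. -/
structure Extends (g' g : Graph Dom T) (N : ℕ) : Prop where
  old : ∀ n, g.Valid n → g'.Valid n ∧ g'.op n = g.op n ∧ g'.iss n = g.iss n ∧ g.iss n < N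
  com_of_lt : ∀ n, g.Valid n → g.com n < N → g'.com n = g.com n
  com_of_not_lt : ∀ n, g.Valid n → ¬ g.com n < N → N ≤ g'.com n
  new : ∀ n, g'.Valid n → ¬ g.Valid n → N ≤ g'.com n

namespace Extends

variable {g g' : Graph Dom T} {N : ℕ} (h : g'.Extends g N)
include h

theorem stores {n : T × ℕ} (hn : g.Valid n) (a : Dom) : g'.Stores n a ↔ g.Stores n a := by
  simp [Stores, hn, (h.old n hn).1, (h.old n hn).2.1]

/-- Every commit that the continuation adds happens at time `N` or later, after `n` was executed. So
the commits that `n` can see, and with them its pending stores and its source, are settled once `n`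
is executed. -/
theorem com_lt {n k : T × ℕ} {a : Dom} (hn : g.Valid n) :
    g'.Stores k a ∧ g'.com k < g'.iss n ↔ g.Stores k a ∧ g.com k < g.iss n := by
  have h1 := h.old n hn
  by_cases hk : g.Valid k
  · rw [h.stores hk]
    have h2 := h.com_of_lt k hk
    have h3 := h.com_of_not_lt k hk
    constructor <;> rintro ⟨hs, hl⟩ <;> refine ⟨hs, ?_⟩ <;> omega
  · refine ⟨fun ⟨hs, hl⟩ => ?_, fun ⟨hs, _⟩ => absurd hs.1 hk⟩
    have := h.new k hs.1 hk
    omega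

theorem pending {n k : T × ℕ} {a : Dom} (hn : g.Valid n) :
    g'.Pending a k n ↔ g.Pending a k n := by
  have h1 := h.com_lt (k := k) (a := a) hn
  unfold Pending
  constructor
  · rintro ⟨hs, ht, hl, hc⟩
    have hk : g.Valid k := by
      have := hn
      simp only [Valid, ht] at this ⊢
      omega
    have hs' := (h.stores hk a).1 hs
    exact ⟨hs', ht, hl, fun hc' => hc (h1.2 ⟨hs', hc'⟩).2⟩
  · rintro ⟨hs, ht, hl, hc⟩
    have hs' := (h.stores hs.1 a).2 hs
    exact ⟨hs', ht, hl, fun hc' => hc (h1.1 ⟨hs', hc'⟩).2⟩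

theorem source {n m : T × ℕ} {a : Dom} (hn : g.Valid n) (hs : g.Source a m n) :
    g'.Source a m n := by
  rcases hs with ⟨hp, hl⟩ | ⟨hp, hm, hc, hl⟩
  · exact Or.inl ⟨(h.pending hn).2 hp, fun k hk => hl k ((h.pending hn).1 hk)⟩
  · obtain ⟨hm', hc'⟩ := h.com_lt hn |>.2 ⟨hm, hc⟩
    refine Or.inr ⟨fun k hk => hp k ((h.pending hn).1 hk), hm', hc', fun k hk hkc => ?_⟩
    obtain ⟨hk', hkc'⟩ := h.com_lt hn |>.1 ⟨hk, hkc⟩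
    have := (h.old n hn).2.2.2
    rw [h.com_of_lt k hk'.1 (by omega), h.com_of_lt m hm.1 (by omega)]
    exact hl k hk' hkc'

theorem read [Zero Dom] (hc : g.Consistent N) {n : T × ℕ} {a v : Dom} (hn : g.Valid n)
    (ho : g'.op n = .ld a v) :
    (∃ m, g'.op m = .st a v ∧ g'.Source a m n) ∨
    (v = 0 ∧ (∀ k, ¬ g'.Pending a k n) ∧ ∀ k, g'.Stores k a → ¬ g'.com k < g'.iss n) := by
  rw [(h.old n hn).2.1] at ho
  rcases hc.read n a v hn ho with ⟨m, hm, hs⟩ | ⟨hv, hp, hl⟩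
  · refine Or.inl ⟨m, ?_, h.source hn hs⟩
    have : g.Valid m := by
      rcases hs with ⟨hp, -⟩ | ⟨-, hs, -⟩
      exacts [hp.1.1, hs.1]
    rw [(h.old m this).2.1, hm]
  · refine Or.inr ⟨hv, fun k hk => hp k ((h.pending hn).1 hk), fun k hk hkc => ?_⟩
    obtain ⟨hk', hkc'⟩ := h.com_lt hn |>.1 ⟨hk, hkc⟩
    exact hl k hk' hkc'

end Extends

end Graph

/-- The execution graph of a sequence of events. -/
noncomputable def graphOf (τ : List (Event Dom T)) (cnt : T → ℕ) (op : T × ℕ → Op Dom) :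
    Graph Dom T where
  cnt := cnt
  op := op
  iss := fun n => pos τ ⟨n.1, n.2, (op n).exec⟩
  com := fun n => pos τ ⟨n.1, n.2, op n⟩

end Graphs

/-! ### Thread-local semantics -/

section Local

variable {Dom : Type u} {T : Type v} {R : T → Type w} {L : Type x} [Zero Dom]

open Classical in
/-- A step of thread `t` on its label and registers, for an arbitrary value returned by loads. -/
inductive Program.LocalStep (P : Program Dom T R L) (t : T) :
    L × (R t → Dom) → Op Dom → L × (R t → Dom) → Prop where
  | load {l l' ρ r e} (v) (hi : (l, Instr.load r e, l') ∈ P.code t) :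
      LocalStep P t (l, ρ) (.ld (e.eval ρ) v) (l', Function.update ρ r v)
  | store {l l' ρ ea ev} (hi : (l, Instr.store ea ev, l') ∈ P.code t) :
      LocalStep P t (l, ρ) (.st (ea.eval ρ) (ev.eval ρ)) (l', ρ)
  | scfence {l l' ρ} (hi : (l, Instr.scfence, l') ∈ P.code t) :
      LocalStep P t (l, ρ) .scfence (l', ρ)
  | assign {l l' ρ r e} (hi : (l, Instr.assign r e, l') ∈ P.code t) :
      LocalStep P t (l, ρ) .loc (l', Function.update ρ r (e.eval ρ))
  | assert {l l' ρ e} (hi : (l, Instr.assert e, l') ∈ P.code t) (he : e.eval ρ ≠ 0) :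
      LocalStep P t (l, ρ) .loc (l', ρ)

theorem Program.LocalStep.op_ne {P : Program Dom T R L} {t : T} {c c' : L × (R t → Dom)}
    {o : Op Dom} (h : P.LocalStep t c o c') : o ≠ .isu ∧ ∀ as, o ≠ .fence as := by
  cases h <;> simp

/-- `c` is the sequence of configurations of thread `t` in a run that performs the operations
`op (t, 0)`, …, `op (t, k - 1)`. -/
def Program.LocalRun (P : Program Dom T R L) (op : T × ℕ → Op Dom) (t : T) (k : ℕ)
    (c : ℕ → L × (R t → Dom)) : Prop :=
  c 0 = (P.init t, fun _ => 0) ∧ ∀ i < k, P.LocalStep t (c i) (op (t, i)) (c (i + 1))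

open Classical in
/-- The entry that the execution of `o` as instance number `k` appends to the buffered stores
to `a`. -/
noncomputable def Op.entry (o : Op Dom) (a : Dom) (k : ℕ) : List (Dom × ℕ) :=
  match o with
  | .st b v => if b = a then [(v, k)] else []
  | _ => []

omit [Zero Dom] in
theorem Op.mem_entry {o : Op Dom} {a v : Dom} {i k : ℕ} :
    (v, i) ∈ o.entry a k ↔ o = .st a v ∧ i = k := by
  cases o with
  | st b v' =>
    by_cases h : b = a
    · simp [Op.entry, h, eq_comm]
    · simp [Op.entry, h]
  | _ => simp [Op.entry]

/-- The events `τ` lead to the labels and registers `cfg`, the memory `mem`, the buffered stores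
`queue` and the instance counters `cnt`; the executed instances have the operations `op`. -/
structure Invariant (P : Program Dom T R L) (τ : List (Event Dom T))
    (cfg : (t : T) → L × (R t → Dom)) (mem : Dom → Dom) (queue : T → Dom → List (Dom × ℕ))
    (cnt : T → ℕ) (op : T × ℕ → Op Dom) : Prop where
  nodup : τ.Nodup
  run : ∀ t, ∃ c, P.LocalRun op t (cnt t) c ∧ c (cnt t) = cfg t
  sound : ∀ e ∈ τ, e.idx < cnt e.thread ∧ (e.op = (op e.node).exec ∨ e.op = op e.node)
  issued : ∀ t i, i < cnt t → ⟨t, i, (op (t, i)).exec⟩ ∈ τ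
  mem_queue : ∀ t a v i, (v, i) ∈ queue t a ↔
    i < cnt t ∧ op (t, i) = .st a v ∧ (⟨t, i, .st a v⟩ : Event Dom T) ∉ τ
  sorted : ∀ t a, (queue t a).Pairwise fun p q => p.2 < q.2
  mem : ∀ a, (∃ m, (graphOf τ cnt op).Stores m a ∧ op m = .st a (mem a) ∧
      (graphOf τ cnt op).com m < τ.length ∧
      ∀ k, (graphOf τ cnt op).Stores k a → (graphOf τ cnt op).com k < τ.length →
        (graphOf τ cnt op).com k ≤ (graphOf τ cnt op).com m) ∨
    (mem a = 0 ∧ ∀ k, (graphOf τ cnt op).Stores k a → ¬ (graphOf τ cnt op).com k < τ.length)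
  consistent : (graphOf τ cnt op).Consistent τ.length

end Local

/-! ### Preservation of the invariant by execution and commit -/

section Preservation

variable {Dom : Type u} {T : Type v} {R : T → Type w} {L : Type x} [Zero Dom]
  {P : Program Dom T R L} {τ : List (Event Dom T)} {cfg cfg' : (t : T) → L × (R t → Dom)}
  {mem mem' : Dom → Dom} {queue queue' : T → Dom → List (Dom × ℕ)} {cnt cnt' : T → ℕ}
  {op op' : T × ℕ → Op Dom}

/-- Appending an event moves no earlier event, and whatever was absent stays at or beyond position
`τ.length`. -/
theorem Invariant.extends (h : Invariant P τ cfg mem queue cnt op) (e : Event Dom T)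
    (hcnt : ∀ t, cnt t ≤ cnt' t) (hop : ∀ n : T × ℕ, n.2 < cnt n.1 → op' n = op n) :
    (graphOf (τ ++ [e]) cnt' op').Extends (graphOf τ cnt op) τ.length where
  old n hn := by
    have hm := h.issued n.1 n.2 hn
    refine ⟨lt_of_lt_of_le hn (hcnt n.1), hop n hn, ?_, pos_lt_length.2 hm⟩
    simp only [graphOf, hop n hn]
    exact pos_append_of_mem hm
  com_of_lt n hn hc := by
    simp only [graphOf, hop n hn]
    exact pos_append_of_mem (pos_lt_length.1 hc)
  com_of_not_lt n hn hc := by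
    simp only [graphOf, hop n hn]
    rw [pos_append_of_notMem fun hm => hc (pos_lt_length.2 hm)]
    omega
  new n hn hn' := by
    simp only [graphOf]
    rw [pos_append_of_notMem fun hm => hn' (h.sound ⟨n.1, n.2, op' n⟩ hm).1]
    omega

/-- One lemma serves all instructions: they differ only in the queue entry they append and in the
conditions on loads and `scfence`. `Graph.Extends` takes care of the old instances, so each law has
to be checked only where the new instance occurs. -/
theorem Invariant.exec (h : Invariant P τ cfg mem queue cnt op) {t : T} {o : Op Dom}
    (hs : P.LocalStep t (cfg t) o (cfg' t)) (hcfg : ∀ t' ≠ t, cfg' t' = cfg t')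
    (hread : ∀ a v, o = .ld a v → v = ((queue t a).getLast?.map Prod.fst).getD (mem a))
    (hfence : o = .scfence → ∀ a, queue t a = [])
    (hq : ∀ a, queue' t a = queue t a ++ o.entry a (cnt t))
    (hq' : ∀ t' ≠ t, ∀ a, queue' t' a = queue t' a)
    (hcnt : cnt' t = cnt t + 1) (hcnt' : ∀ t' ≠ t, cnt' t' = cnt t')
    (hop : op' (t, cnt t) = o) (hop' : ∀ n ≠ (t, cnt t), op' n = op n) :
    Invariant P (τ ++ [⟨t, cnt t, o.exec⟩]) cfg' mem queue' cnt' op' := by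
  have hle : ∀ t', cnt t' ≤ cnt' t' := fun t' => by
    by_cases ht : t' = t
    · subst ht; omega
    · rw [hcnt' t' ht]
  have hold : ∀ n : T × ℕ, n.2 < cnt n.1 → op' n = op n := fun n hn =>
    hop' n (by rintro rfl; simp at hn)
  have hvalid : ∀ n : T × ℕ, n.2 < cnt' n.1 → n.2 < cnt n.1 ∨ n = (t, cnt t) := by
    rintro ⟨t', i⟩ hn
    by_cases ht : t' = t
    · subst ht
      simp only [hcnt] at hn
      rcases Nat.lt_succ_iff_lt_or_eq.1 hn with h' | h'
      · exact Or.inl h'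
      · exact Or.inr (by rw [h'])
    · exact Or.inl (by simpa [hcnt' t' ht] using hn)
  have hext := h.extends (op' := op') ⟨t, cnt t, o.exec⟩ hle hold
  have he : (⟨t, cnt t, o.exec⟩ : Event Dom T) ∉ τ := fun hm => by
    simpa using (h.sound _ hm).1
  have hissnew : (graphOf (τ ++ [⟨t, cnt t, o.exec⟩]) cnt' op').iss (t, cnt t) = τ.length := by
    simp only [graphOf, hop]
    exact pos_append_self he
  -- a committed store is an old one
  have hcommitted : ∀ n a, (graphOf (τ ++ [⟨t, cnt t, o.exec⟩]) cnt' op').Stores n a →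
      (graphOf (τ ++ [⟨t, cnt t, o.exec⟩]) cnt' op').com n < τ.length + 1 →
      (graphOf τ cnt op).Stores n a ∧ (graphOf τ cnt op).com n < τ.length := by
    rintro n a ⟨hn, v, hv⟩ hc
    have hmem : (⟨n.1, n.2, op' n⟩ : Event Dom T) ∈ τ ++ [⟨t, cnt t, o.exec⟩] :=
      pos_lt_length.1 (by simpa [graphOf] using hc)
    rcases List.mem_append.1 hmem with hmem | hmem
    · have hn' := (h.sound _ hmem).1
      have := hold n hn'
      refine ⟨(hext.stores hn' a).1 ⟨hn, v, hv⟩, ?_⟩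
      rw [this] at hmem
      exact pos_lt_length.2 hmem
    · simp only [List.mem_singleton, Event.mk.injEq] at hmem
      exact absurd (hmem.2.2.symm.trans hv) (Op.exec_ne_st o a v)
  have hlen : (τ ++ [(⟨t, cnt t, o.exec⟩ : Event Dom T)]).length = τ.length + 1 := by simp
  constructor
  · rw [List.nodup_append]
    exact ⟨h.nodup, by simp, fun a ha b hb => by
      rintro rfl; simp only [List.mem_singleton] at hb; exact he (hb ▸ ha)⟩
  · intro t'
    obtain ⟨c, ⟨hc0, hc⟩, hcc⟩ := h.run t'
    by_cases ht : t' = t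
    · subst ht
      refine ⟨fun i => if i ≤ cnt t' then c i else cfg' t', ⟨by simpa using hc0, fun i hi => ?_⟩,
        by simp [hcnt]⟩
      rw [hcnt] at hi
      rcases Nat.lt_succ_iff_lt_or_eq.1 hi with h' | h'
      · have h1 : i ≤ cnt t' := by omega
        have h2 : i + 1 ≤ cnt t' := by omega
        simp only [h1, h2, if_true]
        rw [hold (t', i) h']
        exact hc i h'
      · subst h'
        simp only [le_refl, if_true, show ¬ cnt t' + 1 ≤ cnt t' by omega, if_false]
        rw [hcc, hop]
        exact hs
    · refine ⟨c, ⟨hc0, fun i hi => ?_⟩, ?_⟩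
      · rw [hcnt' t' ht] at hi
        rw [hold (t', i) hi]
        exact hc i hi
      · rw [hcnt' t' ht, hcc, hcfg t' ht]
  · intro e hm
    rcases List.mem_append.1 hm with hm | hm
    · have := h.sound e hm
      rw [hold e.node this.1]
      exact ⟨lt_of_lt_of_le this.1 (hle _), this.2⟩
    · simp only [List.mem_singleton] at hm
      subst hm
      simp [Event.node, hop, hcnt]
  · intro t' i hi
    rcases hvalid (t', i) hi with h' | h'
    · rw [hold _ h']
      exact List.mem_append_left _ (h.issued t' i h')
    · obtain ⟨rfl, rfl⟩ := Prod.mk.inj h'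
      simp [hop]
  · intro t' a v i
    have hne : (⟨t', i, .st a v⟩ : Event Dom T) ∉ τ ++ [⟨t, cnt t, o.exec⟩] ↔
        (⟨t', i, .st a v⟩ : Event Dom T) ∉ τ := by
      have : Op.st a v ≠ o.exec := (Op.exec_ne_st o a v).symm
      simp [this]
    rw [hne]
    by_cases ht : t' = t
    · subst ht
      rw [hq, List.mem_append, h.mem_queue, Op.mem_entry, hcnt]
      constructor
      · rintro (⟨h1, h2, h3⟩ | ⟨h1, rfl⟩)
        · exact ⟨by omega, by rw [hold (t', i) h1, h2], h3⟩
        · exact ⟨by omega, by rw [hop, h1], fun hm => by simpa using (h.sound _ hm).1⟩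
      · rintro ⟨h1, h2, h3⟩
        rcases Nat.lt_succ_iff_lt_or_eq.1 h1 with h' | h'
        · exact Or.inl ⟨h', by rw [← hold (t', i) h', h2], h3⟩
        · subst h'
          exact Or.inr ⟨by rw [← hop, h2], rfl⟩
    · rw [hq' t' ht, h.mem_queue, hcnt' t' ht, hop' (t', i) (by simp [ht])]
  · intro t' a
    by_cases ht : t' = t
    · subst ht
      rw [hq, List.pairwise_append]
      refine ⟨h.sorted t' a, ?_, ?_⟩
      · cases o with
        | st b v' => by_cases hb : b = a <;> simp [Op.entry, hb]
        | _ => simp [Op.entry]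
      · rintro ⟨v, i⟩ hp ⟨v', i'⟩ hq
        obtain ⟨-, rfl⟩ := Op.mem_entry.1 hq
        exact ((h.mem_queue t' a v i).1 hp).1
    · rw [hq' t' ht]
      exact h.sorted t' a
  · intro a
    rw [hlen]
    rcases h.mem a with ⟨m, hm, hv, hc, hl⟩ | ⟨hv, hl⟩
    · refine Or.inl ⟨m, (hext.stores hm.1 a).2 hm, by rw [hold m hm.1, hv], ?_, fun k hk hkc => ?_⟩
      · rw [hext.com_of_lt m hm.1 hc]; omega
      · obtain ⟨hk', hkc'⟩ := hcommitted k a hk hkc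
        rw [hext.com_of_lt m hm.1 hc, hext.com_of_lt k hk'.1 hkc']
        exact hl k hk' hkc'
    · refine Or.inr ⟨hv, fun k hk hkc => ?_⟩
      obtain ⟨hk', hkc'⟩ := hcommitted k a hk hkc
      exact hl k hk' hkc'
  · have hcon := h.consistent
    rw [hlen]
    refine ⟨fun n hn => ?_, fun t' i j hij hj => ?_, fun n a hn => ?_,
      fun t' i j a hij hi hj hc => ?_, fun t' i j a hij hi hj hf => ?_, fun n a v hn hv => ?_⟩
    · rcases hvalid n hn with h' | rfl
      · have := hext.old n h'; omega
      · rw [hissnew]; omega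
    · rcases hvalid (t', j) hj with h' | h'
      · have hi : (graphOf τ cnt op).Valid (t', i) := lt_trans hij h'
        rw [(hext.old _ hi).2.2.1, (hext.old _ h').2.2.1]
        exact hcon.po t' i j hij h'
      · obtain ⟨rfl, rfl⟩ := Prod.mk.inj h'
        have := hext.old (t', i) hij
        rw [hissnew]; omega
    · rcases hvalid n hn.1 with h' | rfl
      · have hn' := (hext.stores h' a).1 hn
        have h1 := hcon.iss_lt_com n a hn'
        have h2 := hext.old n h'
        have h3 := hext.com_of_lt n h'
        have h4 := hext.com_of_not_lt n h'
        omega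
      · by_contra hc
        rw [hissnew] at hc
        obtain ⟨hk, -⟩ := hcommitted _ a hn (by omega)
        exact absurd hk.1 (by simp [Graph.Valid, graphOf])
    · obtain ⟨hj', hc'⟩ := hcommitted _ a hj hc
      have hiv : (graphOf τ cnt op).Valid (t', i) := lt_trans hij hj'.1
      have := hcon.fifo t' i j a hij ((hext.stores hiv a).1 hi) hj' hc'
      rw [hext.com_of_lt _ hiv (by omega), hext.com_of_lt _ hj'.1 hc']
      exact this
    · rcases hvalid (t', j) hj with h' | h'
      · have hiv : (graphOf τ cnt op).Valid (t', i) := lt_trans hij h'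
        have := hext.old _ h'
        have h3 := hcon.scfence t' i j a hij ((hext.stores hiv a).1 hi) h' (by rw [← this.2.1, hf])
        rw [this.2.2.1, hext.com_of_lt _ hiv (by omega)]
        exact h3
      · obtain ⟨rfl, rfl⟩ := Prod.mk.inj h'
        have hq0 := hfence (hop ▸ hf) a
        have hi' := (hext.stores (n := (t', i)) hij a).1 hi
        obtain ⟨hiv, v, hv⟩ := hi'
        -- An uncommitted store would still be queued, but `scfence` requires empty queues.
        have hc : (graphOf τ cnt op).com (t', i) < τ.length := by
          by_contra hc
          have : (v, i) ∈ queue t' a := (h.mem_queue t' a v i).2 ⟨hiv, hv, fun hm => hc (by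
            simp only [graphOf] at hv ⊢
            rw [hv]; exact pos_lt_length.2 hm)⟩
          simp [hq0] at this
        rw [hissnew, hext.com_of_lt _ hiv hc]
        exact hc
    · rcases hvalid n hn with h' | rfl
      · exact hext.read hcon h' hv
      · have ho : o = .ld a v := hop.symm.trans hv
        have hval := hread a v ho
        -- The stores pending at the new load are exactly those queued at its address.
        have hpend : ∀ k : T × ℕ, (graphOf (τ ++ [⟨t, cnt t, o.exec⟩]) cnt' op').Pending a k
            (t, cnt t) ↔ k.1 = t ∧ ∃ v', (v', k.2) ∈ queue t a := by
          rintro ⟨t', i⟩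
          constructor
          · rintro ⟨hk, rfl, hl, hc⟩
            obtain ⟨hkv, v', hv'⟩ := (hext.stores (n := (t', i)) hl a).1 hk
            refine ⟨rfl, v', (h.mem_queue t' a v' i).2 ⟨hl, hv', fun hm => hc ?_⟩⟩
            have : (graphOf τ cnt op).com (t', i) < τ.length := by
              simp only [graphOf] at hv' ⊢
              rw [hv']; exact pos_lt_length.2 hm
            rw [hissnew, hext.com_of_lt _ hkv this]
            exact this
          · rintro ⟨rfl, v', hm⟩
            obtain ⟨h1, h2, h3⟩ := (h.mem_queue t' a v' i).1 hm
            refine ⟨(hext.stores (n := (t', i)) h1 a).2 ⟨h1, v', h2⟩, rfl, h1, fun hc => ?_⟩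
            rw [hissnew] at hc
            have := hext.com_of_not_lt (t', i) h1 (fun hc' => h3 (by
              simp only [graphOf] at hc'
              rw [h2] at hc'; exact pos_lt_length.1 hc'))
            omega
        -- An empty queue makes the load read memory, hence the last committed store or the initial
        -- `0`; otherwise it reads the newest entry, which has the largest index since queues are
        -- sorted.
        rcases List.eq_nil_or_concat (queue t a) with hnil | ⟨β, ⟨v', i⟩, hβ⟩
        · have hnp : ∀ k, ¬ (graphOf (τ ++ [⟨t, cnt t, o.exec⟩]) cnt' op').Pending a k
              (t, cnt t) := fun k hk => by
            obtain ⟨-, v', hm⟩ := (hpend k).1 hk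
            simp [hnil] at hm
          simp only [hnil, List.getLast?_nil, Option.map_none, Option.getD_none] at hval
          have hlow : ∀ k, (graphOf (τ ++ [⟨t, cnt t, o.exec⟩]) cnt' op').Stores k a →
              (graphOf (τ ++ [⟨t, cnt t, o.exec⟩]) cnt' op').com k < τ.length →
              (graphOf τ cnt op).Stores k a ∧ (graphOf τ cnt op).com k < τ.length :=
            fun k hk hkc => hcommitted k a hk (by omega)
          rw [hissnew]
          rcases h.mem a with ⟨m, hm, hmv, hc, hl⟩ | ⟨hv0, hl⟩
          · refine Or.inl ⟨m, ?_, Or.inr ⟨hnp, (hext.stores hm.1 a).2 hm, ?_, fun k hk hkc => ?_⟩⟩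
            · rw [show (graphOf (τ ++ [⟨t, cnt t, o.exec⟩]) cnt' op').op m = op m from
                hold m hm.1, hmv, hval]
            · rw [hissnew, hext.com_of_lt m hm.1 hc]; exact hc
            · rw [hissnew] at hkc
              obtain ⟨hk', hkc'⟩ := hlow k hk hkc
              rw [hext.com_of_lt m hm.1 hc, hext.com_of_lt k hk'.1 hkc']
              exact hl k hk' hkc'
          · refine Or.inr ⟨hval.trans hv0, hnp, fun k hk hkc => ?_⟩
            obtain ⟨hk', hkc'⟩ := hlow k hk hkc
            exact hl k hk' hkc'
        · have hβ' : queue t a = β ++ [(v', i)] := by rw [hβ, List.concat_eq_append]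
          rw [hβ'] at hval
          simp only [List.getLast?_append, List.getLast?_singleton, Option.some_or,
            Option.map_some, Option.getD_some] at hval
          subst hval
          have hm : (v, i) ∈ queue t a := by simp [hβ']
          obtain ⟨h1, h2, h3⟩ := (h.mem_queue t a v i).1 hm
          refine Or.inl ⟨(t, i), ?_, Or.inl ⟨(hpend (t, i)).2 ⟨rfl, v, hm⟩, fun k hk => ?_⟩⟩
          · exact (hold (t, i) h1).trans h2
          · obtain ⟨-, v'', hk'⟩ := (hpend k).1 hk
            rw [hβ', List.mem_append] at hk'
            have hsort := h.sorted t a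
            rw [hβ', List.pairwise_append] at hsort
            rcases hk' with hk' | hk'
            · exact le_of_lt (hsort.2.2 _ hk' (v, i) (by simp))
            · simp only [List.mem_singleton, Prod.mk.injEq] at hk'
              exact hk'.2.le

/-- The new event is the latest of all, so it determines the memory at `a`. FIFO holds because the
committed store is the head of a queue sorted by index. -/
theorem Invariant.commit (h : Invariant P τ cfg mem queue cnt op) {t : T} {a v : Dom} {i : ℕ}
    {β : List (Dom × ℕ)} (hb : queue t a = (v, i) :: β)
    (hq : queue' t a = β) (hq' : ∀ t' a', (t', a') ≠ (t, a) → queue' t' a' = queue t' a')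
    (hmem : mem' a = v) (hmem' : ∀ a' ≠ a, mem' a' = mem a') :
    Invariant P (τ ++ [⟨t, i, .st a v⟩]) cfg mem' queue' cnt op := by
  have hext := h.extends (op' := op) ⟨t, i, .st a v⟩ (fun t => le_rfl) fun n _ => rfl
  have hin : (v, i) ∈ queue t a := by simp [hb]
  obtain ⟨hi, hio, he⟩ := (h.mem_queue t a v i).1 hin
  have hlen : (τ ++ [(⟨t, i, .st a v⟩ : Event Dom T)]).length = τ.length + 1 := by simp
  have hsort := h.sorted t a
  rw [hb, List.pairwise_cons] at hsort
  have hnew : (graphOf (τ ++ [⟨t, i, .st a v⟩]) cnt op).com (t, i) = τ.length := by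
    simp only [graphOf, hio]
    exact pos_append_self he
  have hcommitted : ∀ n b, (graphOf (τ ++ [⟨t, i, .st a v⟩]) cnt op).Stores n b →
      (graphOf (τ ++ [⟨t, i, .st a v⟩]) cnt op).com n < τ.length + 1 →
      (graphOf τ cnt op).com n < τ.length ∨ n = (t, i) ∧ b = a := by
    rintro n b ⟨hn, v', hv⟩ hc
    have hmem : (⟨n.1, n.2, op n⟩ : Event Dom T) ∈ τ ++ [⟨t, i, .st a v⟩] :=
      pos_lt_length.1 (by simpa [graphOf] using hc)
    rcases List.mem_append.1 hmem with hmem | hmem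
    · exact Or.inl (pos_lt_length.2 hmem)
    · simp only [List.mem_singleton, Event.mk.injEq] at hmem
      refine Or.inr ⟨Prod.ext hmem.1 hmem.2.1, ?_⟩
      have := hmem.2.2.symm.trans hv
      simp only [Op.st.injEq] at this
      exact this.1.symm
  have hti : (graphOf τ cnt op).Stores (t, i) a := ⟨hi, v, hio⟩
  constructor
  · rw [List.nodup_append]
    exact ⟨h.nodup, by simp, fun a ha b hb => by
      rintro rfl; simp only [List.mem_singleton] at hb; exact he (hb ▸ ha)⟩
  · exact h.run
  · intro e hm
    rcases List.mem_append.1 hm with hm | hm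
    · exact h.sound e hm
    · simp only [List.mem_singleton] at hm
      subst hm
      exact ⟨hi, Or.inr hio.symm⟩
  · exact fun t' j hj => List.mem_append_left _ (h.issued t' j hj)
  · intro t' a' v' j
    by_cases hta : (t', a') = (t, a)
    · obtain ⟨rfl, rfl⟩ := Prod.mk.inj hta
      have h1 := h.mem_queue t' a' v' j
      rw [hb, List.mem_cons] at h1
      rw [hq]
      simp only [List.mem_append, List.mem_singleton, not_or, Event.mk.injEq, true_and,
        Op.st.injEq]
      constructor
      · intro hm
        obtain ⟨h2, h3, h4⟩ := h1.1 (Or.inr hm)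
        have := hsort.1 _ hm
        exact ⟨h2, h3, h4, fun hc => by simp only at this; omega⟩
      · rintro ⟨h2, h3, h4, h5⟩
        rcases h1.2 ⟨h2, h3, h4⟩ with h6 | h6
        · exact absurd ⟨(Prod.mk.inj h6).2, (Prod.mk.inj h6).1⟩ h5
        · exact h6
    · rw [hq' t' a' hta, h.mem_queue]
      have : ¬ (t' = t ∧ j = i ∧ a' = a ∧ v' = v) := fun hc => hta (by rw [hc.1, hc.2.2.1])
      simp [this]
  · intro t' a'
    by_cases hta : (t', a') = (t, a)
    · obtain ⟨rfl, rfl⟩ := Prod.mk.inj hta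
      rw [hq]
      exact hsort.2
    · rw [hq' t' a' hta]
      exact h.sorted t' a'
  · intro b
    rw [hlen]
    by_cases hba : b = a
    · subst hba
      refine Or.inl ⟨(t, i), (hext.stores hti.1 b).2 hti, by rw [hio, hmem], by omega,
        fun k hk hkc => by omega⟩
    · rw [hmem' b hba]
      have hc' : ∀ n, (graphOf (τ ++ [⟨t, i, .st a v⟩]) cnt op).Stores n b →
          (graphOf (τ ++ [⟨t, i, .st a v⟩]) cnt op).com n < τ.length + 1 →
          (graphOf τ cnt op).Stores n b ∧ (graphOf τ cnt op).com n < τ.length :=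
        fun n hn hc => ⟨(hext.stores (g := graphOf τ cnt op) hn.1 b).1 hn,
          (hcommitted n b hn hc).resolve_right fun h => hba h.2⟩
      rcases h.mem b with ⟨m, hm, hv, hc, hl⟩ | ⟨hv, hl⟩
      · refine Or.inl ⟨m, (hext.stores hm.1 b).2 hm, hv, ?_, fun k hk hkc => ?_⟩
        · rw [hext.com_of_lt m hm.1 hc]; omega
        · obtain ⟨hk', hkc'⟩ := hc' k hk hkc
          rw [hext.com_of_lt m hm.1 hc, hext.com_of_lt k hk'.1 hkc']
          exact hl k hk' hkc'
      · refine Or.inr ⟨hv, fun k hk hkc => ?_⟩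
        obtain ⟨hk', hkc'⟩ := hc' k hk hkc
        exact hl k hk' hkc'
  · have hcon := h.consistent
    rw [hlen]
    refine ⟨fun n hn => ?_, fun t' j k hij hj => ?_, fun n a hn => ?_,
      fun t' j k b hjk hj hk hc => ?_, fun t' j k b hjk hj hk hf => ?_, fun n a v hn hv => ?_⟩
    · have := hext.old n hn; omega
    · have hi : (graphOf τ cnt op).Valid (t', j) := lt_trans hij hj
      rw [(hext.old _ hi).2.2.1, (hext.old (t', k) hj).2.2.1]
      exact hcon.po t' j k hij hj
    · have hn' := (hext.stores (g := graphOf τ cnt op) hn.1 a).1 hn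
      have h1 := hcon.iss_lt_com n a hn'
      have h2 := hext.old n hn.1
      have h3 := hext.com_of_lt n hn.1
      have h4 := hext.com_of_not_lt n hn.1
      omega
    · have hj' := (hext.stores (g := graphOf τ cnt op) hj.1 b).1 hj
      have hk' := (hext.stores (g := graphOf τ cnt op) hk.1 b).1 hk
      rcases hcommitted _ b hk hc with hc' | ⟨hki, rfl⟩
      · have := hcon.fifo t' j k b hjk hj' hk' hc'
        rw [hext.com_of_lt _ hj.1 (by omega), hext.com_of_lt _ hk.1 hc']
        exact this
      · obtain ⟨rfl, rfl⟩ := Prod.mk.inj hki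
        -- If the earlier store were uncommitted, it would be queued, at the head or behind it;
        -- either way its index could not be smaller than that of the head.
        have hc' : (graphOf τ cnt op).com (t', j) < τ.length := by
          by_contra hc'
          obtain ⟨hjv, v', hv'⟩ := hj'
          have hm : (v', j) ∈ queue t' b := (h.mem_queue t' b v' j).2 ⟨hjv, hv', fun hm => hc' (by
            simp only [graphOf] at hv' ⊢
            rw [hv']; exact pos_lt_length.2 hm)⟩
          rw [hb, List.mem_cons] at hm
          rcases hm with hm | hm
          · have := (Prod.mk.inj hm).2; omega
          · have := hsort.1 _ hm
            simp only at this; omega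
        rw [hnew, hext.com_of_lt _ hj.1 hc']
        exact hc'
    · have hj' := (hext.stores (g := graphOf τ cnt op) hj.1 b).1 hj
      have := hcon.scfence t' j k b hjk hj' hk hf
      have h2 := hext.old (t', k) hk
      rw [h2.2.2.1, hext.com_of_lt _ hj.1 (by omega)]
      exact this
    · exact hext.read hcon hn hv

end Preservation

/-! ### From reachable states to execution graphs -/

section Reachability

variable {Dom : Type u} {T : Type v} {R : T → Type w} {L : Type x}

/-- The stores to `a` buffered by thread `t`, oldest first. -/
noncomputable def State.queue (s : State Dom T R L) (t : T) (a : Dom) : List (Dom × ℕ) :=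
  (s.buf₂ t).filterMap (fun c => (c.1.valueAt a).map fun v => (v, c.2)) ++ s.buf₁ t a

theorem State.map_fst_queue (s : State Dom T R L) (t : T) (a : Dom) :
    (s.queue t a).map Prod.fst = s.stores₂ t a ++ (s.buf₁ t a).map Prod.fst := by
  simp only [State.queue, State.stores₂, List.map_append, List.map_filterMap]
  congr 2
  funext c
  simp [Function.comp_def]

/-- The three rules for loads merge into one: the newest queued value, with memory as the default.
-/
theorem State.Reads.eq {s : State Dom T R L} {t : T} {a v : Dom} (h : s.Reads t a v) :
    v = ((s.queue t a).getLast?.map Prod.fst).getD (s.mem a) := by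
  rw [← List.getLast?_map, State.map_fst_queue]
  cases h with
  | early₁ β _ i h₁ => simp [h₁]
  | early₂ β _ h₁ h₂ => simp [h₁, h₂]
  | memory h₁ h₂ => simp [h₁, h₂]

variable [Zero Dom] {P : Program Dom T R L}

/-- Moving a store between the two buffers does not change `State.queue`, so silent steps are
invisible. The two rules for lightweight fences cannot fire: the program has no such instruction,
and the absence of fence entries in the buffers is carried along. -/
theorem Program.Step.invariant (hP : P.NoFence) {s s' : State Dom T R L}
    {o : Option (Event Dom T)} (hs : P.Step s o s') {τ : List (Event Dom T)}
    {op : T × ℕ → Op Dom}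
    (h : Invariant P τ (fun t => (s.pc t, s.reg t)) s.mem s.queue s.count op)
    (hf : ∀ t, ∀ c ∈ s.buf₂ t, ∀ as, c.1 ≠ .fence as) :
    (∃ op', Invariant P (τ ++ o.toList) (fun t => (s'.pc t, s'.reg t)) s'.mem s'.queue
      s'.count op') ∧ ∀ t, ∀ c ∈ s'.buf₂ t, ∀ as, c.1 ≠ .fence as := by
  classical
  cases hs with
  | load t l' r e v hi hv =>
    refine ⟨⟨Function.update op (t, s.count t) (.ld (e.eval (s.reg t)) v), ?_⟩, hf⟩
    refine h.exec (t := t) (o := .ld (e.eval (s.reg t)) v) ?_ ?_ ?_ (by simp) ?_ ?_ ?_ ?_ ?_ ?_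
    · simpa [State.goto, State.setReg] using Program.LocalStep.load v hi
    · intro t' ht; simp [State.goto, State.setReg, ht]
    · intro a v' hav
      simp only [Op.ld.injEq] at hav
      obtain ⟨rfl, rfl⟩ := hav
      exact hv.eq
    · intro a; simp [State.queue, State.goto, State.setReg, Op.entry]
    · intro t' _ a; simp [State.queue, State.goto, State.setReg]
    · simp [State.goto, State.setReg]
    · intro t' ht; simp [State.goto, State.setReg, ht]
    · simp
    · intro n hn; simp [hn]
  | issueStore t l' ea ev a v hi ha hv =>
    refine ⟨⟨Function.update op (t, s.count t) (.st a v), ?_⟩, hf⟩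
    refine h.exec (t := t) (o := .st a v) ?_ ?_ (by simp) (by simp) ?_ ?_ ?_ ?_ ?_ ?_
    · subst ha hv
      simpa [State.goto, State.setBuf₁] using Program.LocalStep.store hi
    · intro t' ht; simp [State.goto, State.setBuf₁, ht]
    · intro b
      by_cases hb : a = b
      · subst hb
        simp [State.queue, State.goto, State.setBuf₁, Op.entry]
      · simp [State.queue, State.goto, State.setBuf₁, Op.entry, hb, Ne.symm hb]
    · intro t' ht b; simp [State.queue, State.goto, State.setBuf₁, ht]
    · simp [State.goto, State.setBuf₁]
    · intro t' ht; simp [State.goto, State.setBuf₁, ht]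
    · simp
    · intro n hn; simp [hn]
  | advance t a v i β hb =>
    refine ⟨⟨op, ?_⟩, ?_⟩
    · have hq : ((s.setBuf₁ t a β).setBuf₂ t (s.buf₂ t ++ [(Entry.store a v, i)])).queue
          = s.queue := by
        funext t' b
        by_cases ht : t' = t
        · subst ht
          by_cases hb' : b = a
          · subst hb'
            simp [State.queue, State.setBuf₁, State.setBuf₂, hb, Entry.valueAt]
          · simp [State.queue, State.setBuf₁, State.setBuf₂, Entry.valueAt, hb', Ne.symm hb']
        · simp [State.queue, State.setBuf₁, State.setBuf₂, ht]
      rw [hq]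
      simpa [State.setBuf₁, State.setBuf₂] using h
    · intro t' c hc
      by_cases ht : t' = t
      · subst ht
        simp only [State.setBuf₁, State.setBuf₂, Function.update_self, List.mem_append,
          List.mem_singleton] at hc
        rcases hc with hc | rfl
        · exact hf t' c hc
        · simp
      · simp only [State.setBuf₁, State.setBuf₂, Function.update_of_ne ht] at hc
        exact hf t' c hc
  | storeToMemory t a v i β hb =>
    refine ⟨⟨op, ?_⟩, ?_⟩
    · refine h.commit (t := t) (a := a) (v := v) (i := i) (β := β.filterMap
        (fun c => (c.1.valueAt a).map fun v => (v, c.2)) ++ s.buf₁ t a) ?_ ?_ ?_ ?_ ?_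
      · simp [State.queue, hb, Entry.valueAt]
      · simp [State.queue, State.setMem, State.setBuf₂]
      · intro t' b hne
        by_cases ht : t' = t
        · subst ht
          have hb' : a ≠ b := by rintro rfl; exact hne rfl
          simp [State.queue, State.setMem, State.setBuf₂, hb, Entry.valueAt, hb']
        · simp [State.queue, State.setMem, State.setBuf₂, ht]
      · simp [State.setMem, State.setBuf₂]
      · intro b hb; simp [State.setMem, State.setBuf₂, hb]
    · intro t' c hc
      by_cases ht : t' = t
      · subst ht
        simp only [State.setMem, State.setBuf₂, Function.update_self] at hc
        exact hf t' c (by rw [hb]; exact List.mem_cons_of_mem _ hc)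
      · simp only [State.setMem, State.setBuf₂, Function.update_of_ne ht] at hc
        exact hf t' c hc
  | scfence t l' hi hb =>
    refine ⟨⟨Function.update op (t, s.count t) .scfence, ?_⟩, hf⟩
    refine h.exec (t := t) (o := .scfence) ?_ ?_ (by simp) ?_ ?_ ?_ ?_ ?_ ?_ ?_
    · simpa [State.goto] using Program.LocalStep.scfence hi
    · intro t' ht; simp [State.goto, ht]
    · intro _ a; simp [State.queue, hb.1, hb.2 a]
    · intro a; simp [State.queue, State.goto, Op.entry]
    · intro t' _ a; simp [State.queue, State.goto]
    · simp [State.goto]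
    · intro t' ht; simp [State.goto, ht]
    · simp
    · intro n hn; simp [hn]
  | issueFence t l' es as hi ha hb => exact absurd hi (hP t _ es l')
  | fence t as i β hb => exact absurd rfl (hf t (.fence as, i) (by simp [hb]) as)
  | assign t l' r e hi =>
    refine ⟨⟨Function.update op (t, s.count t) .loc, ?_⟩, hf⟩
    refine h.exec (t := t) (o := .loc) ?_ ?_ (by simp) (by simp) ?_ ?_ ?_ ?_ ?_ ?_
    · simpa [State.goto, State.setReg] using Program.LocalStep.assign hi
    · intro t' ht; simp [State.goto, State.setReg, ht]
    · intro a; simp [State.queue, State.goto, State.setReg, Op.entry]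
    · intro t' _ a; simp [State.queue, State.goto, State.setReg]
    · simp [State.goto, State.setReg]
    · intro t' ht; simp [State.goto, State.setReg, ht]
    · simp
    · intro n hn; simp [hn]
  | assert t l' e hi he =>
    refine ⟨⟨Function.update op (t, s.count t) .loc, ?_⟩, hf⟩
    refine h.exec (t := t) (o := .loc) ?_ ?_ (by simp) (by simp) ?_ ?_ ?_ ?_ ?_ ?_
    · simpa [State.goto] using Program.LocalStep.assert hi he
    · intro t' ht; simp [State.goto, ht]
    · intro a; simp [State.queue, State.goto, Op.entry]
    · intro t' _ a; simp [State.queue, State.goto]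
    · simp [State.goto]
    · intro t' ht; simp [State.goto, ht]
    · simp
    · intro n hn; simp [hn]

theorem Program.Reaches.invariant (hP : P.NoFence) {τ : List (Event Dom T)}
    {s : State Dom T R L} (h : P.Reaches τ s) :
    (∃ op, Invariant P τ (fun t => (s.pc t, s.reg t)) s.mem s.queue s.count op) ∧
      ∀ t, ∀ c ∈ s.buf₂ t, ∀ as, c.1 ≠ .fence as := by
  induction h with
  | init =>
    refine ⟨⟨fun _ => .isu, ?_⟩, by simp [Program.initState]⟩
    constructor
    · exact List.nodup_nil
    · exact fun t => ⟨fun _ => (P.init t, fun _ => 0), ⟨rfl, by simp [Program.initState]⟩, rfl⟩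
    · simp
    · simp [Program.initState]
    · simp [Program.initState, State.queue]
    · simp [Program.initState, State.queue]
    · exact fun a => Or.inr ⟨rfl, by simp [graphOf]⟩
    · constructor <;>
        simp [Graph.Valid, Graph.Stores, graphOf, Program.initState]
  | silent _ hs ih =>
    obtain ⟨⟨op, h⟩, hf⟩ := ih
    simpa using hs.invariant hP h hf
  | act _ hs ih =>
    obtain ⟨⟨op, h⟩, hf⟩ := ih
    simpa using hs.invariant hP h hf

/-- `g` is the execution graph of the computation `τ`. -/
structure Realizes (P : Program Dom T R L) (τ : List (Event Dom T)) (g : Graph Dom T) :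
    Prop where
  nodup : τ.Nodup
  run : ∀ t, ∃ c, P.LocalRun g.op t (g.cnt t) c
  mem_iff : ∀ e, e ∈ τ ↔
    g.Valid e.node ∧ (e.op = (g.op e.node).exec ∨ e.op = g.op e.node)
  iss_eq : ∀ n, g.iss n = pos τ ⟨n.1, n.2, (g.op n).exec⟩
  com_eq : ∀ n, g.com n = pos τ ⟨n.1, n.2, g.op n⟩
  consistent : g.Consistent τ.length

theorem Program.exists_realizes (hP : P.NoFence) {τ : List (Event Dom T)} (h : τ ∈ P.Comp) :
    ∃ g, Realizes P τ g := by
  obtain ⟨s, hs, hb⟩ := h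
  obtain ⟨⟨op, h⟩, -⟩ := hs.invariant hP
  refine ⟨graphOf τ s.count op, h.nodup, fun t => (h.run t).imp fun c hc => hc.1, fun e => ?_,
    fun _ => rfl, fun _ => rfl, h.consistent⟩
  refine ⟨h.sound e, ?_⟩
  obtain ⟨t, i, o⟩ := e
  rintro ⟨hv, ho | ho⟩
  · simp only [Event.node] at hv ho
    subst ho
    exact h.issued t i hv
  · simp only [Event.node] at hv ho
    have ho' : op (t, i) = o := ho.symm
    -- A store event is present because the final buffers are empty; any other operation is its own
    -- execution event.
    by_cases hst : ∃ a v, o = .st a v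
    · obtain ⟨a, v, rfl⟩ := hst
      by_contra hm
      have := (h.mem_queue t a v i).2 ⟨hv, ho', hm⟩
      simp [State.queue, (hb t).1, (hb t).2 a] at this
    · obtain ⟨c, hc, -⟩ := h.run t
      have hne := (hc.2 i hv).op_ne
      have := h.issued t i hv
      rw [ho'] at this hne
      have he : o.exec = o := by
        cases o with
        | st a v => exact absurd ⟨a, v, rfl⟩ hst
        | fence as => exact absurd rfl (hne.2 as)
        | _ => rfl
      rwa [he] at this

end Reachability

/-! ### Happens-before on the graph and on the trace; acyclicity under SC -/

section HappensBefore

variable {Dom : Type u} {T : Type v}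

namespace Graph

def PO (g : Graph Dom T) (n m : T × ℕ) : Prop := n.1 = m.1 ∧ n.2 < m.2 ∧ g.Valid m

def ST (g : Graph Dom T) (n m : T × ℕ) : Prop :=
  ∃ a, g.Stores n a ∧ g.Stores m a ∧ g.com n < g.com m

def SRC (g : Graph Dom T) (m n : T × ℕ) : Prop := ∃ a, g.Loads n a ∧ g.Source a m n

/-- The transitive version of the conflict relation: the load `n` is in conflict with all stores
after its source. -/
def CF (g : Graph Dom T) (n m : T × ℕ) : Prop :=
  ∃ a, g.Loads n a ∧ g.Stores m a ∧ ∀ k, g.Source a k n → g.com k < g.com m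

def HB (g : Graph Dom T) (n m : T × ℕ) : Prop := g.PO n m ∨ g.ST n m ∨ g.SRC n m ∨ g.CF n m

theorem Source.stores {g : Graph Dom T} {a : Dom} {m n : T × ℕ} (h : g.Source a m n) :
    g.Stores m a := by
  rcases h with ⟨h, -⟩ | ⟨-, h, -⟩
  exacts [h.1, h]

theorem Stores.addr_eq {g : Graph Dom T} {n : T × ℕ} {a b : Dom} (h : g.Stores n a)
    (h' : g.Stores n b) : a = b := by
  obtain ⟨-, v, hv⟩ := h
  obtain ⟨-, v', hv'⟩ := h'
  rw [hv] at hv'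
  simp only [Op.st.injEq] at hv'
  exact hv'.1

theorem Loads.addr_eq {g : Graph Dom T} {n : T × ℕ} {a b : Dom} (h : g.Loads n a)
    (h' : g.Loads n b) : a = b := by
  obtain ⟨-, v, hv⟩ := h
  obtain ⟨-, v', hv'⟩ := h'
  rw [hv] at hv'
  simp only [Op.ld.injEq] at hv'
  exact hv'.1

theorem Stores.not_loads {g : Graph Dom T} {n : T × ℕ} {a b : Dom} (h : g.Stores n a) :
    ¬ g.Loads n b := by
  rintro ⟨-, v', hv'⟩
  obtain ⟨-, v, hv⟩ := h
  rw [hv] at hv'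
  cases hv'

end Graph

/-- The happens-before relation of a trace. -/
def Trace.HB (tr : Trace Dom T) (n m : T × ℕ) : Prop :=
  tr.po n m ∨ tr.st n m ∨ tr.src n m ∨ tr.cf n m

theorem Op.exec_ne_fence (o : Op Dom) (as : List Dom) : o.exec ≠ .fence as := by
  cases o <;> simp [Op.exec]

variable {R : T → Type w} {L : Type x} [Zero Dom] {P : Program Dom T R L}
  {τ : List (Event Dom T)} {g : Graph Dom T}

namespace Realizes

variable (h : Realizes P τ g)
include h

theorem before_iff {e f : Event Dom T} : Before τ e f ↔ f ∈ τ ∧ pos τ e < pos τ f :=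
  pair_sublist_iff h.nodup

theorem op_ne {n : T × ℕ} (hn : g.Valid n) : g.op n ≠ .isu ∧ ∀ as, g.op n ≠ .fence as := by
  obtain ⟨c, hc⟩ := h.run n.1
  exact (hc.2 n.2 hn).op_ne

theorem exec_mem {n : T × ℕ} (hn : g.Valid n) : (⟨n.1, n.2, (g.op n).exec⟩ : Event Dom T) ∈ τ :=
  (h.mem_iff _).2 ⟨hn, Or.inl rfl⟩

theorem op_mem {n : T × ℕ} (hn : g.Valid n) : (⟨n.1, n.2, g.op n⟩ : Event Dom T) ∈ τ :=
  (h.mem_iff _).2 ⟨hn, Or.inr rfl⟩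

theorem iss_inj {n m : T × ℕ} (hn : g.Valid n) (hm : g.Valid m) (he : g.iss n = g.iss m) :
    n = m := by
  rw [h.iss_eq, h.iss_eq] at he
  have := pos_inj (h.exec_mem hn) (h.exec_mem hm) he
  simp only [Event.mk.injEq] at this
  exact Prod.ext this.1 this.2.1

theorem com_inj {n m : T × ℕ} (hn : g.Valid n) (hm : g.Valid m) (he : g.com n = g.com m) :
    n = m := by
  rw [h.com_eq, h.com_eq] at he
  have := pos_inj (h.op_mem hn) (h.op_mem hm) he
  simp only [Event.mk.injEq] at this
  exact Prod.ext this.1 this.2.1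

theorem com_ne_iss {n m : T × ℕ} {a : Dom} (hm : g.Stores m a) (hn : g.Valid n) :
    g.com m ≠ g.iss n := by
  intro he
  rw [h.iss_eq, h.com_eq] at he
  have := pos_inj (h.op_mem hm.1) (h.exec_mem hn) he
  simp only [Event.mk.injEq] at this
  obtain ⟨-, v, hv⟩ := hm
  exact Op.exec_ne_st _ a v (this.2.2.symm.trans hv)

theorem iss_lt_iff {t : T} {i j : ℕ} (hi : g.Valid (t, i)) (hj : g.Valid (t, j)) :
    g.iss (t, i) < g.iss (t, j) ↔ i < j := by
  refine ⟨fun hl => ?_, fun hl => h.consistent.po t i j hl hj⟩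
  by_contra hc
  rcases Nat.lt_or_eq_of_le (not_lt.1 hc) with hc | rfl
  · have := h.consistent.po t j i hc hi
    omega
  · omega

theorem com_lt_length {n : T × ℕ} (hn : g.Valid n) : g.com n < τ.length := by
  rw [h.com_eq]
  exact pos_lt_length.2 (h.op_mem hn)

theorem source_unique {a : Dom} {n m m' : T × ℕ} (hm : g.Source a m n) (hm' : g.Source a m' n) :
    m = m' := by
  rcases hm with ⟨hp, hl⟩ | ⟨hp, hs, hc, hl⟩ <;> rcases hm' with ⟨hp', hl'⟩ | ⟨hp', hs', hc', hl'⟩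
  · exact Prod.ext (hp.2.1.trans hp'.2.1.symm) (le_antisymm (hl' m hp) (hl m' hp'))
  · exact absurd hp (hp' m)
  · exact absurd hp' (hp m')
  · exact h.com_inj hs.1 hs'.1 (le_antisymm (hl' m hs hc) (hl m' hs' hc'))

theorem eq_exec {e : Event Dom T} (he : e ∈ τ) (hs : ¬ (e.IsStore ∨ e.IsFence)) :
    g.Valid e.node ∧ e = ⟨e.node.1, e.node.2, (g.op e.node).exec⟩ := by
  obtain ⟨hv, ho⟩ := (h.mem_iff e).1 he
  refine ⟨hv, ?_⟩
  suffices e.op = (g.op e.node).exec by rw [← this]; rfl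
  rcases ho with ho | ho
  · exact ho
  · rw [ho]
    cases hop : g.op e.node with
    | st a v => exact absurd (Or.inl ⟨a, v, ho.trans hop⟩) hs
    | fence as => exact absurd (Or.inr ⟨as, ho.trans hop⟩) hs
    | _ => rfl

theorem eq_op {e : Event Dom T} {a : Dom} (he : e ∈ τ) (hs : e.StoresTo a) :
    g.Stores e.node a ∧ e = ⟨e.node.1, e.node.2, g.op e.node⟩ := by
  obtain ⟨hv, ho⟩ := (h.mem_iff e).1 he
  obtain ⟨v, hv'⟩ := hs
  rcases ho with ho | ho
  · exact absurd (ho.symm.trans hv') (Op.exec_ne_st _ a v)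
  · exact ⟨⟨hv, v, ho.symm.trans hv'⟩, by rw [← ho]; rfl⟩

theorem eq_load {e : Event Dom T} {a : Dom} (he : e ∈ τ) (hs : e.LoadsFrom a) :
    g.Loads e.node a ∧ pos τ e = g.iss e.node := by
  obtain ⟨v, hv⟩ := hs
  obtain ⟨h1, h2⟩ := h.eq_exec he (by
    rintro (⟨b, v', hs⟩ | ⟨as, hs⟩) <;> rw [hv] at hs <;> cases hs)
  refine ⟨⟨h1, v, ?_⟩, by rw [h.iss_eq, ← h2]⟩
  rcases ((h.mem_iff e).1 he).2 with ho | ho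
  · rw [hv] at ho
    cases hop : g.op e.node with
    | ld b w => rw [hop] at ho; exact ho.symm
    | _ => rw [hop] at ho; simp [Op.exec] at ho
  · rw [← ho, hv]

theorem eq_issue {e : Event Dom T} (he : e ∈ τ) (hs : e.IsIssue) :
    g.Valid e.node ∧ pos τ e = g.iss e.node := by
  obtain ⟨h1, h2⟩ := h.eq_exec he (by
    rintro (⟨b, v', h'⟩ | ⟨as, h'⟩) <;> rw [hs] at h' <;> cases h')
  exact ⟨h1, by rw [h.iss_eq, ← h2]⟩

theorem po_iff {n m : T × ℕ} : PO τ n m ↔ g.PO n m := by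
  constructor
  · rintro ⟨e, f, hb, ht, he, hf, rfl, rfl⟩
    obtain ⟨hfm, hl⟩ := h.before_iff.1 hb
    have hem : e ∈ τ := pos_lt_length.1 (lt_of_lt_of_le hl pos_le_length)
    obtain ⟨hev, he'⟩ := h.eq_exec hem he
    obtain ⟨hfv, hf'⟩ := h.eq_exec hfm hf
    refine ⟨ht, ?_, hfv⟩
    rw [he', hf', ← h.iss_eq, ← h.iss_eq] at hl
    obtain ⟨t, i, o⟩ := e
    obtain ⟨t', j, o'⟩ := f
    simp only at ht
    subst ht
    exact (h.iss_lt_iff hev hfv).1 hl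
  · rintro ⟨ht, hl, hv⟩
    obtain ⟨t, i⟩ := n
    obtain ⟨t', j⟩ := m
    simp only at ht hl
    subst ht
    have hi : g.Valid (t, i) := lt_trans hl hv
    refine ⟨⟨t, i, (g.op (t, i)).exec⟩, ⟨t, j, (g.op (t, j)).exec⟩,
      h.before_iff.2 ⟨h.exec_mem hv, ?_⟩, rfl, ?_, ?_, rfl, rfl⟩
    · have := h.consistent.po t i j hl hv
      rwa [h.iss_eq, h.iss_eq] at this
    all_goals
      rintro (⟨a, v, hs⟩ | ⟨as, hs⟩)
      exacts [Op.exec_ne_st _ _ _ hs, Op.exec_ne_fence _ _ hs]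

theorem st_iff {n m : T × ℕ} : ST τ n m ↔ g.ST n m := by
  constructor
  · rintro ⟨a, e, f, hb, he, hf, rfl, rfl⟩
    obtain ⟨hfm, hl⟩ := h.before_iff.1 hb
    have hem : e ∈ τ := pos_lt_length.1 (lt_of_lt_of_le hl pos_le_length)
    obtain ⟨hev, he'⟩ := h.eq_op hem he
    obtain ⟨hfv, hf'⟩ := h.eq_op hfm hf
    rw [he', hf', ← h.com_eq, ← h.com_eq] at hl
    exact ⟨a, hev, hfv, hl⟩
  · rintro ⟨a, hn, hm, hl⟩
    rw [h.com_eq, h.com_eq] at hl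
    exact ⟨a, _, _, h.before_iff.2 ⟨h.op_mem hm.1, hl⟩, hn.2, hm.2, rfl, rfl⟩

theorem pendingAt_iff {l y : Event Dom T} {a : Dom} (hl : l ∈ τ) (hla : l.LoadsFrom a) :
    PendingAt τ a l y ↔ y = ⟨y.node.1, y.node.2, g.op y.node⟩ ∧ g.Pending a y.node l.node := by
  obtain ⟨hlo, hlp⟩ := h.eq_load hl hla
  constructor
  · rintro ⟨hy, ht, hb, i, hi, hin, hbi⟩
    obtain ⟨hym, hly⟩ := h.before_iff.1 hb
    obtain ⟨-, hil⟩ := h.before_iff.1 hbi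
    have him : i ∈ τ := pos_lt_length.1 (lt_of_lt_of_le hil pos_le_length)
    obtain ⟨hys, hy'⟩ := h.eq_op hym hy
    obtain ⟨hiv, hip⟩ := h.eq_issue him hi
    refine ⟨hy', hys, ht, ?_, ?_⟩
    · rw [hip, hlp, hin] at hil
      obtain ⟨t, k, o⟩ := y
      obtain ⟨t', k', o'⟩ := l
      simp only at ht
      subst ht
      exact (h.iss_lt_iff hys.1 hlo.1).1 hil
    · rw [h.com_eq, ← hy', ← hlp]
      omega
  · rintro ⟨hy, hs, ht, hl', hc⟩
    refine ⟨?_, ht, h.before_iff.2 ⟨?_, ?_⟩, ⟨y.node.1, y.node.2, (g.op y.node).exec⟩, ?_, rfl,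
      h.before_iff.2 ⟨hl, ?_⟩⟩
    · rw [hy]; exact hs.2
    · rw [hy]; exact h.op_mem hs.1
    · rw [hy, hlp, ← h.com_eq]
      have := h.com_ne_iss hs hlo.1
      omega
    · obtain ⟨-, v, hv⟩ := hs
      simp [Event.IsIssue, hv, Op.exec]
    · rw [hlp, ← h.iss_eq]
      obtain ⟨t, k, o⟩ := y
      obtain ⟨t', k', o'⟩ := l
      simp only [Event.node] at ht
      subst ht
      exact (h.iss_lt_iff hs.1 hlo.1).2 hl'

theorem isSource_iff {l y : Event Dom T} {a : Dom} (hl : l ∈ τ) (hla : l.LoadsFrom a) :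
    IsSource τ a y l ↔ y = ⟨y.node.1, y.node.2, g.op y.node⟩ ∧ g.Source a y.node l.node := by
  obtain ⟨hlo, hlp⟩ := h.eq_load hl hla
  have hno : (∀ z, ¬ PendingAt τ a l z) ↔ ∀ k, ¬ g.Pending a k l.node :=
    ⟨fun hp k hk => hp ⟨k.1, k.2, g.op k⟩ ((h.pendingAt_iff hl hla).2 ⟨rfl, hk⟩),
      fun hp z hz => hp _ ((h.pendingAt_iff hl hla).1 hz).2⟩
  unfold IsSource Graph.Source
  rw [and_or_left, hno]
  refine or_congr ?_ ?_
  · rw [h.pendingAt_iff hl hla, and_assoc]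
    refine and_congr_right fun hy => and_congr_right fun hp => ⟨fun hz k hk => ?_, fun hk z hz => ?_⟩
    · rcases hz ⟨k.1, k.2, g.op k⟩ ((h.pendingAt_iff hl hla).2 ⟨rfl, hk⟩) with rfl | hpo
      · exact le_rfl
      · exact (h.po_iff.1 hpo).2.1.le
    · obtain ⟨hz1, hz2⟩ := (h.pendingAt_iff hl hla).1 hz
      have ht : z.node.1 = y.node.1 := hz2.2.1.trans hp.2.1.symm
      rcases Nat.lt_or_eq_of_le (hk _ hz2) with hlt | heq
      · exact Or.inr (h.po_iff.2 ⟨ht, hlt, hp.1.1⟩)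
      · have : z.node = y.node := Prod.ext ht heq
        rw [hz1, hy, this]
        exact Or.inl rfl
  · constructor
    · rintro ⟨hp, hs, hb, hz⟩
      obtain ⟨-, hlt⟩ := h.before_iff.1 hb
      have hym : y ∈ τ := pos_lt_length.1 (lt_of_lt_of_le hlt pos_le_length)
      obtain ⟨hys, hy'⟩ := h.eq_op hym hs
      refine ⟨hy', hp, hys, by rw [h.com_eq, ← hy', ← hlp]; exact hlt, fun k hk hkc => ?_⟩
      rw [h.com_eq, ← hlp] at hkc
      rcases hz ⟨k.1, k.2, g.op k⟩ hk.2 (h.before_iff.2 ⟨hl, hkc⟩) with rfl | hb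
      · exact le_rfl
      · rw [h.com_eq, h.com_eq, ← hy']
        exact (h.before_iff.1 hb).2.le
    · rintro ⟨hy, hp, hs, hc, hz⟩
      rw [h.com_eq, ← hy, ← hlp] at hc
      refine ⟨hp, by rw [hy]; exact hs.2, h.before_iff.2 ⟨hl, hc⟩, fun z hzs hzb => ?_⟩
      obtain ⟨-, hlt⟩ := h.before_iff.1 hzb
      have hzm : z ∈ τ := pos_lt_length.1 (lt_of_lt_of_le hlt pos_le_length)
      obtain ⟨hzs', hz'⟩ := h.eq_op hzm hzs
      have := hz _ hzs' (by rw [h.com_eq, ← hz', ← hlp]; exact hlt)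
      have hym : y ∈ τ := by rw [hy]; exact h.op_mem hs.1
      rw [h.com_eq, h.com_eq, ← hz', ← hy] at this
      rcases Nat.lt_or_eq_of_le this with hlt | heq
      · exact Or.inr (h.before_iff.2 ⟨hym, hlt⟩)
      · exact Or.inl (pos_inj hzm hym heq)

theorem src_iff {n m : T × ℕ} : SRC τ m n ↔ g.SRC m n := by
  constructor
  · rintro ⟨a, y, l, hl, hla, hs, rfl, rfl⟩
    exact ⟨a, (h.eq_load hl hla).1, ((h.isSource_iff hl hla).1 hs).2⟩
  · rintro ⟨a, ⟨hv, v, ho⟩, hs⟩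
    have hla : (⟨n.1, n.2, g.op n⟩ : Event Dom T).LoadsFrom a := ⟨v, ho⟩
    exact ⟨a, ⟨m.1, m.2, g.op m⟩, ⟨n.1, n.2, g.op n⟩, h.op_mem hv, hla,
      (h.isSource_iff (h.op_mem hv) hla).2 ⟨rfl, hs⟩, rfl, rfl⟩

theorem cf_of_cf {n m : T × ℕ} (hcf : CF τ n m) : g.CF n m := by
  rcases hcf with ⟨k, hs, hst⟩ | ⟨a, l, y, hl, hla, rfl, hy, hya, rfl, hs, -⟩
  · obtain ⟨a, hn, hs⟩ := h.src_iff.1 hs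
    obtain ⟨b, hk, hm, hc⟩ := h.st_iff.1 hst
    obtain rfl := hs.stores.addr_eq hk
    exact ⟨a, hn, hm, fun k' hk' => by rwa [h.source_unique hk' hs]⟩
  · have hn := (h.eq_load hl hla).1
    exact ⟨a, hn, (h.eq_op hy hya).1, fun k hk => absurd (h.src_iff.2 ⟨a, hn, hk⟩) (hs k)⟩

theorem hb_of_hb {n m : T × ℕ} (hb : (traceOf τ).HB n m) : g.HB n m := by
  rcases hb with hb | hb | hb | hb
  · exact Or.inl (h.po_iff.1 hb)
  · exact Or.inr (Or.inl (h.st_iff.1 hb))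
  · exact Or.inr (Or.inr (Or.inl (h.src_iff.1 hb)))
  · exact Or.inr (Or.inr (Or.inr (h.cf_of_cf hb)))

theorem transGen_of_hb {n m : T × ℕ} (hb : g.HB n m) :
    Relation.TransGen (traceOf τ).HB n m := by
  rcases hb with hb | hb | hb | ⟨a, hn, hm, hk⟩
  · exact .single (Or.inl (h.po_iff.2 hb))
  · exact .single (Or.inr (Or.inl (h.st_iff.2 hb)))
  · exact .single (Or.inr (Or.inr (Or.inl (h.src_iff.2 hb))))
  · by_cases hs : ∃ k, g.Source a k n
    · obtain ⟨k, hs⟩ := hs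
      exact .single (Or.inr (Or.inr (Or.inr (Or.inl ⟨k, h.src_iff.2 ⟨a, hn, hs⟩,
        h.st_iff.2 ⟨a, hs.stores, hm, hk k hs⟩⟩))))
    · have hs' : ∀ k, ¬ SRC τ k n := fun k hsk => by
        obtain ⟨b, hn', hsk⟩ := h.src_iff.1 hsk
        obtain rfl := hn.addr_eq hn'
        exact hs ⟨k, hsk⟩
      -- A load without source conflicts, in the trace, only with the first store to its address.
      -- The later stores are reached from there by store order, by induction on the commit time.
      clear hk
      induction hc : g.com m using Nat.strong_induction_on generalizing m with
      | _ c ih =>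
        by_cases hst : ∃ k, ST τ k m
        · obtain ⟨k, hst⟩ := hst
          obtain ⟨b, hk, hm', hkc⟩ := h.st_iff.1 hst
          obtain rfl := hm.addr_eq hm'
          exact (ih _ (hc ▸ hkc) hk rfl).tail (Or.inr (Or.inl hst))
        · refine .single (Or.inr (Or.inr (Or.inr (Or.inr ⟨a, ⟨n.1, n.2, g.op n⟩,
            ⟨m.1, m.2, g.op m⟩, h.op_mem hn.1, hn.2, rfl, h.op_mem hm.1, hm.2, rfl, hs',
            fun k hk => hst ⟨k, hk⟩⟩))))

theorem transGen_iff {n m : T × ℕ} :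
    Relation.TransGen (traceOf τ).HB n m ↔ Relation.TransGen g.HB n m := by
  constructor
  · intro hb
    induction hb with
    | single hb => exact .single (h.hb_of_hb hb)
    | tail _ hb ih => exact ih.tail (h.hb_of_hb hb)
  · intro hb
    induction hb with
    | single hb => exact h.transGen_of_hb hb
    | tail _ hb ih => exact ih.trans (h.transGen_of_hb hb)

/-- The event after the issue is a store or fence of the same node; fences do not occur, and a node
has only one store event. -/
theorem com_eq_of_mem_SCComp (hsc : τ ∈ P.SCComp) {n : T × ℕ} {a : Dom} (hn : g.Stores n a) :
    g.com n = g.iss n + 1 := by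
  obtain ⟨e, he, hs, hen⟩ := hsc.2 _ _ (getElem?_pos (h.exec_mem hn.1)) (by
    obtain ⟨-, v, hv⟩ := hn
    simp [Event.IsIssue, hv, Op.exec])
  obtain ⟨hp, hpe⟩ := List.getElem?_eq_some_iff.1 he
  have hem : e ∈ τ := hpe ▸ List.getElem_mem _
  have hes : e.IsStore := by
    rcases hs with hs | ⟨as, hs⟩
    · exact hs
    · obtain ⟨hv, ho | ho⟩ := (h.mem_iff e).1 hem
      · exact absurd (ho.symm.trans hs) (Op.exec_ne_fence _ _)
      · exact absurd (ho.symm.trans hs) ((h.op_ne hv).2 as)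
  obtain ⟨b, hes⟩ := hes
  obtain ⟨-, he'⟩ := h.eq_op hem hes
  have hen' : e.node = n := hen
  rw [hen'] at he'
  rw [h.com_eq, ← he', h.iss_eq]
  have key : ∀ p (hp : p < τ.length), τ[p] = e → pos τ e = p := by
    rintro p hp rfl
    classical exact h.nodup.idxOf_getElem _ hp
  exact key _ hp hpe

/-- The delicate edge is conflict. If the store were issued before the load, its commit, which is
the very next event, would precede the load too. Then the load would have a source, committed no
earlier than this store, and there would be no conflict. -/
theorem iss_lt_of_hb (hsc : τ ∈ P.SCComp) {n m : T × ℕ} (hb : g.HB n m) :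
    g.iss n < g.iss m := by
  rcases hb with ⟨ht, hl, hv⟩ | ⟨a, hn, hm, hl⟩ | ⟨a, hn, hs⟩ | ⟨a, hn, hm, hk⟩
  · obtain ⟨t, i⟩ := n
    obtain ⟨t', j⟩ := m
    simp only at ht
    subst ht
    exact h.consistent.po t i j hl hv
  · rw [h.com_eq_of_mem_SCComp hsc hn, h.com_eq_of_mem_SCComp hsc hm] at hl
    omega
  · have := h.com_eq_of_mem_SCComp hsc hs.stores
    rcases hs with ⟨⟨hs, ht, hl, hc⟩, -⟩ | ⟨-, -, hc, -⟩
    · obtain ⟨t, i⟩ := n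
      obtain ⟨t', j⟩ := m
      simp only at ht
      subst ht
      exact h.consistent.po _ _ _ hl hn.1
    · omega
  · by_contra hc
    have h1 := h.com_eq_of_mem_SCComp hsc hm
    have h2 : g.iss m ≠ g.iss n := fun he => by
      obtain rfl := h.iss_inj hm.1 hn.1 he
      exact hm.not_loads hn
    have h3 := h.com_ne_iss hm hn.1
    have h4 : g.com m < g.iss n := by omega
    obtain ⟨hv, v, hop⟩ := hn
    rcases h.consistent.read n a v hv hop with ⟨k, -, hs⟩ | ⟨-, -, hs⟩
    · have h5 := hk k hs
      rcases hs with ⟨hp, -⟩ | ⟨-, -, -, hl⟩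
      · exact hp.2.2.2 (by omega)
      · have := hl m hm h4
        omega
    · exact hs m hm h4

theorem acyclic_of_mem_SCComp (hsc : τ ∈ P.SCComp) (n : T × ℕ) :
    ¬ Relation.TransGen (traceOf τ).HB n n := by
  rw [h.transGen_iff]
  have : ∀ m, Relation.TransGen g.HB n m → g.iss n < g.iss m := fun m hb => by
    induction hb with
    | single hb => exact h.iss_lt_of_hb hsc hb
    | tail _ hb ih => exact ih.trans (h.iss_lt_of_hb hsc hb)
  exact fun hb => lt_irrefl _ (this n hb)

end Realizes

end HappensBefore

/-! ### Replaying instances in a prescribed order -/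

section Replay

variable {Dom : Type u} {T : Type v} {R : T → Type w} {L : Type x}

/-- The events of an instruction instance that takes effect immediately. -/
def eventsOf (op : T × ℕ → Op Dom) (n : T × ℕ) : List (Event Dom T) :=
  match op n with
  | .st a v => [⟨n.1, n.2, .isu⟩, ⟨n.1, n.2, .st a v⟩]
  | o => [⟨n.1, n.2, o⟩]

open Classical in
/-- The effect of an operation on the memory. -/
noncomputable def Op.write (o : Op Dom) (μ : Dom → Dom) : Dom → Dom :=
  match o with
  | .st a v => Function.update μ a v
  | _ => μ

/-- The memory after the instances in `σ` have taken effect in this order. -/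
noncomputable def memAfter (op : T × ℕ → Op Dom) (μ : Dom → Dom) (σ : List (T × ℕ)) : Dom → Dom :=
  σ.foldl (fun μ n => (op n).write μ) μ

theorem memAfter_append (op : T × ℕ → Op Dom) (μ : Dom → Dom) (σ ρ : List (T × ℕ)) :
    memAfter op μ (σ ++ ρ) = memAfter op (memAfter op μ σ) ρ := List.foldl_append

theorem Op.write_of_ne {o : Op Dom} {a : Dom} (h : ∀ v, o ≠ .st a v) (μ : Dom → Dom) :
    o.write μ a = μ a := by
  cases o with
  | st b v =>
    have : a ≠ b := by rintro rfl; exact h v rfl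
    simp [Op.write, this]
  | _ => rfl

theorem memAfter_of_forall_ne {op : T × ℕ → Op Dom} {a : Dom} {σ : List (T × ℕ)}
    (h : ∀ n ∈ σ, ∀ v, op n ≠ .st a v) (μ : Dom → Dom) : memAfter op μ σ a = μ a := by
  induction σ generalizing μ with
  | nil => rfl
  | cons n σ ih =>
    refine (ih (fun k hk => h k (List.mem_cons_of_mem _ hk)) _).trans ?_
    exact Op.write_of_ne (h n (by simp)) μ

theorem memAfter_last {op : T × ℕ → Op Dom} {a v : Dom} {σ ρ : List (T × ℕ)} {n : T × ℕ}
    (hn : op n = .st a v) (h : ∀ k ∈ ρ, ∀ v, op k ≠ .st a v) (μ : Dom → Dom) :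
    memAfter op μ (σ ++ n :: ρ) a = v := by
  rw [memAfter_append]
  refine (memAfter_of_forall_ne h _).trans ?_
  simp [hn, Op.write]

/-- The value at `a` never depends on other addresses. This makes a missing write of the delayed
store harmless to loads from elsewhere. -/
theorem memAfter_congr {op : T × ℕ → Op Dom} {a : Dom} {μ ν : Dom → Dom} (h : μ a = ν a)
    (σ : List (T × ℕ)) : memAfter op μ σ a = memAfter op ν σ a := by
  induction σ generalizing μ ν with
  | nil => exact h
  | cons n σ ih =>
    refine ih ?_
    change (op n).write μ a = (op n).write ν a
    cases op n with
    | st b v => by_cases hb : a = b <;> simp [Op.write, hb, h]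
    | _ => exact h

theorem issue_followed_by_store (op : T × ℕ → Op Dom) {σ : List (T × ℕ)}
    (hσ : ∀ n ∈ σ, op n ≠ .isu) (p : ℕ) (i : Event Dom T)
    (hp : (σ.flatMap (eventsOf op))[p]? = some i) (hi : i.IsIssue) :
    ∃ e, (σ.flatMap (eventsOf op))[p + 1]? = some e ∧ (e.IsStore ∨ e.IsFence) ∧
      e.node = i.node := by
  induction σ generalizing p with
  | nil => simp at hp
  | cons n σ ih =>
    have ih' := ih fun k hk => hσ k (List.mem_cons_of_mem _ hk)
    have hn := hσ n (by simp)
    rw [List.flatMap_cons] at hp ⊢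
    by_cases hst : ∃ a v, op n = .st a v
    · obtain ⟨a, v, hst⟩ := hst
      simp only [eventsOf, hst, List.cons_append, List.nil_append] at hp ⊢
      match p with
      | 0 =>
        simp only [List.getElem?_cons_zero, Option.some.injEq] at hp
        subst hp
        exact ⟨_, rfl, Or.inl ⟨a, v, rfl⟩, rfl⟩
      | 1 =>
        simp only [List.getElem?_cons_succ, List.getElem?_cons_zero, Option.some.injEq] at hp
        subst hp
        cases hi
      | p + 2 => exact ih' p hp
    · have he : eventsOf op n = [⟨n.1, n.2, op n⟩] := by
        cases hop : op n with
        | st a v => exact absurd ⟨a, v, hop⟩ hst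
        | _ => simp [eventsOf, hop]
      rw [he] at hp ⊢
      match p with
      | 0 =>
        simp only [List.cons_append, List.getElem?_cons_zero, Option.some.injEq] at hp
        subst hp
        exact absurd hi hn
      | p + 1 => exact ih' p hp

variable [Zero Dom] {P : Program Dom T R L} {op : T × ℕ → Op Dom}
  {cfg : (t : T) → ℕ → L × (R t → Dom)}

/-- The state in which each thread `t` has executed `k t` instances, the memory is `μ`, and only
the per-address buffers `β` may be non-empty. -/
def stateAt (cfg : (t : T) → ℕ → L × (R t → Dom)) (k : T → ℕ) (μ : Dom → Dom)
    (β : T → Dom → List (Dom × ℕ)) : State Dom T R L where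
  pc := fun t => (cfg t (k t)).1
  reg := fun t => (cfg t (k t)).2
  mem := μ
  buf₁ := β
  buf₂ := fun _ => []
  count := k

/-- The events `τ` execute exactly the instances in `σ`, and end with memory `μ` and per-address
buffers `β`. -/
def Replays (P : Program Dom T R L) (cfg : (t : T) → ℕ → L × (R t → Dom))
    (τ : List (Event Dom T)) (σ : List (T × ℕ)) (μ : Dom → Dom)
    (β : T → Dom → List (Dom × ℕ)) : Prop :=
  ∃ k : T → ℕ, (∀ t i, i < k t ↔ (t, i) ∈ σ) ∧ P.Reaches τ (stateAt cfg k μ β)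

theorem Replays.nil (hcfg : ∀ t, cfg t 0 = (P.init t, fun _ => 0)) :
    Replays P cfg [] [] (fun _ => 0) (fun _ _ => []) := by
  refine ⟨fun _ => 0, by simp, ?_⟩
  have : stateAt cfg (fun _ => 0) (fun _ => 0) (fun _ _ => []) = P.initState := by
    simp [stateAt, Program.initState, hcfg]
  rw [this]
  exact .init

open Classical in
theorem count_update {k : T → ℕ} {σ : List (T × ℕ)} (hk : ∀ t i, i < k t ↔ (t, i) ∈ σ)
    {n : T × ℕ} (hn : n.2 = k n.1) (t : T) (i : ℕ) :
    i < Function.update k n.1 (n.2 + 1) t ↔ (t, i) ∈ σ ++ [n] := by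
  by_cases ht : t = n.1
  · subst ht
    rw [Function.update_self, List.mem_append, ← hk, List.mem_singleton, hn, Prod.ext_iff]
    simp only [true_and, hn]
    omega
  · have : (t, i) ≠ n := by rintro rfl; exact ht rfl
    rw [Function.update_of_ne ht, hk]
    simp [this]

theorem count_eq {k : T → ℕ} {σ : List (T × ℕ)} (hk : ∀ t i, i < k t ↔ (t, i) ∈ σ)
    {n : T × ℕ} (hn : n ∉ σ) (hpre : ∀ j < n.2, (n.1, j) ∈ σ) : n.2 = k n.1 := by
  refine le_antisymm (not_lt.1 fun h => ?_) (not_lt.1 fun h => hn ((hk n.1 n.2).1 h))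
  exact lt_irrefl _ ((hk _ _).2 (hpre _ h))

omit [Zero Dom] in
open Classical in
theorem stateAt_goto {k : T → ℕ} {μ : Dom → Dom} {β : T → Dom → List (Dom × ℕ)} {t : T} {i : ℕ}
    (hi : i = k t) {l : L} {ρ : R t → Dom} (hc : cfg t (i + 1) = (l, ρ)) :
    { (stateAt cfg k μ β).goto t l with
      reg := Function.update (fun t => (cfg t (k t)).2) t ρ } =
    stateAt cfg (Function.update k t (i + 1)) μ β := by
  subst hi
  simp only [stateAt, State.goto, State.mk.injEq, and_true]
  constructor
  · funext t'
    by_cases ht : t' = t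
    · subst ht; simp [hc]
    · simp [ht]
  · funext t'
    by_cases ht : t' = t
    · subst ht; simp [hc]
    · simp [ht]

omit [Zero Dom] in
theorem stateAt_goto' {k : T → ℕ} {μ : Dom → Dom} {β : T → Dom → List (Dom × ℕ)} {t : T} {i : ℕ}
    (hi : i = k t) {l : L} (hc : cfg t (i + 1) = (l, (cfg t (k t)).2)) :
    (stateAt cfg k μ β).goto t l =
      stateAt cfg (open Classical in Function.update k t (i + 1)) μ β := by
  rw [← stateAt_goto hi hc]
  simp [State.goto, stateAt]

/-- Execution of an instance that takes effect immediately. -/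
theorem Replays.step {τ : List (Event Dom T)} {σ : List (T × ℕ)} {μ : Dom → Dom}
    {β : T → Dom → List (Dom × ℕ)} (h : Replays P cfg τ σ μ β) {n : T × ℕ} (hn : n ∉ σ)
    (hpre : ∀ j < n.2, (n.1, j) ∈ σ)
    (hs : P.LocalStep n.1 (cfg n.1 n.2) (op n) (cfg n.1 (n.2 + 1)))
    (hld : ∀ a v, op n = .ld a v →
      (β n.1 a = [] ∧ v = μ a) ∨ ∃ j, β n.1 a = [(v, j)])
    (hst : ∀ a v, op n = .st a v → β n.1 a = [])
    (hsc : op n = .scfence → ∀ a, β n.1 a = []) :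
    Replays P cfg (τ ++ eventsOf op n) (σ ++ [n]) ((op n).write μ) β := by
  classical
  obtain ⟨k, hk, hr⟩ := h
  obtain ⟨t, i⟩ := n
  have hi : i = k t := count_eq hk hn hpre
  refine ⟨Function.update k t (i + 1), count_update (n := (t, i)) hk hi, ?_⟩
  simp only at hs hld hst hsc
  generalize hc : cfg t i = c at hs
  generalize hc' : cfg t (i + 1) = c' at hs
  have hpc : (stateAt cfg k μ β).pc t = c.1 := by simp [stateAt, ← hi, hc]
  have hreg : (stateAt cfg k μ β).reg t = c.2 := by simp [stateAt, ← hi, hc]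
  have hreg' : (cfg t (k t)).2 = c.2 := hreg
  have hcount : (stateAt cfg k μ β).count t = i := hi.symm
  generalize ho : op (t, i) = o at hs
  cases hs with
  | @load l l' ρ r e v hinstr =>
    have hrd : (stateAt cfg k μ β).Reads t (e.eval ρ) v := by
      rcases hld _ _ ho with ⟨h1, rfl⟩ | ⟨j, h1⟩
      · exact .memory h1 rfl
      · exact .early₁ [] v j h1
    have hstep := Program.Step.load (P := P) (stateAt cfg k μ β) t l' r e v
      (by rw [hpc]; exact hinstr) (by rw [hreg]; exact hrd)
    rw [hreg, hcount] at hstep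
    have := hr.act hstep
    simp only [eventsOf, ho, Op.write]
    rw [← stateAt_goto hi hc']
    convert this using 2
    simp [State.setReg, State.goto, stateAt, hreg']
  | @store l l' ρ ea ev hinstr =>
    have hb := hst _ _ ho
    have h1 := hr.act (Program.Step.issueStore (P := P) (stateAt cfg k μ β) t l' ea ev _ _
      (by rw [hpc]; exact hinstr) rfl rfl)
    rw [hreg, hcount, stateAt_goto' hi (by rw [hc', hreg'])] at h1
    have h2 := h1.silent (Program.Step.advance (P := P) _ t (ea.eval ρ) (ev.eval ρ) i []
      (by simp [State.setBuf₁, stateAt, hb]))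
    have h3 := h2.act (Program.Step.storeToMemory (P := P) _ t (ea.eval ρ) (ev.eval ρ) i []
      (by simp [State.setBuf₁, State.setBuf₂, stateAt]))
    simp only [eventsOf, ho, Op.write]
    rw [show τ ++ [(⟨t, i, .isu⟩ : Event Dom T), ⟨t, i, .st (ea.eval ρ) (ev.eval ρ)⟩] =
      τ ++ [⟨t, i, .isu⟩] ++ [⟨t, i, .st (ea.eval ρ) (ev.eval ρ)⟩] by simp]
    convert h3 using 1
    have hbb : Function.update (β t) (ea.eval ρ) [] = β t := by
      rw [← hb]; exact Function.update_eq_self _ _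
    simp [State.setBuf₁, State.setBuf₂, State.setMem, stateAt, hbb]
  | @scfence l l' ρ hinstr =>
    have hstep := Program.Step.scfence (P := P) (stateAt cfg k μ β) t l'
      (by rw [hpc]; exact hinstr) ⟨rfl, hsc ho⟩
    rw [hcount, stateAt_goto' hi (by rw [hc', hreg'])] at hstep
    simp only [eventsOf, ho, Op.write]
    exact hr.act hstep
  | @assign l l' ρ r e hinstr =>
    have hstep := Program.Step.assign (P := P) (stateAt cfg k μ β) t l' r e
      (by rw [hpc]; exact hinstr)
    rw [hreg, hcount] at hstep
    have := hr.act hstep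
    simp only [eventsOf, ho, Op.write]
    rw [← stateAt_goto hi hc']
    convert this using 2
    simp [State.setReg, State.goto, stateAt, hreg']
  | @assert l l' ρ e hinstr he =>
    have hstep := Program.Step.assert (P := P) (stateAt cfg k μ β) t l' e
      (by rw [hpc]; exact hinstr) (by rw [hreg]; exact he)
    rw [hcount, stateAt_goto' hi (by rw [hc', hreg'])] at hstep
    simp only [eventsOf, ho, Op.write]
    exact hr.act hstep

open Classical in
/-- Buffers that hold a single store. -/
noncomputable def singleBuffer (n : T × ℕ) (a v : Dom) (t : T) (b : Dom) : List (Dom × ℕ) :=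
  if t = n.1 ∧ b = a then [(v, n.2)] else []

/-- Issue of a store that stays in its buffer. -/
theorem Replays.issue {τ : List (Event Dom T)} {σ : List (T × ℕ)} {μ : Dom → Dom}
    (h : Replays P cfg τ σ μ (fun _ _ => [])) {n : T × ℕ} (hn : n ∉ σ)
    (hpre : ∀ j < n.2, (n.1, j) ∈ σ) {a v : Dom}
    (hs : P.LocalStep n.1 (cfg n.1 n.2) (.st a v) (cfg n.1 (n.2 + 1))) :
    Replays P cfg (τ ++ [⟨n.1, n.2, .isu⟩]) (σ ++ [n]) μ (singleBuffer n a v) := by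
  classical
  obtain ⟨k, hk, hr⟩ := h
  obtain ⟨t, i⟩ := n
  have hi : i = k t := count_eq hk hn hpre
  refine ⟨Function.update k t (i + 1), count_update (n := (t, i)) hk hi, ?_⟩
  simp only at hs
  generalize hc : cfg t i = c at hs
  generalize hc' : cfg t (i + 1) = c' at hs
  have hpc : (stateAt cfg k μ fun _ _ => []).pc t = c.1 := by simp [stateAt, ← hi, hc]
  have hreg : (stateAt cfg k μ fun _ _ => []).reg t = c.2 := by simp [stateAt, ← hi, hc]
  have hreg' : (cfg t (k t)).2 = c.2 := hreg
  have hcount : (stateAt cfg k μ fun _ _ => []).count t = i := hi.symm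
  cases hs with
  | @store l l' ρ ea ev hinstr =>
    have h1 := hr.act (Program.Step.issueStore (P := P) (stateAt cfg k μ _) t l' ea ev _ _
      (by rw [hpc]; exact hinstr) rfl rfl)
    rw [hreg, hcount, stateAt_goto' hi (by rw [hc', hreg'])] at h1
    convert h1 using 1
    simp only [State.setBuf₁, stateAt, State.mk.injEq, true_and, and_true]
    funext t' b
    by_cases ht : t' = t
    · subst ht
      by_cases hb : b = ea.eval ρ <;> simp [singleBuffer, hb]
    · simp [singleBuffer, ht]

/-- The buffered store reaches the memory. -/
theorem Replays.commit {τ : List (Event Dom T)} {σ : List (T × ℕ)} {μ : Dom → Dom}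
    {n : T × ℕ} {a v : Dom} (h : Replays P cfg τ σ μ (singleBuffer n a v)) :
    Replays P cfg (τ ++ [⟨n.1, n.2, .st a v⟩]) σ ((Op.st a v).write μ) (fun _ _ => []) := by
  classical
  obtain ⟨k, hk, hr⟩ := h
  refine ⟨k, hk, ?_⟩
  have h2 := hr.silent (Program.Step.advance (P := P) _ n.1 a v n.2 []
    (by simp [stateAt, singleBuffer]))
  have h3 := h2.act (Program.Step.storeToMemory (P := P) _ n.1 a v n.2 []
    (by simp [State.setBuf₁, State.setBuf₂, stateAt]))
  convert h3 using 1
  simp only [State.setBuf₁, State.setBuf₂, State.setMem, stateAt, State.mk.injEq, Op.write,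
    true_and, and_true]
  constructor
  · funext t b
    by_cases ht : t = n.1
    · subst ht
      by_cases hb : b = a <;> simp [singleBuffer, hb]
    · simp [singleBuffer, ht]
  · simp

/-- The buffers `β` do not change along `ρ`: they are either all empty or hold just the delayed
store. Hence `ρ` may store only where `β` is empty, and a load either reads the replayed memory or
finds the single buffered entry. -/
theorem Replays.steps {τ : List (Event Dom T)} {σ : List (T × ℕ)} {μ : Dom → Dom}
    {β : T → Dom → List (Dom × ℕ)} (h : Replays P cfg τ σ μ β) (ρ : List (T × ℕ))
    (hρ : ∀ ρ₁ n ρ₂, ρ = ρ₁ ++ n :: ρ₂ → n ∉ σ ++ ρ₁ ∧ (∀ j < n.2, (n.1, j) ∈ σ ++ ρ₁) ∧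
      P.LocalStep n.1 (cfg n.1 n.2) (op n) (cfg n.1 (n.2 + 1)) ∧
      (∀ a v, op n = .ld a v →
        (β n.1 a = [] ∧ v = memAfter op μ ρ₁ a) ∨ ∃ j, β n.1 a = [(v, j)]) ∧
      (∀ a v, op n = .st a v → β n.1 a = []) ∧ (op n = .scfence → ∀ a, β n.1 a = [])) :
    Replays P cfg (τ ++ ρ.flatMap (eventsOf op)) (σ ++ ρ) (memAfter op μ ρ) β := by
  induction ρ using List.reverseRecOn with
  | nil => simpa [memAfter] using h
  | append_singleton ρ n ih =>
    have ih' := ih fun ρ₁ m ρ₂ he => hρ ρ₁ m (ρ₂ ++ [n]) (by simp [he])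
    obtain ⟨h1, h2, h3, h4, h5, h6⟩ := hρ ρ n [] rfl
    have := ih'.step h1 h2 h3 h4 h5 h6
    rw [memAfter_append, List.flatMap_append, ← List.append_assoc, ← List.append_assoc]
    simpa [memAfter] using this

theorem Replays.mem_Comp {τ : List (Event Dom T)} {σ : List (T × ℕ)} {μ : Dom → Dom}
    (h : Replays P cfg τ σ μ (fun _ _ => [])) : τ ∈ P.Comp := by
  obtain ⟨k, -, hr⟩ := h
  exact ⟨_, hr, fun t => ⟨rfl, fun a => rfl⟩⟩

end Replay

/-! ### Linear extensions of finite acyclic relations -/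

section Linear

/-- Sort `s` by the number of strict predecessors within `s`; by acyclicity this number strictly
increases along `r`. -/
theorem exists_linear_extension {α : Type u} {r : α → α → Prop}
    (hr : ∀ x, ¬ Relation.TransGen r x x) (s : Finset α) :
    ∃ σ : List α, σ.Nodup ∧ (∀ x, x ∈ σ ↔ x ∈ s) ∧
      ∀ x ∈ s, ∀ y ∈ s, r x y → pos σ x < pos σ y := by
  classical
  let f : α → ℕ := fun x => (s.filter fun z => Relation.TransGen r z x).card
  have hf : ∀ x ∈ s, ∀ y, r x y → f x < f y := fun x hx y hxy => by
    refine Finset.card_lt_card (Finset.ssubset_iff_subset_ne.2 ⟨fun z hz => ?_, fun he => ?_⟩)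
    · simp only [Finset.mem_filter] at hz ⊢
      exact ⟨hz.1, hz.2.tail hxy⟩
    · have : x ∈ s.filter fun z => Relation.TransGen r z y := by
        simp [hx, Relation.TransGen.single hxy]
      rw [← he] at this
      exact hr x (Finset.mem_filter.1 this).2
  let σ := s.toList.insertionSort fun x y => f x ≤ f y
  have hperm : σ.Perm s.toList := List.perm_insertionSort _ _
  have hmem : ∀ x, x ∈ σ ↔ x ∈ s := fun x => by rw [hperm.mem_iff, Finset.mem_toList]
  have hsort : σ.Pairwise fun x y => f x ≤ f y := by
    have : Std.Total (fun x y : α => f x ≤ f y) := ⟨fun x y => le_total _ _⟩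
    have : IsTrans α (fun x y : α => f x ≤ f y) := ⟨fun x y z => le_trans⟩
    exact List.pairwise_insertionSort _ _
  refine ⟨σ, hperm.nodup_iff.2 s.nodup_toList, hmem, fun x hx y hy hxy => ?_⟩
  have hlt := hf x hx y hxy
  by_contra hc
  rcases Nat.lt_or_eq_of_le (not_lt.1 hc) with hc | hc
  · have hx' := (hmem x).2 hx
    have hy' := (hmem y).2 hy
    have := List.pairwise_iff_getElem.1 hsort _ _ (pos_lt_length.2 hy') (pos_lt_length.2 hx') hc
    rw [(List.getElem?_eq_some_iff.1 (getElem?_pos hy')).2,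
      (List.getElem?_eq_some_iff.1 (getElem?_pos hx')).2] at this
    omega
  · rw [pos_inj ((hmem y).2 hy) ((hmem x).2 hx) hc] at hlt
    exact lt_irrefl _ hlt

theorem exists_split_of_pos_lt {α : Type u} {σ : List α} {x y : α} (hy : y ∈ σ)
    (h : pos σ x < pos σ y) : ∃ σ₁ σ₂, σ = σ₁ ++ x :: σ₂ ∧ y ∈ σ₂ := by
  have hx : x ∈ σ := pos_lt_length.1 (lt_of_lt_of_le h pos_le_length)
  obtain ⟨σ₁, σ₂, rfl, hx1⟩ := List.eq_append_cons_of_mem hx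
  refine ⟨σ₁, σ₂, rfl, ?_⟩
  have hxp : pos (σ₁ ++ x :: σ₂) x = σ₁.length := by
    rw [pos_append_of_notMem hx1]; simp [pos]
  by_contra hy2
  rcases List.mem_append.1 hy with hy1 | hy1
  · rw [pos_append_of_mem hy1, hxp] at h
    have := pos_lt_length.2 hy1
    omega
  · rcases List.mem_cons.1 hy1 with rfl | hy1
    · exact lt_irrefl _ h
    · exact hy2 hy1

theorem pos_lt_of_split {α : Type u} {σ₁ σ₂ : List α} {n : α} (hn : (σ₁ ++ n :: σ₂).Nodup) {m : α} :
    (m ∈ σ₁ → pos (σ₁ ++ n :: σ₂) m < pos (σ₁ ++ n :: σ₂) n) ∧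
    (m ∈ σ₂ → pos (σ₁ ++ n :: σ₂) n < pos (σ₁ ++ n :: σ₂) m) := by
  constructor
  · intro hm
    exact ((pair_sublist_iff hn).1 ((List.singleton_sublist.2 hm).append
      (List.singleton_sublist.2 (List.mem_cons_self)))).2
  · intro hm
    refine ((pair_sublist_iff hn).1 ?_).2
    exact (List.Sublist.cons_cons n (List.singleton_sublist.2 hm)).trans
      (List.sublist_append_right _ _)

/-- Events of earlier chunks precede those of later chunks. -/
theorem pair_sublist_flatMap {α : Type u} {β : Type v} {σ : List α} {E : α → List β} {x y : α}
    {e f : β} (hy : y ∈ σ) (h : pos σ x < pos σ y) (he : e ∈ E x) (hf : f ∈ E y) :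
    [e, f].Sublist (σ.flatMap E) := by
  obtain ⟨σ₁, σ₂, rfl, hy'⟩ := exists_split_of_pos_lt hy h
  rw [List.flatMap_append, List.flatMap_cons]
  refine List.Sublist.trans ?_ (List.sublist_append_right _ _)
  exact (List.singleton_sublist.2 he).append
    (List.singleton_sublist.2 (List.mem_flatMap.2 ⟨y, hy', hf⟩))

end Linear

/-! ### Executions along a linear extension and what they preserve -/

section Linearizations

variable {Dom : Type u} {T : Type v}

/-- `σ` lists a subset of the instances, closed under predecessors in program and source order,
compatibly with happens-before. -/
structure Graph.Linearization (g : Graph Dom T) (σ : List (T × ℕ)) : Prop where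
  nodup : σ.Nodup
  valid : ∀ n ∈ σ, g.Valid n
  po_closed : ∀ n ∈ σ, ∀ m, g.PO m n → m ∈ σ
  src_closed : ∀ n ∈ σ, ∀ m, g.SRC m n → m ∈ σ
  ordered : ∀ m ∈ σ, ∀ n ∈ σ, g.HB m n → pos σ m < pos σ n

namespace Graph.Linearization

variable {g : Graph Dom T} {σ : List (T × ℕ)} (hl : g.Linearization σ)
include hl

theorem split {σ₁ σ₂ : List (T × ℕ)} {n : T × ℕ} (hσ : σ = σ₁ ++ n :: σ₂) :
    n ∈ σ ∧ n ∉ σ₁ ∧ ∀ j < n.2, (n.1, j) ∈ σ₁ := by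
  subst hσ
  have hn : n ∈ σ₁ ++ n :: σ₂ := by simp
  refine ⟨hn, fun h => lt_irrefl _ ((pos_lt_of_split hl.nodup).1 h), fun j hj => ?_⟩
  have hpo : g.PO (n.1, j) n := ⟨rfl, hj, hl.valid n hn⟩
  have hm := hl.po_closed n hn _ hpo
  have hlt := hl.ordered _ hm n hn (Or.inl hpo)
  rcases List.mem_append.1 hm with h | h
  · exact h
  · rcases List.mem_cons.1 h with h | h
    · rw [h] at hlt; exact absurd hlt (lt_irrefl _)
    · exact absurd ((pos_lt_of_split hl.nodup).2 h) (not_lt.2 hlt.le)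

variable {R : T → Type w} {L : Type x} [Zero Dom] {P : Program Dom T R L}
  {τ : List (Event Dom T)} (h : Realizes P τ g)
include h

/-- Loads read the last store before them in a linearization. -/
theorem memAfter_eq {σ₁ σ₂ : List (T × ℕ)} {n : T × ℕ} (hσ : σ = σ₁ ++ n :: σ₂) {a v : Dom}
    (hn : g.op n = .ld a v) : memAfter g.op (fun _ => 0) σ₁ a = v := by
  have hnm := (hl.split hσ).1
  have hnv := hl.valid n hnm
  have hnl : g.Loads n a := ⟨hnv, v, hn⟩
  subst hσ
  rcases h.consistent.read n a v hnv hn with ⟨m, hmo, hs⟩ | ⟨rfl, hp, hc⟩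
  · have hmm := hl.src_closed n hnm m ⟨a, hnl, hs⟩
    have hlt := hl.ordered m hmm n hnm (Or.inr (Or.inr (Or.inl ⟨a, hnl, hs⟩)))
    have hm1 : m ∈ σ₁ := by
      rcases List.mem_append.1 hmm with h | h
      · exact h
      · rcases List.mem_cons.1 h with h | h
        · rw [h] at hlt; exact absurd hlt (lt_irrefl _)
        · exact absurd ((pos_lt_of_split hl.nodup).2 h) (not_lt.2 hlt.le)
    obtain ⟨ρ₁, ρ₂, rfl⟩ := List.append_of_mem hm1
    refine memAfter_last hmo (fun k hk v' hkv => ?_) _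
    have hk1 : k ∈ ρ₁ ++ m :: ρ₂ := by simp [hk]
    have hkm : k ∈ (ρ₁ ++ m :: ρ₂) ++ n :: σ₂ := List.mem_append_left _ hk1
    have hks : g.Stores k a := ⟨hl.valid k hkm, v', hkv⟩
    have hkn := (pos_lt_of_split hl.nodup).1 hk1
    have hmk : pos ((ρ₁ ++ m :: ρ₂) ++ n :: σ₂) m < pos ((ρ₁ ++ m :: ρ₂) ++ n :: σ₂) k := by
      have hnd := hl.nodup
      have he : (ρ₁ ++ m :: ρ₂) ++ n :: σ₂ = ρ₁ ++ m :: (ρ₂ ++ n :: σ₂) := by simp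
      rw [he] at hnd ⊢
      exact (pos_lt_of_split hnd).2 (List.mem_append_left _ hk)
    -- A store `k` placed between the source `m` and the load `n` is impossible: committed before
    -- `m`, it precedes `m` by store order; committed after `m`, it follows `n` by conflict.
    rcases lt_trichotomy (g.com k) (g.com m) with hc | hc | hc
    · exact absurd (hl.ordered k hkm m hmm (Or.inr (Or.inl ⟨a, hks, hs.stores, hc⟩)))
        (not_lt.2 hmk.le)
    · rw [h.com_inj hks.1 hs.stores.1 hc] at hmk
      exact lt_irrefl _ hmk
    · refine absurd (hl.ordered n hnm k hkm (Or.inr (Or.inr (Or.inr ⟨a, hnl, hks, ?_⟩))))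
        (not_lt.2 hkn.le)
      intro k' hk'
      rwa [h.source_unique hk' hs]
  -- A load without source conflicts with every store to its address, so all of those come after it.
  · refine memAfter_of_forall_ne (fun k hk v' hkv => ?_) _
    have hkm : k ∈ σ₁ ++ n :: σ₂ := List.mem_append_left _ hk
    have hkn := (pos_lt_of_split hl.nodup).1 hk
    refine absurd (hl.ordered n hnm k hkm (Or.inr (Or.inr (Or.inr ⟨a, hnl,
      ⟨hl.valid k hkm, v', hkv⟩, ?_⟩)))) (not_lt.2 hkn.le)
    rintro k' (⟨hk', -⟩ | ⟨-, hk', hkc, -⟩)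
    · exact absurd hk' (hp k')
    · exact absurd hkc (hc k' hk')

end Graph.Linearization

/-- `g'` executes the instances in `σ` in this order and with immediate effect, except that the
stores in `W` take effect after everything else; further instances come after `σ`. -/
structure Graph.Performs (g' g : Graph Dom T) (σ : List (T × ℕ)) (W : Set (T × ℕ)) : Prop where
  same : ∀ n ∈ σ, g'.Valid n ∧ g'.op n = g.op n
  late : ∀ n, g'.Valid n → n ∈ σ ∨ ∀ m ∈ σ, g'.iss m < g'.iss n
  iss_lt_iss : ∀ m ∈ σ, ∀ n ∈ σ, pos σ m < pos σ n → g'.iss m < g'.iss n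
  com_lt_iss : ∀ m ∈ σ, ∀ n ∈ σ, pos σ m < pos σ n → m ∉ W → g'.com m < g'.iss n
  last : ∀ m ∈ W, ∀ n, g'.Valid n → g'.iss n < g'.com m ∧ (n ≠ m → g'.com n < g'.com m)
  -- The last two fields concern the original `g`. They make the delay harmless: the delayed store
  -- was still buffered there while `σ` was executed, and it commits last among the stores of `σ` to
  -- its address.
  pending : ∀ m ∈ W, ∀ n ∈ σ, g.iss n < g.com m
  max : ∀ m ∈ W, ∀ n ∈ σ, ∀ a, g.Stores m a → g.Stores n a → g.com n ≤ g.com m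

namespace Graph.Performs

variable {R : T → Type w} {L : Type x} [Zero Dom] {P P' : Program Dom T R L}
  {τ τ' : List (Event Dom T)} {g g' : Graph Dom T} {σ : List (T × ℕ)} {W : Set (T × ℕ)}

omit [Zero Dom] in
theorem stores_iff (hp : g'.Performs g σ W) (hl : g.Linearization σ) {n : T × ℕ} (hn : n ∈ σ)
    {a : Dom} : g'.Stores n a ↔ g.Stores n a := by
  simp [Stores, (hp.same n hn).1, (hp.same n hn).2, hl.valid n hn]

omit [Zero Dom] in
theorem loads_iff (hp : g'.Performs g σ W) (hl : g.Linearization σ) {n : T × ℕ} (hn : n ∈ σ)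
    {a : Dom} : g'.Loads n a ↔ g.Loads n a := by
  simp [Loads, (hp.same n hn).1, (hp.same n hn).2, hl.valid n hn]

theorem pos_lt_of_com_lt (hp : g'.Performs g σ W) (h' : Realizes P' τ' g') {n k : T × ℕ}
    (hn : n ∈ σ) {a : Dom} (hk : g'.Stores k a) (hc : g'.com k < g'.iss n) (hne : k ≠ n) :
    k ∈ σ ∧ k ∉ W ∧ pos σ k < pos σ n := by
  have h1 := h'.consistent.iss_lt_com k a hk
  have hkσ : k ∈ σ := by
    rcases hp.late k hk.1 with hk' | hk'
    · exact hk'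
    · have := hk' n hn; omega
  refine ⟨hkσ, fun hw => ?_, ?_⟩
  · have := hp.last k hw n (hp.same n hn).1; omega
  · by_contra hlt
    rcases Nat.lt_or_eq_of_le (not_lt.1 hlt) with hlt | heq
    · have := hp.iss_lt_iss n hn k hkσ hlt; omega
    · exact hne (pos_inj hn hkσ heq).symm

/-- A store followed in store order by another one of `σ` is not delayed, by `max`. It thus commits
before the next one is even issued. -/
theorem st (hp : g'.Performs g σ W) (hl : g.Linearization σ) (h' : Realizes P' τ' g')
    {m n : T × ℕ} (hm : m ∈ σ) (hn : n ∈ σ) (hs : g.ST m n) : g'.ST m n := by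
  obtain ⟨a, hma, hna, hc⟩ := hs
  refine ⟨a, (hp.stores_iff hl hm).2 hma, (hp.stores_iff hl hn).2 hna, ?_⟩
  have hmw : m ∉ W := fun hw => by
    have := hp.max m hw n hn a hma hna; omega
  have hlt := hl.ordered m hm n hn (Or.inr (Or.inl ⟨a, hma, hna, hc⟩))
  have := hp.com_lt_iss m hm n hn hlt hmw
  have := h'.consistent.iss_lt_com n a ((hp.stores_iff hl hn).2 hna)
  omega

/-- A delayed source must have been read early in `g`, and it is again the newest pending store in
`g'`. Any other source is in memory by the time of the load in `g'`, even if it was read from a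
buffer in `g`; a delayed store pending at the load would, by FIFO and `max`, be at least as new as
the source. Stores in between are excluded by the order of `σ`. -/
theorem source (hp : g'.Performs g σ W) (hl : g.Linearization σ) (h : Realizes P τ g)
    (h' : Realizes P' τ' g') {n m : T × ℕ} (hn : n ∈ σ) {a : Dom} (hna : g.Loads n a)
    (hs : g.Source a m n) : g'.Source a m n := by
  have hm := hl.src_closed n hn m ⟨a, hna, hs⟩
  have hma := hs.stores
  have hma' := (hp.stores_iff hl hm).2 hma
  have hpend : ∀ k, g'.Pending a k n → k ∈ σ ∧ g.Stores k a ∧ pos σ k < pos σ n := by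
    rintro k ⟨hk, ht, hlt, -⟩
    have hpo : g.PO k n := ⟨ht, hlt, hna.1⟩
    have hkσ := hl.po_closed n hn k hpo
    exact ⟨hkσ, (hp.stores_iff hl hkσ).1 hk, hl.ordered k hkσ n hn (Or.inl hpo)⟩
  have hfifo : ∀ k k' : T × ℕ, k.1 = k'.1 → g.Stores k a → g.Stores k' a → k.2 < k'.2 →
      g.com k < g.com k' := by
    rintro ⟨t, i⟩ ⟨t', j⟩ ht hi hj hij
    simp only at ht
    subst ht
    exact h.consistent.fifo t i j a hij hi hj (h.com_lt_length hj.1)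
  by_cases hmw : m ∈ W
  · have hpm := hp.pending m hmw n hn
    rcases hs with ⟨⟨-, ht, hlt, -⟩, -⟩ | ⟨-, -, hc, -⟩
    · refine Or.inl ⟨⟨hma', ht, hlt, ?_⟩, fun k hk => ?_⟩
      · have := hp.last m hmw n (hp.same n hn).1; omega
      · obtain ⟨hkσ, hka, -⟩ := hpend k hk
        by_contra hc
        have := hfifo m k (ht.trans hk.2.1.symm) hma hka (by omega)
        have := hp.max m hmw k hkσ a hma hka
        omega
    · omega
  · have hlt := hl.ordered m hm n hn (Or.inr (Or.inr (Or.inl ⟨a, hna, hs⟩)))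
    refine Or.inr ⟨fun k hk => ?_, hma', hp.com_lt_iss m hm n hn hlt hmw, fun k hk hkc => ?_⟩
    · obtain ⟨hkσ, hka, hkn⟩ := hpend k hk
      by_cases hkw : k ∈ W
      · have hkp := hp.pending k hkw n hn
        have hkpend : g.Pending a k n := ⟨hka, hk.2.1, hk.2.2.1, by omega⟩
        rcases hs with ⟨hpm, hle⟩ | ⟨hno, -⟩
        · have h1 := hle k hkpend
          have ht : k.1 = m.1 := hk.2.1.trans hpm.2.1.symm
          have hne : k.2 ≠ m.2 := fun he => hmw ((Prod.ext ht he : k = m) ▸ hkw)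
          have := hfifo k m ht hka hma (by omega)
          have := hp.max k hkw m hm a hka hma
          omega
        · exact hno k hkpend
      · exact hk.2.2.2 (hp.com_lt_iss k hkσ n hn hkn hkw)
    · have hkne : k ≠ n := by
        rintro rfl; exact hk.not_loads ((hp.loads_iff hl hn).2 hna)
      obtain ⟨hkσ, -, hkn⟩ := hp.pos_lt_of_com_lt h' hn hk hkc hkne
      have hka := (hp.stores_iff hl hkσ).1 hk
      by_contra hgt
      rcases lt_trichotomy (g.com k) (g.com m) with hc | hc | hc
      · obtain ⟨-, -, -, hc'⟩ := hp.st hl h' hkσ hm ⟨a, hka, hma, hc⟩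
        omega
      · rw [h.com_inj hka.1 hma.1 hc] at hgt
        omega
      · have := hl.ordered n hn k hkσ (Or.inr (Or.inr (Or.inr ⟨a, hna, hka, fun k' hk' => by
          rwa [h.source_unique hk' hs]⟩)))
        omega

/-- Uniqueness of sources reverses `source` when `n` has a source in `g`. If it has none, it
conflicts in `g` with all stores of `σ` to its address, so these come after it and it cannot acquire
one. -/
theorem source_iff (hp : g'.Performs g σ W) (hl : g.Linearization σ) (h : Realizes P τ g)
    (h' : Realizes P' τ' g') {n m : T × ℕ} (hn : n ∈ σ) {a : Dom} (hna : g.Loads n a) :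
    g'.Source a m n ↔ g.Source a m n := by
  refine ⟨fun hs => ?_, hp.source hl h h' hn hna⟩
  obtain ⟨v, hv⟩ := hna.2
  rcases h.consistent.read n a v hna.1 hv with ⟨m₀, -, hs₀⟩ | ⟨-, hno, hc⟩
  · rwa [h'.source_unique hs (hp.source hl h h' hn hna hs₀)]
  · exfalso
    have hcf : ∀ k ∈ σ, g.Stores k a → pos σ n < pos σ k := fun k hk hka =>
      hl.ordered n hn k hk (Or.inr (Or.inr (Or.inr ⟨a, hna, hka, by
        rintro k' (⟨hk', -⟩ | ⟨-, hk', hkc, -⟩)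
        · exact absurd hk' (hno k')
        · exact absurd hkc (hc k' hk')⟩)))
    rcases hs with ⟨⟨hm, ht, hlt, -⟩, -⟩ | ⟨-, hm, hmc, -⟩
    · have hpo : g.PO m n := ⟨ht, hlt, hna.1⟩
      have hmσ := hl.po_closed n hn m hpo
      have h1 := hl.ordered m hmσ n hn (Or.inl hpo)
      have h2 := hcf m hmσ ((hp.stores_iff hl hmσ).1 hm)
      omega
    · have hne : m ≠ n := by
        rintro rfl; exact hm.not_loads ((hp.loads_iff hl hn).2 hna)
      obtain ⟨hmσ, -, h1⟩ := hp.pos_lt_of_com_lt h' hn hm hmc hne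
      have h2 := hcf m hmσ ((hp.stores_iff hl hmσ).1 hm)
      omega

theorem hb (hp : g'.Performs g σ W) (hl : g.Linearization σ) (h : Realizes P τ g)
    (h' : Realizes P' τ' g') {m n : T × ℕ} (hm : m ∈ σ) (hn : n ∈ σ) (hb : g.HB m n) :
    g'.HB m n := by
  rcases hb with ⟨ht, hlt, -⟩ | hb | ⟨a, hna, hs⟩ | ⟨a, hma, hna, hk⟩
  · exact Or.inl ⟨ht, hlt, (hp.same n hn).1⟩
  · exact Or.inr (Or.inl (hp.st hl h' hm hn hb))
  · exact Or.inr (Or.inr (Or.inl ⟨a, (hp.loads_iff hl hn).2 hna, hp.source hl h h' hn hna hs⟩))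
  · refine Or.inr (Or.inr (Or.inr ⟨a, (hp.loads_iff hl hm).2 hma, (hp.stores_iff hl hn).2 hna,
      fun k hks => ?_⟩))
    have hks' := (hp.source_iff hl h h' hm hma).1 hks
    have hkσ := hl.src_closed m hm k ⟨a, hma, hks'⟩
    obtain ⟨-, -, -, hc⟩ := hp.st hl h' hkσ hn ⟨a, hks'.stores, hna, hk k hks'⟩
    exact hc

end Graph.Performs

end Linearizations

/-! ### Acyclic traces are sequentially consistent -/

section Sequential

variable {Dom : Type u} {T : Type v}

theorem mem_eventsOf {op : T × ℕ → Op Dom} {n : T × ℕ} (hn : ∀ as, op n ≠ .fence as)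
    {e : Event Dom T} :
    e ∈ eventsOf op n ↔ e.node = n ∧ (e.op = (op n).exec ∨ e.op = op n) := by
  obtain ⟨t, i, o⟩ := e
  obtain ⟨t', j⟩ := n
  cases hop : op (t', j) with
  | fence as => exact absurd hop (hn as)
  | st a v =>
    simp only [eventsOf, hop, Event.node, Op.exec, List.mem_cons, Event.mk.injEq,
      List.not_mem_nil, or_false, Prod.mk.injEq]
    tauto
  | _ =>
    simp only [eventsOf, hop, Event.node, Op.exec, List.mem_cons, Event.mk.injEq,
      List.not_mem_nil, or_false, Prod.mk.injEq]
    tauto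

theorem Op.eq_of_exec_eq {o o' : Op Dom} (h : o = o'.exec) (ho : o ≠ .isu) : o' = o := by
  subst h
  cases o' <;> simp_all [Op.exec]

variable {R : T → Type w} {L : Type x} [Zero Dom] {P P' : Program Dom T R L}
  {τ τ' : List (Event Dom T)} {g g' : Graph Dom T}

namespace Realizes

theorem op_eq (h : Realizes P τ g) {n : T × ℕ} {o : Op Dom}
    (hm : (⟨n.1, n.2, o⟩ : Event Dom T) ∈ τ) (ho : o ≠ .isu) : g.Valid n ∧ g.op n = o := by
  obtain ⟨hv, hop | hop⟩ := (h.mem_iff _).1 hm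
  · exact ⟨hv, Op.eq_of_exec_eq hop ho⟩
  · exact ⟨hv, hop.symm⟩

theorem nodes_eq (h : Realizes P τ g) :
    (traceOf τ).nodes = {p | g.Valid p.1 ∧ p.2 = g.op p.1} := by
  ext ⟨n, o⟩
  constructor
  · rintro ⟨e, he, hi, hp⟩
    obtain ⟨rfl, rfl⟩ := Prod.mk.inj hp
    obtain ⟨hv, ho⟩ := h.op_eq (n := e.node) (o := e.op) he hi
    exact ⟨hv, ho.symm⟩
  · rintro ⟨hv, ho⟩
    exact ⟨_, h.op_mem hv, (h.op_ne hv).1, Prod.ext rfl ho⟩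

/-- The conflict relation of a trace is thus determined by its source relation, its store order and
the operations, and needs no separate treatment when traces are compared. -/
theorem cf_iff (h : Realizes P τ g) {n m : T × ℕ} : CF τ n m ↔
    (∃ k, SRC τ k n ∧ ST τ k m) ∨
    ((∃ a, g.Loads n a ∧ g.Stores m a) ∧ (∀ k, ¬ SRC τ k n) ∧ ∀ k, ¬ ST τ k m) := by
  refine or_congr Iff.rfl ⟨?_, ?_⟩
  · rintro ⟨a, l, y, hl, hla, rfl, hy, hya, rfl, hs⟩
    exact ⟨⟨a, (h.eq_load hl hla).1, (h.eq_op hy hya).1⟩, hs⟩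
  · rintro ⟨⟨a, hn, hm⟩, hs⟩
    exact ⟨a, ⟨n.1, n.2, g.op n⟩, ⟨m.1, m.2, g.op m⟩, h.op_mem hn.1, hn.2, rfl, h.op_mem hm.1,
      hm.2, rfl, hs⟩

theorem traceOf_eq (h : Realizes P τ g) (h' : Realizes P' τ' g')
    (hv : ∀ n, g'.Valid n ↔ g.Valid n) (hop : ∀ n, g.Valid n → g'.op n = g.op n)
    (hst : ∀ n m, g'.ST n m ↔ g.ST n m) (hsrc : ∀ n m, g'.SRC n m ↔ g.SRC n m) :
    traceOf τ' = traceOf τ := by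
  have hST : ∀ n m, ST τ' n m ↔ ST τ n m := fun n m => by rw [h.st_iff, h'.st_iff, hst]
  have hSRC : ∀ n m, SRC τ' n m ↔ SRC τ n m := fun n m => by rw [h.src_iff, h'.src_iff, hsrc]
  have hs : ∀ n a, g'.Stores n a ↔ g.Stores n a := fun n a => by
    unfold Graph.Stores
    rw [hv]
    exact and_congr_right fun hn => by rw [hop n hn]
  have hl : ∀ n a, g'.Loads n a ↔ g.Loads n a := fun n a => by
    unfold Graph.Loads
    rw [hv]
    exact and_congr_right fun hn => by rw [hop n hn]
  ext n m
  · rw [h.nodes_eq, h'.nodes_eq]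
    simp only [Set.mem_ofPred_eq, hv]
    exact and_congr_right fun hn => by rw [hop n.1 hn]
  · change PO τ' n m ↔ PO τ n m
    rw [h.po_iff, h'.po_iff]
    unfold Graph.PO
    rw [hv]
  · exact hST n m
  · exact hSRC n m
  · change CF τ' n m ↔ CF τ n m
    rw [h.cf_iff, h'.cf_iff]
    simp only [hST, hSRC, hs, hl]

theorem finite_valid (h : Realizes P τ g) : {n | g.Valid n}.Finite := by
  refine (List.finite_toSet (τ.map Event.node)).subset fun n hn => ?_
  exact List.mem_map.2 ⟨_, h.op_mem hn, rfl⟩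

/-- List all instances along a linear extension of happens-before and let each take effect at once.
Loads return their old values, so the threads make the same steps, and `Graph.Performs` with no
delayed store transfers store order and sources. -/
theorem exists_mem_SCComp (hP : P.NoFence) (h : Realizes P τ g)
    (hac : ∀ n, ¬ Relation.TransGen g.HB n n) : ∃ τ' ∈ P.SCComp, traceOf τ' = traceOf τ := by
  obtain ⟨σ, hnd, hmem, hord⟩ := exists_linear_extension hac h.finite_valid.toFinset
  simp only [Set.Finite.mem_toFinset, Set.mem_ofPred_eq] at hmem hord
  have hl : g.Linearization σ := by
    refine ⟨hnd, fun n => (hmem n).1, fun n hn m hm => ?_, fun n hn m hm => ?_,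
      fun m hm n hn => hord m ((hmem m).1 hm) n ((hmem n).1 hn)⟩
    · obtain ⟨t, i⟩ := n
      obtain ⟨t', j⟩ := m
      obtain ⟨ht, hlt, hv⟩ := hm
      simp only at ht
      subst ht
      exact (hmem _).2 (lt_trans hlt hv)
    · obtain ⟨a, -, hs⟩ := hm
      exact (hmem m).2 hs.stores.1
  choose cfg hcfg using h.run
  have hrep := (Replays.nil (P := P) (cfg := cfg) fun t => (hcfg t).1).steps (op := g.op) σ (by
    intro σ₁ n σ₂ hσ
    obtain ⟨h1, h2, h3⟩ := hl.split hσ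
    refine ⟨by simpa using h2, by simpa using h3, (hcfg n.1).2 n.2 (hl.valid n h1), ?_, ?_, ?_⟩
    · exact fun a v ha => Or.inl ⟨rfl, (hl.memAfter_eq h hσ ha).symm⟩
    · exact fun _ _ _ => rfl
    · exact fun _ _ => rfl)
  simp only [List.nil_append] at hrep
  set τ' := σ.flatMap (eventsOf g.op) with hτ'
  have hcomp := hrep.mem_Comp
  have hsc : τ' ∈ P.SCComp := ⟨hcomp, fun p i hp hi => issue_followed_by_store g.op
    (fun n hn => (h.op_ne (hl.valid n hn)).1) p i hp hi⟩
  refine ⟨τ', hsc, ?_⟩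
  obtain ⟨g', h'⟩ := P.exists_realizes hP hcomp
  have hE : ∀ n ∈ σ, ∀ e : Event Dom T, e ∈ eventsOf g.op n ↔
      e.node = n ∧ (e.op = (g.op n).exec ∨ e.op = g.op n) := fun n hn e =>
    mem_eventsOf (h.op_ne (hl.valid n hn)).2
  have hsame : ∀ n ∈ σ, g'.Valid n ∧ g'.op n = g.op n := fun n hn =>
    h'.op_eq (List.mem_flatMap.2 ⟨n, hn, (hE n hn _).2 ⟨rfl, Or.inr rfl⟩⟩)
      (h.op_ne (hl.valid n hn)).1
  have hvalid : ∀ n, g'.Valid n → n ∈ σ := fun n hn => by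
    obtain ⟨m, hm, he⟩ := List.mem_flatMap.1 (h'.op_mem hn)
    obtain rfl := ((hE m hm _).1 he).1
    exact hm
  have hbefore : ∀ m ∈ σ, ∀ n ∈ σ, pos σ m < pos σ n →
      ∀ o, o = (g.op m).exec ∨ o = g.op m →
        pos τ' ⟨m.1, m.2, o⟩ < pos τ' ⟨n.1, n.2, (g.op n).exec⟩ := fun m hm n hn hlt o ho =>
    ((pair_sublist_iff h'.nodup).1 (pair_sublist_flatMap hn hlt ((hE m hm _).2 ⟨rfl, ho⟩)
      ((hE n hn _).2 ⟨rfl, Or.inl rfl⟩))).2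
  have hp : g'.Performs g σ ∅ := by
    refine ⟨hsame, fun n hn => Or.inl (hvalid n hn), fun m hm n hn hlt => ?_,
      fun m hm n hn hlt _ => ?_, by simp, by simp, by simp⟩
    · rw [h'.iss_eq, h'.iss_eq, (hsame m hm).2, (hsame n hn).2]
      exact hbefore m hm n hn hlt _ (Or.inl rfl)
    · rw [h'.com_eq, h'.iss_eq, (hsame m hm).2, (hsame n hn).2]
      exact hbefore m hm n hn hlt _ (Or.inr rfl)
  have hval : ∀ n, g'.Valid n ↔ g.Valid n := fun n =>
    ⟨fun hn => (hmem n).1 (hvalid n hn), fun hn => (hsame n ((hmem n).2 hn)).1⟩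
  refine h.traceOf_eq h' hval (fun n hn => (hsame n ((hmem n).2 hn)).2) (fun n m => ?_)
    fun m n => ?_
  · refine ⟨fun hs => ?_, fun hs => ?_⟩
    · obtain ⟨a, hn, hm, hc⟩ := hs
      have hnσ := hvalid n hn.1
      have hmσ := hvalid m hm.1
      have hn' := (hp.stores_iff hl hnσ).1 hn
      have hm' := (hp.stores_iff hl hmσ).1 hm
      refine ⟨a, hn', hm', ?_⟩
      rcases lt_trichotomy (g.com n) (g.com m) with hlt | heq | hlt
      · exact hlt
      · rw [h.com_inj hn'.1 hm'.1 heq] at hc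
        exact absurd hc (lt_irrefl _)
      · obtain ⟨-, -, -, hc'⟩ := hp.st hl h' hmσ hnσ ⟨a, hm', hn', hlt⟩
        omega
    · obtain ⟨a, hn, hm, hc⟩ := hs
      exact hp.st hl h' ((hmem n).2 hn.1) ((hmem m).2 hm.1) ⟨a, hn, hm, hc⟩
  · refine ⟨fun ⟨a, hn, hs⟩ => ?_, fun ⟨a, hn, hs⟩ => ?_⟩
    · have hnσ := hvalid n hn.1
      have hn' := (hp.loads_iff hl hnσ).1 hn
      exact ⟨a, hn', (hp.source_iff hl h h' hnσ hn').1 hs⟩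
    · have hnσ := (hmem n).2 hn.1
      exact ⟨a, (hp.loads_iff hl hnσ).2 hn, hp.source hl h h' hnσ hn hs⟩

end Realizes

end Sequential

/-! ### Sequences in which a single store is delayed -/

section Delayed

variable {Dom : Type u} {T : Type v}

open Classical in
/-- The instances in `κ` take effect immediately and in this order, except that the store `w`
is delayed to the end. -/
noncomputable def delayedSeq (op : T × ℕ → Op Dom) (κ : List (T × ℕ)) (w : T × ℕ) :
    List (Event Dom T) :=
  κ.flatMap (fun n => if n = w then [⟨w.1, w.2, .isu⟩] else eventsOf op n) ++ [⟨w.1, w.2, op w⟩]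

variable {R : T → Type w} {L : Type x} [Zero Dom] {P : Program Dom T R L}
  {g' : Graph Dom T} {op : T × ℕ → Op Dom} {κ : List (T × ℕ)} {w : T × ℕ} {a u : Dom}

/-- `g'` is the execution graph of `delayedSeq op κ w`, where `w` is a store in `κ`. -/
structure IsDelayedSeq (P : Program Dom T R L) (g' : Graph Dom T) (op : T × ℕ → Op Dom)
    (κ : List (T × ℕ)) (w : T × ℕ) : Prop where
  realizes : Realizes P (delayedSeq op κ w) g'
  mem : w ∈ κ
  store : ∃ a v, op w = .st a v
  op_ne : ∀ n ∈ κ, op n ≠ .isu ∧ ∀ as, op n ≠ .fence as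

namespace IsDelayedSeq

variable (h : IsDelayedSeq P g' op κ w)
include h

open Classical in
theorem mem_chunk {n : T × ℕ} (hn : n ∈ κ) {e : Event Dom T} :
    e ∈ (if n = w then [⟨w.1, w.2, .isu⟩] else eventsOf op n) ↔
      e.node = n ∧ (e.op = (op n).exec ∨ (n ≠ w ∧ e.op = op n)) := by
  by_cases hw : n = w
  · subst hw
    obtain ⟨a, v, hs⟩ := h.store
    obtain ⟨t, i, o⟩ := e
    simp only [if_true, hs, List.mem_singleton, Event.mk.injEq, Event.node, Op.exec, ne_eq,
      not_true_eq_false, false_and, or_false, Prod.ext_iff]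
    tauto
  · simp only [hw, if_false, ne_eq, not_false_eq_true, true_and]
    exact mem_eventsOf (h.op_ne n hn).2

theorem op_mem {n : T × ℕ} (hn : n ∈ κ) : ⟨n.1, n.2, op n⟩ ∈ delayedSeq op κ w := by
  by_cases hw : n = w
  · subst hw
    simp [delayedSeq]
  · exact List.mem_append_left _ (List.mem_flatMap.2 ⟨n, hn, (h.mem_chunk hn).2
      ⟨rfl, Or.inr ⟨hw, rfl⟩⟩⟩)

theorem same {n : T × ℕ} (hn : n ∈ κ) : g'.Valid n ∧ g'.op n = op n :=
  h.realizes.op_eq (h.op_mem hn) (h.op_ne n hn).1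

theorem mem_of_valid {n : T × ℕ} (hn : g'.Valid n) : n ∈ κ := by
  rcases List.mem_append.1 (h.realizes.exec_mem hn) with hm | hm
  · obtain ⟨m, hm, he⟩ := List.mem_flatMap.1 hm
    obtain rfl := ((h.mem_chunk hm).1 he).1
    exact hm
  · simp only [List.mem_singleton, Event.mk.injEq] at hm
    rw [show n = w from Prod.ext hm.1 hm.2.1]
    exact h.mem

theorem pos_lt_pos {m n : T × ℕ} (hm : m ∈ κ) (hn : n ∈ κ) (hlt : pos κ m < pos κ n) {o : Op Dom}
    (ho : o = (op m).exec ∨ m ≠ w ∧ o = op m) :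
    [⟨m.1, m.2, o⟩, ⟨n.1, n.2, (op n).exec⟩].Sublist
      (κ.flatMap (open Classical in
        fun n => if n = w then [⟨w.1, w.2, .isu⟩] else eventsOf op n)) :=
  pair_sublist_flatMap hn hlt ((h.mem_chunk hm).2 ⟨rfl, ho⟩) ((h.mem_chunk hn).2 ⟨rfl, Or.inl rfl⟩)

theorem iss_lt_iss {m n : T × ℕ} (hm : m ∈ κ) (hn : n ∈ κ) (hlt : pos κ m < pos κ n) :
    g'.iss m < g'.iss n := by
  rw [h.realizes.iss_eq, h.realizes.iss_eq, (h.same hm).2, (h.same hn).2]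
  exact ((pair_sublist_iff h.realizes.nodup).1
    ((h.pos_lt_pos hm hn hlt (Or.inl rfl)).trans (List.sublist_append_left _ _))).2

theorem com_lt_iss {m n : T × ℕ} (hm : m ∈ κ) (hn : n ∈ κ) (hlt : pos κ m < pos κ n) (hw : m ≠ w) :
    g'.com m < g'.iss n := by
  rw [h.realizes.iss_eq, h.realizes.com_eq, (h.same hm).2, (h.same hn).2]
  exact ((pair_sublist_iff h.realizes.nodup).1
    ((h.pos_lt_pos hm hn hlt (Or.inr ⟨hw, rfl⟩)).trans (List.sublist_append_left _ _))).2

theorem lt_com {n : T × ℕ} (hn : n ∈ κ) :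
    g'.iss n < g'.com w ∧ (n ≠ w → g'.com n < g'.com w) := by
  have key : ∀ o, (o = (op n).exec ∨ n ≠ w ∧ o = op n) →
      pos (delayedSeq op κ w) ⟨n.1, n.2, o⟩ < g'.com w := fun o ho => by
    rw [h.realizes.com_eq, (h.same h.mem).2]
    refine ((pair_sublist_iff h.realizes.nodup).1 ?_).2
    exact (List.singleton_sublist.2 (List.mem_flatMap.2 ⟨n, hn, (h.mem_chunk hn).2
      ⟨rfl, ho⟩⟩)).append (List.Sublist.refl [_])
  rw [h.realizes.iss_eq, h.realizes.com_eq n, (h.same hn).2]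
  exact ⟨key _ (Or.inl rfl), fun hw => key _ (Or.inr ⟨hw, rfl⟩)⟩

theorem isDelayedStore {n : T × ℕ} (hn : n ∈ κ) (hlt : pos κ w < pos κ n) (ht : n.1 = w.1) :
    IsDelayedStore (delayedSeq op κ w) ⟨w.1, w.2, op w⟩ := by
  obtain ⟨a, v, hs⟩ := h.store
  refine ⟨⟨a, v, hs⟩, ⟨n.1, n.2, (op n).exec⟩, Or.inl ⟨a, v, hs⟩, ht,
    ⟨w.1, w.2, (op w).exec⟩, ?_, rfl, ?_⟩
  · simp [Event.IsIssue, hs, Op.exec]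
  · exact (h.pos_lt_pos h.mem hn hlt (Or.inl rfl)).append (List.Sublist.refl [_])

/-- Every store other than `w` directly follows its issue, which leaves no room for an overtaken
action. -/
theorem eq_of_isDelayedStore {y : Event Dom T} (hy : IsDelayedStore (delayedSeq op κ w) y) :
    y = ⟨w.1, w.2, op w⟩ := by
  classical
  obtain ⟨⟨a, hya⟩, c, -, -, i, hi, hin, hsub⟩ := hy
  have hnd := h.realizes.nodup
  have hym : y ∈ delayedSeq op κ w := hsub.subset (by simp)
  have him : i ∈ delayedSeq op κ w := hsub.subset (by simp)
  obtain ⟨hys, hye⟩ := h.realizes.eq_op hym hya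
  obtain ⟨hiv, hip⟩ := h.realizes.eq_issue him hi
  have hnκ := h.mem_of_valid hys.1
  rw [(h.same hnκ).2] at hye
  by_cases hw : y.node = w
  · rw [hye, hw]
  · exfalso
    have h1 : pos (delayedSeq op κ w) i < pos (delayedSeq op κ w) c :=
      ((pair_sublist_iff hnd).1 (List.Sublist.trans (by simp) hsub)).2
    have h2 : pos (delayedSeq op κ w) c < pos (delayedSeq op κ w) y :=
      ((pair_sublist_iff hnd).1 (List.Sublist.trans (by simp) hsub)).2
    have hyc : pos (delayedSeq op κ w) y = g'.com y.node := by
      rw [h.realizes.com_eq, (h.same hnκ).2, ← hye]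
    rw [hip, hin] at h1
    have h3 : g'.com y.node = g'.iss y.node + 1 := by
      obtain ⟨-, v, hv⟩ := hys
      rw [(h.same hnκ).2] at hv
      rw [h.realizes.com_eq, h.realizes.iss_eq, (h.same hnκ).2, hv,
        show (Op.st a v).exec = .isu from rfl]
      generalize y.node = n at *
      obtain ⟨κ₁, κ₂, rfl⟩ := List.append_of_mem hnκ
      have hτ : delayedSeq op (κ₁ ++ n :: κ₂) w =
          κ₁.flatMap (fun n => if n = w then [⟨w.1, w.2, .isu⟩] else eventsOf op n) ++
          ⟨n.1, n.2, .isu⟩ :: ⟨n.1, n.2, .st a v⟩ ::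
          (κ₂.flatMap (fun n => if n = w then [⟨w.1, w.2, .isu⟩] else eventsOf op n) ++
            [⟨w.1, w.2, op w⟩]) := by
        simp [delayedSeq, hw, eventsOf, hv]
      rw [hτ] at hnd ⊢
      have hd := (List.nodup_append.1 hnd).2.2
      rw [pos_append_of_notMem fun hm => hd _ hm _ (by simp) rfl,
        pos_append_of_notMem fun hm => hd _ hm _ (by simp) rfl]
      simp [pos]
    omega

end IsDelayedSeq

end Delayed

/-! ### The instance that closes the first cycle -/

section Critical

variable {Dom : Type u} {T : Type v}

namespace Graph

/-- Happens-before between instances executed before time `N`. -/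
def HBUpTo (g : Graph Dom T) (N : ℕ) (m n : T × ℕ) : Prop :=
  g.iss m < N ∧ g.iss n < N ∧ g.HB m n

theorem HB.valid {g : Graph Dom T} {m n : T × ℕ} (h : g.HB m n) : g.Valid m ∧ g.Valid n := by
  rcases h with ⟨ht, hl, hv⟩ | ⟨a, hm, hn, -⟩ | ⟨a, hn, hs⟩ | ⟨a, hm, hn, -⟩
  · refine ⟨?_, hv⟩
    simp only [Valid, ht] at hv ⊢
    omega
  · exact ⟨hm.1, hn.1⟩
  · exact ⟨hs.stores.1, hn.1⟩
  · exact ⟨hm.1, hn.1⟩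

theorem HB.irrefl {g : Graph Dom T} {n : T × ℕ} : ¬ g.HB n n := by
  rintro (⟨-, hl, -⟩ | ⟨a, -, -, hl⟩ | ⟨a, hn, hs⟩ | ⟨a, hm, hn, -⟩)
  · exact lt_irrefl _ hl
  · exact lt_irrefl _ hl
  · exact hs.stores.not_loads hn
  · exact hn.not_loads hm

end Graph

/-- Serves to rotate a cycle so that it starts at the last executed instance, or to find that it
avoids that instance and is therefore not minimal. -/
theorem transGen_avoiding {α : Type u} {r : α → α → Prop} {v x y : α}
    (h : Relation.TransGen r x y) :
    Relation.TransGen (fun a b => r a b ∧ a ≠ v ∧ b ≠ v) x y ∨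
      (Relation.ReflTransGen r x v ∧ Relation.ReflTransGen r v y) := by
  induction h with
  | @single b hb =>
    by_cases hx : x = v
    · exact Or.inr ⟨hx ▸ .refl, hx ▸ .single hb⟩
    · by_cases hbv : b = v
      · exact Or.inr ⟨hbv ▸ .single hb, hbv ▸ .refl⟩
      · exact Or.inl (.single ⟨hb, hx, hbv⟩)
  | @tail b c hab hbc ih =>
    by_cases hcv : c = v
    · exact Or.inr ⟨hcv ▸ (hab.tail hbc).to_reflTransGen, hcv ▸ .refl⟩
    · by_cases hbv : b = v
      · exact Or.inr ⟨hbv ▸ hab.to_reflTransGen, hbv ▸ .single hbc⟩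
      · rcases ih with ih | ⟨h1, h2⟩
        · exact Or.inl (ih.tail ⟨hbc, hbv, hcv⟩)
        · exact Or.inr ⟨h1, h2.tail hbc⟩

/-- Cut the path at its last visit to `v`. -/
theorem exists_return_path {α : Type u} {r : α → α → Prop} {v z : α} (h : Relation.TransGen r v z)
    (hz : z ≠ v) :
    ∃ w, r v w ∧ w ≠ v ∧
      Relation.ReflTransGen (fun a b => r a b ∧ a ≠ v ∧ b ≠ v) w z := by
  induction h with
  | single hb => exact ⟨_, hb, hz, .refl⟩
  | @tail b c _ hbc ih =>
    by_cases hbv : b = v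
    · exact ⟨c, hbv ▸ hbc, hz, .refl⟩
    · obtain ⟨w, h1, h2, h3⟩ := ih hbv
      exact ⟨w, h1, h2, h3.tail ⟨hbc, hbv, hz⟩⟩

variable {R : T → Type w} {L : Type x} [Zero Dom] {P : Program Dom T R L}
  {τ : List (Event Dom T)} {g : Graph Dom T}

namespace Realizes

variable (h : Realizes P τ g)
include h

/-- The first instance whose execution closes a happens-before cycle. -/
theorem exists_critical {n : T × ℕ} (hn : Relation.TransGen g.HB n n) :
    ∃ v u y, (∀ x, ¬ Relation.TransGen (g.HBUpTo (g.iss v)) x x) ∧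
      g.HB v u ∧ g.iss u < g.iss v ∧ Relation.ReflTransGen (g.HBUpTo (g.iss v)) u y ∧
      g.HB y v ∧ g.iss y < g.iss v := by
  classical
  have hex : ∃ N, ∃ x, Relation.TransGen (g.HBUpTo N) x x := by
    refine ⟨τ.length, n, ?_⟩
    have : ∀ m, Relation.TransGen g.HB n m → Relation.TransGen (g.HBUpTo τ.length) n m := by
      intro m hm
      have hlift : ∀ a b, g.HB a b → g.HBUpTo τ.length a b := fun a b hab =>
        ⟨h.consistent.iss_lt a hab.valid.1, h.consistent.iss_lt b hab.valid.2, hab⟩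
      induction hm with
      | single hb => exact .single (hlift _ _ hb)
      | tail _ hb ih => exact ih.tail (hlift _ _ hb)
    exact this n hn
  obtain ⟨x, hx⟩ := Nat.find_spec hex
  have hmin := fun N (hN : N < Nat.find hex) => Nat.find_min hex hN
  generalize Nat.find hex = N₀ at hx hmin
  obtain ⟨N, rfl⟩ : ∃ N, N₀ = N + 1 := by
    cases N₀ with
    | zero =>
      obtain ⟨z, ⟨h1, -⟩, -⟩ := Relation.TransGen.head'_iff.1 hx
      omega
    | succ N => exact ⟨N, rfl⟩
  have hac := hmin N (by omega)
  push Not at hac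
  have hmono : ∀ {r : T × ℕ → T × ℕ → Prop}, (∀ a b, r a b → g.HBUpTo N a b) →
      ∀ {a b}, Relation.TransGen r a b → Relation.TransGen (g.HBUpTo N) a b := fun hr a b hab => by
    induction hab with
    | single hb => exact .single (hr _ _ hb)
    | tail _ hb ih => exact ih.tail (hr _ _ hb)
  by_cases hv : ∃ v, g.Valid v ∧ g.iss v = N
  · obtain ⟨v, hv, rfl⟩ := hv
    -- Issue times are distinct, so `v` is the only instance executed at the last moment; edges that
    -- avoid it lie strictly before.
    have hr : ∀ a b, g.HBUpTo (g.iss v + 1) a b ∧ a ≠ v ∧ b ≠ v → g.HBUpTo (g.iss v) a b := by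
      rintro a b ⟨⟨h1, h2, h3⟩, ha, hb⟩
      have h4 : g.iss a ≠ g.iss v := fun he => ha (h.iss_inj h3.valid.1 hv he)
      have h5 : g.iss b ≠ g.iss v := fun he => hb (h.iss_inj h3.valid.2 hv he)
      exact ⟨by omega, by omega, h3⟩
    have hvv : Relation.TransGen (g.HBUpTo (g.iss v + 1)) v v := by
      rcases transGen_avoiding (v := v) hx with hx' | ⟨h1, h2⟩
      · exact absurd (hmono hr hx') (hac x)
      · rcases Relation.reflTransGen_iff_eq_or_transGen.1 h1 with h1 | h1
        · subst h1
          exact hx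
        · exact Relation.TransGen.trans_right h2 h1
    obtain ⟨y, hvy, hyv⟩ := Relation.TransGen.tail'_iff.1 hvv
    have hyne : y ≠ v := by rintro rfl; exact hyv.2.2.irrefl
    rcases Relation.reflTransGen_iff_eq_or_transGen.1 hvy with hvy | hvy
    · exact absurd hvy hyne
    · obtain ⟨u, hvu, hune, hpath⟩ := exists_return_path hvy hyne
      have h1 : g.iss u ≠ g.iss v := fun he => hune (h.iss_inj hvu.2.2.valid.2 hv he)
      have h2 : g.iss y ≠ g.iss v := fun he => hyne (h.iss_inj hyv.2.2.valid.1 hv he)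
      have h3 := hvu.2.1
      have h4 := hyv.1
      refine ⟨v, u, y, hac, hvu.2.2, by omega, hpath.lift id hr, hyv.2.2, by omega⟩
  -- If no instance is executed at time `N`, the cycle already exists before `N`, against
  -- minimality.
  · refine absurd (hmono (fun a b hab => ?_) hx) (hac x)
    obtain ⟨h1, h2, h3⟩ := hab
    have h4 : g.iss a ≠ N := fun he => hv ⟨a, h3.valid.1, he⟩
    have h5 : g.iss b ≠ N := fun he => hv ⟨b, h3.valid.2, he⟩
    exact ⟨by omega, by omega, h3⟩

/-- An instance that happens before an earlier executed one conflicts with a pending store of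
another thread. -/
theorem pending_of_hb {v u : T × ℕ} (hb : g.HB v u) (hlt : g.iss u < g.iss v) :
    ∃ a, g.Stores u a ∧ g.iss v < g.com u ∧ u.1 ≠ v.1 ∧
      ((g.Stores v a ∧ g.com v < g.com u) ∨
        (g.Loads v a ∧ ∀ k, g.Source a k v → g.com k < g.com u)) := by
  have hidx : u.1 = v.1 → u.2 < v.2 := by
    have hv := hb.valid
    obtain ⟨t, i⟩ := v
    obtain ⟨t', j⟩ := u
    rintro ht
    simp only at ht
    subst ht
    exact (h.iss_lt_iff hv.2 hv.1).1 hlt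
  have hfifo : ∀ k k' : T × ℕ, ∀ a, k.1 = k'.1 → g.Stores k a → g.Stores k' a → k.2 < k'.2 →
      g.com k < g.com k' := by
    rintro ⟨t, i⟩ ⟨t', j⟩ a ht hi hj hij
    simp only at ht
    subst ht
    exact h.consistent.fifo t i j a hij hi hj (h.com_lt_length hj.1)
  rcases hb with ⟨ht, hl, hv⟩ | ⟨a, hva, hua, hc⟩ | ⟨a, hul, hs⟩ | ⟨a, hvl, hua, hk⟩
  · have := hidx ht.symm
    omega
  · have := h.consistent.iss_lt_com v a hva
    refine ⟨a, hua, by omega, fun ht => ?_, Or.inl ⟨hva, hc⟩⟩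
    have := hfifo u v a ht hua hva (hidx ht)
    omega
  · exfalso
    rcases hs with ⟨⟨-, ht, hl, -⟩, -⟩ | ⟨-, hva, hc, -⟩
    · have := hidx ht.symm
      omega
    · have := h.consistent.iss_lt_com v a hva
      omega
  · obtain ⟨x, hx⟩ := hvl.2
    have hread := h.consistent.read v a x hvl.1 hx
    have hne := h.com_ne_iss hua hvl.1
    -- Had `u` committed before the load `v`, the source of `v` would commit no earlier than `u`,
    -- and there would be no conflict.
    have hcu : g.iss v < g.com u := by
      by_contra hcu
      have hcu' : g.com u < g.iss v := by omega
      rcases hread with ⟨k, -, hs⟩ | ⟨-, -, hs⟩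
      · have h5 := hk k hs
        rcases hs with ⟨hp, -⟩ | ⟨-, -, -, hl⟩
        · exact hp.2.2.2 (by omega)
        · have := hl u hua hcu'
          omega
      · exact hs u hua hcu'
    -- If `u` belonged to the thread of `v`, it would be pending at `v`; the source would then be
    -- `u` or a store issued after it, which by FIFO does not commit before `u`.
    refine ⟨a, hua, hcu, fun ht => ?_, Or.inr ⟨hvl, hk⟩⟩
    have hpu : g.Pending a u v := ⟨hua, ht, hidx ht, by omega⟩
    rcases hread with ⟨k, -, hs⟩ | ⟨-, hno, -⟩
    · have h5 := hk k hs
      rcases hs with ⟨hp, hle⟩ | ⟨hno, -⟩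
      · have hku : u.1 = k.1 := ht.trans hp.2.1.symm
        rcases Nat.lt_or_eq_of_le (hle u hpu) with hl | he
        · have := hfifo u k a hku hua hp.1 hl
          omega
        · rw [show u = k from Prod.ext hku he] at h5
          exact lt_irrefl _ h5
      · exact hno u hpu
    · exact hno u hpu

end Realizes

end Critical

/-! ### The violation with a single delayed store -/

section Construction

variable {Dom : Type u} {T : Type v} {R : T → Type w} {L : Type x}

theorem flatMap_congr_op {op op' : T × ℕ → Op Dom} {σ : List (T × ℕ)}
    (h : ∀ n ∈ σ, op n = op' n) : σ.flatMap (eventsOf op) = σ.flatMap (eventsOf op') := by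
  refine List.flatMap_congr fun n hn => ?_
  simp only [eventsOf, h n hn]

variable [Zero Dom] {P : Program Dom T R L} {τ : List (Event Dom T)} {g : Graph Dom T}

/-- A step can be repeated with loads returning any given values. -/
theorem Program.LocalStep.exists_reading {t : T} {c c' : L × (R t → Dom)} {o : Op Dom}
    (h : P.LocalStep t c o c') (f : Dom → Dom) :
    ∃ o' c'', P.LocalStep t c o' c'' ∧ (∀ b x, o' = .ld b x → x = f b) ∧
      (∀ b x, o = .st b x → o' = .st b x) ∧ ∀ b x, o = .ld b x → ∃ x', o' = .ld b x' := by
  cases h with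
  | @load l l' ρ r e v hi =>
    exact ⟨_, _, .load (f (e.eval ρ)) hi, by rintro b x ⟨⟩; rfl, by simp, by simp⟩
  | store hi => exact ⟨_, _, .store hi, by simp, by simp, by simp⟩
  | scfence hi => exact ⟨_, _, .scfence hi, by simp, by simp, by simp⟩
  | assign hi => exact ⟨_, _, .assign hi, by simp, by simp, by simp⟩
  | assert hi he => exact ⟨_, _, .assert hi he, by simp, by simp, by simp⟩

/-- Only the configurations reached within `σ` matter. This allows the configuration after `v` to be
replaced when `v` loads a new value. -/
theorem Replays.congr_cfg {cfg cfg' : (t : T) → ℕ → L × (R t → Dom)} {τ : List (Event Dom T)}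
    {σ : List (T × ℕ)} {μ : Dom → Dom} {β : T → Dom → List (Dom × ℕ)}
    (h : Replays P cfg τ σ μ β) (h0 : ∀ t, cfg' t 0 = cfg t 0)
    (hσ : ∀ n ∈ σ, cfg' n.1 (n.2 + 1) = cfg n.1 (n.2 + 1)) : Replays P cfg' τ σ μ β := by
  obtain ⟨k, hk, hr⟩ := h
  have : ∀ t, cfg' t (k t) = cfg t (k t) := fun t => by
    rcases Nat.eq_zero_or_pos (k t) with h | h
    · rw [h, h0]
    · have := hσ (t, k t - 1) ((hk _ _).1 (by omega))
      rwa [Nat.sub_add_cancel h] at this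
  refine ⟨k, hk, ?_⟩
  have he : stateAt cfg' k μ β = stateAt cfg k μ β := by
    simp [stateAt, this]
  rwa [he]

/-- Write `σ` as `A ++ w :: B`. The part `A` runs with empty buffers, `w` is only issued, and `B`
runs with `w` buffered without noticing it. Then `v`, in another thread, sees only memory and may
load a new value, which is why its operation is fixed only up to the value of a load. -/
theorem Realizes.exists_delayedSeq (h : Realizes P τ g) {σ : List (T × ℕ)}
    (hl : g.Linearization σ) {w v : T × ℕ} {a : Dom} (hw : w ∈ σ) (hwa : g.Stores w a)
    (hpend : ∀ n ∈ σ, g.iss n < g.com w)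
    (hmax : ∀ n ∈ σ, g.Stores n a → g.com n ≤ g.com w) (hv : g.Valid v) (hvσ : v ∉ σ)
    (hpre : ∀ j < v.2, (v.1, j) ∈ σ) (hwv : w.1 ≠ v.1) :
    ∃ op, delayedSeq op (σ ++ [v]) w ∈ P.Comp ∧ (∀ n ∈ σ, op n = g.op n) ∧
      (op v ≠ .isu ∧ ∀ as, op v ≠ .fence as) ∧
      (∀ b x, g.op v = .st b x → op v = .st b x) ∧
      ∀ b x, g.op v = .ld b x → ∃ x', op v = .ld b x' := by
  classical
  obtain ⟨A, B, rfl⟩ := List.append_of_mem hw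
  choose cfg hcfg using h.run
  obtain ⟨u, hwu⟩ := hwa.2
  have hnd := hl.nodup
  have hordB : ∀ n ∈ B, pos (A ++ w :: B) w < pos (A ++ w :: B) n := fun n hn =>
    (pos_lt_of_split hnd).2 hn
  have hmemB : ∀ n ∈ B, n ∈ A ++ w :: B := fun n hn => by simp [hn]
  -- Since `w` commits last among the stores of `σ` to `a`, all others precede it in `σ`.
  have hnst : ∀ n ∈ B, ∀ x, g.op n ≠ .st a x := fun n hn x hx => by
    have hns : g.Stores n a := ⟨hl.valid n (hmemB n hn), x, hx⟩
    have hne : n ≠ w := by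
      rintro rfl; exact lt_irrefl _ (hordB n hn)
    have hc : g.com n ≠ g.com w := fun hc => hne (h.com_inj hns.1 hwa.1 hc)
    have := hmax n (hmemB n hn) hns
    have := hl.ordered n (hmemB n hn) w hw (Or.inr (Or.inl ⟨a, hns, hwa, by omega⟩))
    have := hordB n hn
    omega
  have hsplitA : ∀ A₁ n A₂, A = A₁ ++ n :: A₂ → A ++ w :: B = A₁ ++ n :: (A₂ ++ w :: B) := by
    rintro A₁ n A₂ rfl; simp
  have hsplitB : ∀ B₁ n B₂, B = B₁ ++ n :: B₂ → A ++ w :: B = (A ++ w :: B₁) ++ n :: B₂ := by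
    rintro B₁ n B₂ rfl; simp
  have h1 := (Replays.nil (P := P) (cfg := cfg) fun t => (hcfg t).1).steps (op := g.op) A (by
    intro A₁ n A₂ hA
    obtain ⟨h1, h2, h3⟩ := hl.split (hsplitA A₁ n A₂ hA)
    refine ⟨by simpa using h2, by simpa using h3, (hcfg n.1).2 n.2 (hl.valid n h1), ?_, ?_, ?_⟩
    · exact fun b v hb => Or.inl ⟨rfl, (hl.memAfter_eq h (hsplitA A₁ n A₂ hA) hb).symm⟩
    · exact fun _ _ _ => rfl
    · exact fun _ _ => rfl)
  simp only [List.nil_append] at h1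
  obtain ⟨-, hwA, hpreA⟩ := hl.split rfl
  have h2 := h1.issue hwA hpreA (hwu ▸ (hcfg w.1).2 w.2 hwa.1)
  have h3 := h2.steps (op := g.op) B (by
    intro B₁ n B₂ hB
    have hsp := hsplitB B₁ n B₂ hB
    have hnB : n ∈ B := by simp [hB]
    obtain ⟨h1, h2, h3⟩ := hl.split hsp
    refine ⟨by simpa using h2, by simpa using h3, (hcfg n.1).2 n.2 (hl.valid n h1), ?_, ?_, ?_⟩
    · intro b x hx
      have hmem := hl.memAfter_eq h hsp hx
      by_cases hb : b = a
      · subst hb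
        have hxu : x = u := by
          rw [← hmem]
          exact memAfter_last hwu (fun k hk => hnst k (by simp [hB, hk])) _
        have hnl : g.Loads n b := ⟨hl.valid n h1, x, hx⟩
        have hncf : ¬ g.CF n w := fun hcf => by
          have := hl.ordered n h1 w hw (Or.inr (Or.inr (Or.inr hcf)))
          have := hordB n hnB
          omega
        -- Any source other than `w` commits before `w`, and a missing source also gives a conflict;
        -- either would place `n` before `w`. So `n` reads `w`, and it does so from the buffer of
        -- its own thread because `w` commits only after `n` is executed.
        have ht : n.1 = w.1 := by
          rcases h.consistent.read n b x hnl.1 hx with ⟨m, -, hs⟩ | ⟨-, hno, hc⟩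
          · have hm := hl.src_closed n h1 m ⟨b, hnl, hs⟩
            have hle := hmax m hm hs.stores
            rcases Nat.lt_or_eq_of_le hle with hlt | heq
            · exact absurd ⟨b, hnl, hwa, fun k hk => by rwa [h.source_unique hk hs]⟩ hncf
            · obtain rfl := h.com_inj hs.stores.1 hwa.1 heq
              rcases hs with ⟨hp, -⟩ | ⟨-, -, hc, -⟩
              · exact hp.2.1.symm
              · have := hpend n h1; omega
          · refine absurd ⟨b, hnl, hwa, ?_⟩ hncf
            rintro k' (⟨hk', -⟩ | ⟨-, hk', hkc, -⟩)
            · exact absurd hk' (hno k')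
            · exact absurd hkc (hc k' hk')
        exact Or.inr ⟨w.2, by simp [singleBuffer, ht, hxu]⟩
      · refine Or.inl ⟨by simp [singleBuffer, hb], ?_⟩
        rw [← hmem, memAfter_append]
        refine memAfter_congr ?_ B₁
        exact Op.write_of_ne (fun v hv => by
          rw [hwu] at hv
          simp only [Op.st.injEq] at hv
          exact hb hv.1.symm) _
    · intro b x hx
      have hb : b ≠ a := by rintro rfl; exact hnst n hnB x hx
      simp [singleBuffer, hb]
    · intro hf b
      -- An `scfence` after `w` in the thread of `w` would have waited for `w` to commit, but `w` is
      -- still pending at every instance of `σ`.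
      have ht : n.1 ≠ w.1 := fun ht => by
        have hlt : w.2 < n.2 := by
          by_contra hge
          rcases Nat.lt_or_eq_of_le (not_lt.1 hge) with hlt | heq
          · have := hl.ordered n h1 w hw (Or.inl ⟨ht, hlt, hwa.1⟩)
            have := hordB n hnB
            omega
          · have := hordB n hnB
            rw [show n = w from Prod.ext ht heq] at this
            exact lt_irrefl _ this
        have hp := hpend n h1
        have hnv := hl.valid n h1
        obtain ⟨t, i⟩ := n
        obtain ⟨t', j⟩ := w
        simp only at ht
        subst ht
        have := h.consistent.scfence t j i a hlt hwa hnv hf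
        omega
      simp [singleBuffer, ht])
  -- The instance `v` is executed with the memory at hand, in which `w` is not yet visible.
  obtain ⟨o, c, hs, hsl, hs1, hs2⟩ := ((hcfg v.1).2 v.2 hv).exists_reading
    (memAfter g.op (memAfter g.op (fun _ => 0) A) B)
  set cfg' := Function.update cfg v.1 (Function.update (cfg v.1) (v.2 + 1) c) with hcfg'
  have hne : ∀ t j, (t, j) ≠ (v.1, v.2 + 1) → cfg' t j = cfg t j := fun t j hne => by
    by_cases ht : t = v.1
    · subst ht
      have hj : j ≠ v.2 + 1 := by rintro rfl; exact hne rfl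
      simp [hcfg', hj]
    · simp [hcfg', ht]
  have h4 := h3.congr_cfg (cfg' := cfg') (fun t => hne t 0 (by simp)) (fun n hn => hne _ _ (by
    intro he
    have : n = v := Prod.ext (Prod.mk.inj he).1 (Nat.succ_injective (Prod.mk.inj he).2)
    exact hvσ (by simpa [← this] using hn)))
  have hσ : A ++ [w] ++ B = A ++ w :: B := by simp
  set op := Function.update g.op v o with hop
  have hov : op v = o := by simp [hop]
  have hon : ∀ n ∈ A ++ w :: B, op n = g.op n := fun n hn => by
    have : n ≠ v := by rintro rfl; exact hvσ hn
    simp [hop, this]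
  have hβ : ∀ b, singleBuffer w a u v.1 b = [] := fun b => by simp [singleBuffer, hwv.symm]
  have h5 := h4.step (op := op) (n := v) (by rwa [hσ]) (by rwa [hσ])
    (by
      rw [hov, hne v.1 v.2 fun he => by simpa using congrArg Prod.snd he]
      simpa [hcfg'] using hs)
    (fun b x hx => Or.inl ⟨hβ b, hsl b x (hov ▸ hx)⟩) (fun b x _ => hβ b) (fun _ => hβ)
  refine ⟨op, ?_, hon, ?_, fun b x hx => hov ▸ hs1 b x hx, fun b x hx => hov ▸ hs2 b x hx⟩
  · have h6 := h5.commit.mem_Comp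
    convert h6 using 1
    have hA : ∀ n ∈ A, n ≠ w := by rintro n hn rfl; exact hwA hn
    have hB : ∀ n ∈ B, n ≠ w := by rintro n hn rfl; exact lt_irrefl _ (hordB n hn)
    have hvw : v ≠ w := by rintro rfl; exact hwv rfl
    have e1 : ∀ C : List (T × ℕ), (∀ n ∈ C, n ≠ w) → (∀ n ∈ C, n ∈ A ++ w :: B) →
        C.flatMap (fun n => if n = w then [⟨w.1, w.2, .isu⟩] else eventsOf op n) =
          C.flatMap (eventsOf g.op) := fun C hC hC' => by
      rw [← flatMap_congr_op (fun n hn => hon n (hC' n hn))]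
      exact List.flatMap_congr fun n hn => by simp [hC n hn]
    rw [delayedSeq, List.flatMap_append, List.flatMap_append, List.flatMap_cons, e1 A hA (by simp_all),
      e1 B hB hmemB, hon w hw, hwu]
    simp [hvw]
  · rw [hov]
    exact hs.op_ne

/-- From a happens-before cycle, a violation with a single delayed store. -/
theorem Realizes.exists_single_delay (hP : P.NoFence) (h : Realizes P τ g) {n : T × ℕ}
    (hn : Relation.TransGen g.HB n n) :
    ∃ τ', P.IsViolation τ' ∧ ∃! y, IsDelayedStore τ' y := by
  classical
  obtain ⟨v, u, y, hac, hvu, huv, hpath, hyv, hylt⟩ := h.exists_critical hn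
  obtain ⟨a, hua, hpu, -, hcase⟩ := h.pending_of_hb hvu huv
  -- the last step into `v` is not to the location of the conflict
  have hback : ∀ z, g.Stores z a → g.com z < g.com u → z ≠ y := by
    rintro z hz hc rfl
    exact hac u (Relation.TransGen.tail' hpath ⟨hylt, huv, Or.inr (Or.inl ⟨a, hz, hua, hc⟩)⟩)
  -- Store order and source edges into `v` are left out: the cycle does not return through them, and
  -- a source edge need not survive when `v` loads another value.
  let E : T × ℕ → Prop := fun z => g.iss z < g.iss v ∧ (g.PO z v ∨ g.CF z v)
  have hEy : E y := by
    refine ⟨hylt, ?_⟩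
    rcases hyv with hyv | ⟨b, hyb, hvb, hc⟩ | ⟨b, hvb, hs⟩ | hyv
    · exact Or.inl hyv
    · exfalso
      rcases hcase with ⟨hva, hc'⟩ | ⟨hva, -⟩
      · obtain rfl := hva.addr_eq hvb
        exact hback y hyb (hc.trans hc') rfl
      · exact hvb.not_loads hva
    · exfalso
      rcases hcase with ⟨hva, -⟩ | ⟨hva, hk⟩
      · exact hva.not_loads hvb
      · obtain rfl := hva.addr_eq hvb
        exact hback y hs.stores (hk y hs) rfl
    · exact Or.inr hyv
  have hEhb : ∀ z, E z → g.HB z v := fun z hz =>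
    hz.2.elim Or.inl fun hz => Or.inr (Or.inr (Or.inr hz))
  have hvv := hvu.valid.1
  -- Closing `E` under happens-before predecessors keeps all instances and sources that the replay
  -- needs.
  let D : T × ℕ → Prop := fun x => ∃ z, Relation.ReflTransGen (g.HBUpTo (g.iss v)) x z ∧ E z
  have hDlt : ∀ x, D x → g.iss x < g.iss v ∧ g.Valid x := by
    rintro x ⟨z, hxz, hz⟩
    rcases Relation.ReflTransGen.cases_head hxz with rfl | ⟨x', hx', -⟩
    · exact ⟨hz.1, (hEhb _ hz).valid.1⟩
    · exact ⟨hx'.1, hx'.2.2.valid.1⟩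
  have hDclosed : ∀ x m, D x → g.HB m x → g.iss m < g.iss v → D m := fun x m hx hm hmv => by
    have hxv := (hDlt x hx).1
    obtain ⟨z, hxz, hz⟩ := hx
    exact ⟨z, .head ⟨hmv, hxv, hm⟩ hxz, hz⟩
  have hDu : D u := ⟨y, hpath, hEy⟩
  -- the last store to the location of the conflict
  have hfin : {x | D x ∧ g.Stores x a}.Finite := h.finite_valid.subset fun x hx => hx.2.1
  obtain ⟨w, ⟨hDw, hwa⟩, hwmax⟩ := Set.exists_max_image _ g.com hfin ⟨u, hDu, hua⟩
  have hwmax' : ∀ x, D x → g.Stores x a → g.com x ≤ g.com w := fun x hx hxa => hwmax x ⟨hx, hxa⟩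
  have huw := hwmax' u hDu hua
  -- As `w` commits no earlier than `u`, the edge from `v` to `u` gives one from `v` to `w`. So `w`
  -- too is pending at `v` and belongs to another thread.
  have hvw : g.HB v w := by
    rcases hcase with ⟨hva, hc⟩ | ⟨hva, hk⟩
    · exact Or.inr (Or.inl ⟨a, hva, hwa, by omega⟩)
    · exact Or.inr (Or.inr (Or.inr ⟨a, hva, hwa, fun k hks => by have := hk k hks; omega⟩))
  obtain ⟨b, hwb, hpw, hwv, hcase⟩ := h.pending_of_hb hvw (hDlt w hDw).1
  obtain rfl := hwa.addr_eq hwb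
  have hfinD : {x | D x}.Finite := h.finite_valid.subset fun x hx => (hDlt x hx).2
  obtain ⟨σ, hnd, hmem, hord⟩ := exists_linear_extension hac hfinD.toFinset
  simp only [Set.Finite.mem_toFinset, Set.mem_ofPred_eq] at hmem hord
  have hpo_iss : ∀ m n, g.PO m n → g.iss m < g.iss n := by
    rintro ⟨t, i⟩ ⟨t', j⟩ ⟨ht, hlt, hv⟩
    simp only at ht
    subst ht
    exact h.consistent.po t i j hlt hv
  have hl : g.Linearization σ := by
    refine ⟨hnd, fun n hn => (hDlt n ((hmem n).1 hn)).2, fun n hn m hm => ?_, fun n hn m hm => ?_,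
      fun m hm n hn hb => ?_⟩
    · have hn' := (hmem n).1 hn
      have := hpo_iss m n hm
      have := (hDlt n hn').1
      exact (hmem m).2 (hDclosed n m hn' (Or.inl hm) (by omega))
    · have hn' := (hmem n).1 hn
      have hlt : g.iss m < g.iss n := by
        obtain ⟨b, hnb, ⟨hp, -⟩ | ⟨-, hms, hc, -⟩⟩ := hm
        · exact hpo_iss m n ⟨hp.2.1, hp.2.2.1, hnb.1⟩
        · have := h.consistent.iss_lt_com m b hms
          omega
      have := (hDlt n hn').1
      exact (hmem m).2 (hDclosed n m hn' (Or.inr (Or.inr (Or.inl hm))) (by omega))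
    · have hm' := (hmem m).1 hm
      have hn' := (hmem n).1 hn
      exact hord m hm' n hn' ⟨(hDlt m hm').1, (hDlt n hn').1, hb⟩
  have hwσ := (hmem w).2 hDw
  have hvσ : v ∉ σ := fun hv => lt_irrefl _ (hDlt v ((hmem v).1 hv)).1
  have hpend : ∀ n ∈ σ, g.iss n < g.com w := fun n hn => (hDlt n ((hmem n).1 hn)).1.trans hpw
  have hmaxσ : ∀ n ∈ σ, g.Stores n a → g.com n ≤ g.com w := fun n hn =>
    hwmax' n ((hmem n).1 hn)
  obtain ⟨op, hcomp, hon, hov, hst, hld⟩ := h.exists_delayedSeq hl hwσ hwa hpend hmaxσ hvv hvσ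
    (fun j hj => by
      have hpo : g.PO (v.1, j) v := ⟨rfl, hj, hvv⟩
      have := hpo_iss _ _ hpo
      exact (hmem _).2 ⟨_, .refl, this, Or.inl hpo⟩) hwv
  obtain ⟨g', h'⟩ := P.exists_realizes hP hcomp
  obtain ⟨x₀, hx₀⟩ := hwa.2
  have hseq : IsDelayedSeq P g' op (σ ++ [v]) w := by
    refine ⟨h', by simp [hwσ], ⟨a, x₀, (hon w hwσ).trans hx₀⟩, fun n hn => ?_⟩
    rcases List.mem_append.1 hn with hn | hn
    · rw [hon n hn]; exact h.op_ne (hl.valid n hn)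
    · rw [List.mem_singleton.1 hn]; exact hov
  have hκ : ∀ n ∈ σ, n ∈ σ ++ [v] := fun n hn => List.mem_append_left _ hn
  have hvκ : v ∈ σ ++ [v] := by simp
  have hposκ : ∀ m ∈ σ, ∀ n ∈ σ, pos σ m < pos σ n → pos (σ ++ [v]) m < pos (σ ++ [v]) n :=
    fun m hm n hn hlt => by rwa [pos_append_of_mem hm, pos_append_of_mem hn]
  have hposv : ∀ m ∈ σ, pos (σ ++ [v]) m < pos (σ ++ [v]) v := fun m hm =>
    pos_lt_pos_of_append hm hvσ
  have hp : g'.Performs g σ {w} := by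
    refine ⟨fun n hn => ⟨(hseq.same (hκ n hn)).1, (hseq.same (hκ n hn)).2.trans (hon n hn)⟩,
      fun n hn => ?_, fun m hm n hn hlt => hseq.iss_lt_iss (hκ m hm) (hκ n hn) (hposκ m hm n hn hlt),
      fun m hm n hn hlt hmw => hseq.com_lt_iss (hκ m hm) (hκ n hn) (hposκ m hm n hn hlt) hmw,
      ?_, ?_, ?_⟩
    · rcases List.mem_append.1 (hseq.mem_of_valid hn) with hn | hn
      · exact Or.inl hn
      · rw [List.mem_singleton.1 hn]
        exact Or.inr fun m hm => hseq.iss_lt_iss (hκ m hm) hvκ (hposv m hm)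
    · rintro m rfl n hn
      exact hseq.lt_com (hseq.mem_of_valid hn)
    · rintro m rfl n hn
      exact hpend n hn
    · rintro m rfl n hn b hb
      obtain rfl := hwa.addr_eq hb
      exact hmaxσ n hn
  have hv' := hseq.same hvκ
  have hvst : ∀ b, g.Stores v b → g'.Stores v b := fun b ⟨_, x, hx⟩ =>
    ⟨hv'.1, x, hv'.2.trans (hst b x hx)⟩
  have hwne : v ≠ w := by rintro rfl; exact hwv rfl
  have hcomv := hseq.lt_com hvκ
  have hwa' := (hp.stores_iff hl hwσ).2 hwa
  have hvw' : g'.HB v w := by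
    rcases hcase with ⟨hva, -⟩ | ⟨⟨-, x, hx⟩, -⟩
    · exact Or.inr (Or.inl ⟨a, hvst a hva, hwa', hcomv.2 hwne⟩)
    · obtain ⟨x', hx'⟩ := hld a x hx
      -- Whatever `v` now reads, it is not `w`, which is uncommitted and belongs to another thread;
      -- and every other store commits before `w`.
      refine Or.inr (Or.inr (Or.inr ⟨a, ⟨hv'.1, x', hv'.2.trans hx'⟩, hwa', fun k hk => ?_⟩))
      refine (hseq.lt_com (hseq.mem_of_valid hk.stores.1)).2 ?_
      rintro rfl
      rcases hk with ⟨hk, -⟩ | ⟨-, -, hk, -⟩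
      · exact hwv hk.2.1
      · have := hcomv.1
        omega
  have hEv : ∀ z ∈ σ, E z → g'.HB z v := by
    rintro z hz ⟨-, ⟨ht, hlt, -⟩ | ⟨b, hzb, hvb, hk⟩⟩
    · exact Or.inl ⟨ht, hlt, hv'.1⟩
    · refine Or.inr (Or.inr (Or.inr ⟨b, (hp.loads_iff hl hz).2 hzb, hvst b hvb, fun k hks => ?_⟩))
      have hks' := (hp.source_iff hl h h' hz hzb).1 hks
      have hkσ := hl.src_closed z hz k ⟨b, hzb, hks'⟩
      have hkv := hk k hks'
      -- If `v` is a store, it commits in `g` before `w` but after the source `k`; hence `k` is not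
      -- delayed and is in memory when `v` is issued.
      have hkw : k ≠ w := by
        rintro rfl
        rcases hcase with ⟨-, hc⟩ | ⟨hva, -⟩
        · omega
        · exact hvb.not_loads hva
      have := hseq.com_lt_iss (hκ k hkσ) hvκ (hposv k hkσ) hkw
      have := h'.consistent.iss_lt_com v b (hvst b hvb)
      omega
  have hcycle : Relation.TransGen g'.HB v v := by
    obtain ⟨z, hwz, hz⟩ := hDw
    have hpath' : ∀ x, Relation.ReflTransGen (g.HBUpTo (g.iss v)) x z →
        Relation.ReflTransGen g'.HB x z := fun x hx => by
      induction hx using Relation.ReflTransGen.head_induction_on with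
      | refl => exact .refl
      | head hab hbz ih =>
        exact .head (hp.hb hl h h' ((hmem _).2 ⟨z, .head hab hbz, hz⟩) ((hmem _).2 ⟨z, hbz, hz⟩)
          hab.2.2) ih
    exact Relation.TransGen.head' hvw' ((hpath' w hwz).tail (hEv z ((hmem z).2 ⟨z, .refl, hz⟩) hz))
  refine ⟨_, ⟨hcomp, ?_⟩, ⟨w.1, w.2, op w⟩, ?_, fun y hy => hseq.eq_of_isDelayedStore hy⟩
  · rintro ⟨τsc, hsc, htr⟩
    obtain ⟨gsc, hr⟩ := P.exists_realizes hP hsc.1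
    refine hr.acyclic_of_mem_SCComp hsc v ?_
    rw [htr]
    exact h'.transGen_iff.2 hcycle
  · obtain ⟨z, hwz, hz⟩ := hDw
    rcases Relation.ReflTransGen.cases_head hwz with rfl | ⟨x, hwx, hxz⟩
    · rcases hz.2 with hz | ⟨b, hz, -⟩
      · exact absurd hz.1 hwv
      · exact absurd hz hwa.not_loads
    · have hDx : D x := ⟨z, hxz, hz⟩
      have hxσ := (hmem x).2 hDx
      refine hseq.isDelayedStore (hκ x hxσ) (hposκ w hwσ x hxσ (hl.ordered w hwσ x hxσ hwx.2.2)) ?_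
      -- The edge from `w` to `x` stays in the thread of `w`: a store order edge contradicts the
      -- choice of `w`, a read from memory contradicts that `w` is pending, and a conflict does not
      -- start at a store.
      rcases hwx.2.2 with hb | ⟨b, hwb, hxb, hc⟩ | ⟨b, hxb, hs⟩ | ⟨b, hwb, -⟩
      · exact hb.1.symm
      · obtain rfl := hwa.addr_eq hwb
        have := hwmax' x hDx hxb
        omega
      · rcases hs with ⟨hs, -⟩ | ⟨-, -, hc, -⟩
        · exact hs.2.1.symm
        · have := hpend x hxσ
          omega
      · exact absurd hwb hwa.not_loads

end Construction

end StoreAtomic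

/-- A program without the lightweight fence instruction is not robust if and only if it has a
violation with exactly one delayed store. -/
theorem theorem2 {Dom T L : Type*} {R : T → Type*} [Zero Dom] [Finite T] [∀ t, Finite (R t)]
    (P : StoreAtomic.Program Dom T R L) (hP : P.NoFence) :
    ¬ P.Robust ↔
      ∃ τ : List (StoreAtomic.Event Dom T),
        P.IsViolation τ ∧ ∃! y : StoreAtomic.Event Dom T, StoreAtomic.IsDelayedStore τ y := by
  constructor
  · intro hr
    obtain ⟨_, ⟨τ, hτ, rfl⟩, hn⟩ := Set.not_subset.1 hr
    obtain ⟨g, h⟩ := P.exists_realizes hP hτ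
    -- The cycle comes from an arbitrary violation; the one with a single delay is built anew and in
    -- general has a different trace.
    by_cases hac : ∀ n, ¬ Relation.TransGen g.HB n n
    · exact absurd (h.exists_mem_SCComp hP hac) hn
    · push Not at hac
      obtain ⟨n, hcyc⟩ := hac
      exact h.exists_single_delay hP hcyc
  · rintro ⟨τ, ⟨hτ, hn⟩, -⟩ hr
    exact hn (hr ⟨τ, hτ, rfl⟩)
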